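/- **Setting.** Let $0<K<N$ be integers. Let $H\in\mathbb C^{K\times N}$ have i.i.d. $\mathcal{CN}(0,1)$ entries ($K$ single-antenna users, $N$ transmit antennas) and let the noise variance at each user be $\sigma_n^2>0$. In-phase/quadrature imbalance (IQI) at the transmitter turns the transmit vector $x$ into $A_1x+A_2x^*$ with diagonal $A_1,A_2$. Write $$\mathcal T(X)=\begin{bmatrix}\operatorname{Re}X&-\operatorname{Im}X\\ \operatorname{Im}X&\operatorname{Re}X\end{bmatrix},\qquad \tilde H=\mathcal T(H),\qquad \tilde A=\mathcal T(A_1)+\mathcal T(A_2)\operatorname{diag}(I_N,-I_N),$$ so that in real coordinates the channel is $\tilde H\tilde A$. The symbols of different users are uncorrelated with unit variance; in real coordinates, every stream has power $\tfrac12$ and every noise component variance $\tfrac12\sigma_n^2$. For transmit power $P_T$, * ZF (used without IQI) has precoder $\sqrt{\lambda_{ZF}}\,H^{\mathsf H}(HH^{\mathsf H})^{-1}$ with $\lambda_{ZF}=P_T/\mathbb E\operatorname{Tr}[(HH^{\mathsf H})^{-1}]$, and sum rate $C_{ZF}=\sum_{k=1}^K\log_2(1+\mathrm{SINR}_k)$;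 * WL-ZF has the real precoder $\sqrt{\lambda_{WL}}\,(\tilde H\tilde A)^{\mathsf T}(\tilde H\tilde A\tilde A^{\mathsf T}\tilde H^{\mathsf T})^{-1}$ with $\lambda_{WL}=2P_T/\mathbb E\operatorname{Tr}[(\tilde H\tilde A\tilde A^{\mathsf T}\tilde H^{\mathsf T})^{-1}]$, and sum rate $C_{WL}=\sum_{k=1}^{2K}\tfrac12\log_2(1+\mathrm{SINR}_k)$. It is called *well defined* if the inverse exists almost surely and the expectation is finite. The multiplexing gain of a sum rate $C(P_T)$ is $S^\infty=\lim_{P_T\to\infty}C(P_T)/\log_2P_T$, its power offset is $L^\infty=\lim_{P_T\to\infty}[\log_2P_T-C(P_T)/S^\infty]$; below they are taken for almost every realization of the channel and the IQ parameters, and are non-random. **Theorem.** 1. $\mathbb E\operatorname{Tr}[(HH^{\mathsf H})^{-1}]=\frac{K}{N-K}$ and $\mathbb E\operatorname{Tr}\big[H^{\mathsf H}(HH^{\mathsf H})^{-2}H\,\big(H^{\mathsf H}(HH^{\mathsf H})^{-1}H\big)^*\big]=\frac{K^2+K}{(N-K)(N+1)}$, where $^*$ is the entrywise complex conjugate (both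 traces are integrable). 2. Without IQI ($A_1=I$, $A_2=0$), WL-ZF is well defined, ZF and WL-ZF both have multiplexing gain $K$, and they have the same (finite) power offset. 3. With any random IQI for which WL-ZF is well defined, WL-ZF has multiplexing gain $K$, equal to that of ideal ZF, and a finite power offset. For the rest, let the diagonal entries of $A_1,A_2$ be $$a_{n1}=\frac{\cos(\theta_n/2)+\mathrm j\,g_n\sin(\theta_n/2)}{\sqrt{1+\sigma_g^2}},\qquad a_{n2}=\frac{g_n\cos(\theta_n/2)-\mathrm j\sin(\theta_n/2)}{\sqrt{1+\sigma_g^2}} .$$ For any random $g_n,\theta_n$, WL-ZF is well defined whenever, for some $c>0$, almost surely $\big||g_n|-1\big|\ge c$ and $|\cos\theta_n|\ge c$ for all $n$. Now let $\theta_1,\dots,\theta_N$ be i.i.d. with mean $0$ and variance $\sigma_\theta^2$, let $g_1,\dots,g_N$ be i.i.d. with mean $0$ and variance $\sigma_g^2$, and let $H$ be independent of $(g_n,\theta_n)_{n\le N}$. Let $\Delta=L^\infty_{WL}-L^\infty_{ZF}$ be the power-offset loss of WL-ZF relative to ZF without IQI, and put $\beta=K/N$. 4. (General distributions.) For every $\varepsilon>0$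 there are $\delta,C>0$, depending only on $K,N,\varepsilon$, such that, whenever WL-ZF is well defined, $$\Big|\Delta-\log_2\Big[1+(\sigma_\theta^2+4\sigma_g^2)\tfrac{K+1}{N+1}\Big]\Big|\le\varepsilon(\sigma_\theta^2+\sigma_g^2)+C\,\tau_\delta,$$ $$\tau_\delta=\mathbb E\Big[\Big(1+\sum_n(g_n^2+\theta_n^2)+\operatorname{Tr}[(\tilde H\tilde A\tilde A^{\mathsf T}\tilde H^{\mathsf T})^{-1}]\Big)\mathbf 1_{\{\max_n\max(|g_n|,|\theta_n|)>\delta\}}\Big],$$ and $|\Delta-\log_2(1+4\sigma_g^2\beta)|$ is at most the same bound plus $r=\frac1{\ln2}\big[\sigma_\theta^2\frac{K+1}{N+1}+4\sigma_g^2\frac{1-\beta}{N+1}\big]$, which is small when $N$ is large and $\sigma_\theta^2$ is small. 5. (Bounded mismatches.) For every $\varepsilon>0$ there is $\delta>0$, depending only on $K,N,\varepsilon$, such that if $|g_n|,|\theta_n|\le\delta$ almost surely for all $n$, then WL-ZF is well defined and $$\Big|\Delta-\log_2\Big[1+(\sigma_\theta^2+4\sigma_g^2)\tfrac{K+1}{N+1}\Big]\Big|\le\varepsilon(\sigma_\theta^2+\sigma_g^2),\qquad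 |\Delta-\log_2(1+4\sigma_g^2\beta)|\le\varepsilon(\sigma_\theta^2+\sigma_g^2)+r .$$ 6. (Gaussian gain mismatches.) For every $\varepsilon>0$ there is $\delta>0$, depending only on $K,N,\varepsilon$, such that if $g_n\sim\mathcal N(0,\sigma_g^2)$ with $\sigma_g\le\delta$, and $|\theta_n|\le\delta$ almost surely for all $n$, then WL-ZF is well defined if $N\ge K+3$, and whenever it is well defined both bounds of part 5 hold. -/

import Mathlib

open MeasureTheory ProbabilityTheory Filter Topology

universe u

noncomputable section

namespace WLZF

/-! ### Real-valued representation and IQ imbalance -/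

/-- The real representation `[Re X, -Im X; Im X, Re X]` of a complex matrix `X`. -/
def realRep {m n : Type*} (X : Matrix m n ℂ) : Matrix (m ⊕ m) (n ⊕ n) ℝ :=
  Matrix.fromBlocks (X.map Complex.re) (-(X.map Complex.im))
    (X.map Complex.im) (X.map Complex.re)

/-- `diag(I, -I)`, the real representation of complex conjugation of vectors. -/
def conjMat (n : Type*) [DecidableEq n] : Matrix (n ⊕ n) (n ⊕ n) ℝ :=
  Matrix.fromBlocks 1 0 0 (-1)

/-- The real matrix of the map `x ↦ A₁ x + A₂ x^*`, where `A₁ = diag(a₁)`, `A₂ = diag(a₂)`. -/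
def iqMat {n : Type*} [Fintype n] [DecidableEq n] (a₁ a₂ : n → ℂ) :
    Matrix (n ⊕ n) (n ⊕ n) ℝ :=
  realRep (Matrix.diagonal a₁) + realRep (Matrix.diagonal a₂) * conjMat n

/-- IQ coefficient of `x_n`, for gain mismatch `g` (of standard deviation `σg`) and phase
mismatch `θ`. -/
def iqCoeff₁ (σg g θ : ℝ) : ℂ :=
  ((1 / Real.sqrt (1 + σg ^ 2) : ℝ) : ℂ) *
    ((Real.cos (θ / 2) : ℂ) + Complex.I * ((g * Real.sin (θ / 2) : ℝ) : ℂ))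

/-- IQ coefficient of `x_n^*`. -/
def iqCoeff₂ (σg g θ : ℝ) : ℂ :=
  ((1 / Real.sqrt (1 + σg ^ 2) : ℝ) : ℂ) *
    (((g * Real.cos (θ / 2) : ℝ) : ℂ) - Complex.I * (Real.sin (θ / 2) : ℂ))

/-! ### Signal-to-interference-plus-noise ratio, multiplexing gain, power offset -/

/-- The SINR of stream `i` when the received signal is `Q s + n`, where the streams `s` are
uncorrelated with power `p` and the noise has power `ν` in every component. -/
def sinr {ι 𝕜 : Type*} [Fintype ι] [DecidableEq ι] [Norm 𝕜] (Q : Matrix ι ι 𝕜) (p ν : ℝ)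
    (i : ι) : ℝ :=
  p * ‖Q i i‖ ^ 2 / ((∑ j ∈ Finset.univ.erase i, p * ‖Q i j‖ ^ 2) + ν)

/-- The sum rate `C`, as a function of the transmit power, has multiplexing gain `S`. -/
def HasMultiplexingGain (C : ℝ → ℝ) (S : ℝ) : Prop :=
  Tendsto (fun PT => C PT / Real.logb 2 PT) atTop (𝓝 S)

/-- The sum rate `C`, of multiplexing gain `S`, has power offset `L`. -/
def HasPowerOffset (C : ℝ → ℝ) (S L : ℝ) : Prop :=
  Tendsto (fun PT => Real.logb 2 PT - C PT / S) atTop (𝓝 L)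

section Precoding

variable {Ω : Type u} [MeasurableSpace Ω] {K N : ℕ}

/-! ### Zero forcing with ideal IQ branches -/

/-- `Tr[(H Hᴴ)⁻¹]`. -/
def zfTrace (H : Matrix (Fin K) (Fin N) ℂ) : ℂ := ((H * H.conjTranspose)⁻¹).trace

/-- `Tr[Hᴴ (H Hᴴ)⁻² H (Hᴴ (H Hᴴ)⁻¹ H)^*]`, `^*` being the entrywise conjugate. -/
def mixedTrace (H : Matrix (Fin K) (Fin N) ℂ) : ℂ :=
  (H.conjTranspose * (H * H.conjTranspose)⁻¹ ^ 2 * H *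
    (H.conjTranspose * (H * H.conjTranspose)⁻¹ * H).map (starRingEnd ℂ)).trace

/-- The power normalization factor of ZF for transmit power `PT`. -/
def zfLambda (P : Measure Ω) (H : Ω → Matrix (Fin K) (Fin N) ℂ) (PT : ℝ) : ℝ :=
  PT / (∫ ω, zfTrace (H ω) ∂P).re

/-- The ZF precoder at the channel realization `H ω`. -/
def zfPrecoder (P : Measure Ω) (H : Ω → Matrix (Fin K) (Fin N) ℂ) (PT : ℝ) (ω : Ω) :
    Matrix (Fin N) (Fin K) ℂ :=
  (Real.sqrt (zfLambda P H PT) : ℂ) •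
    ((H ω).conjTranspose * (H ω * (H ω).conjTranspose)⁻¹)

/-- The sum rate of ZF without IQ imbalance; `σn ^ 2` is the noise variance. -/
def zfRate (P : Measure Ω) (H : Ω → Matrix (Fin K) (Fin N) ℂ) (σn : ℝ) (ω : Ω) (PT : ℝ) : ℝ :=
  ∑ k : Fin K, Real.logb 2 (1 + sinr (H ω * zfPrecoder P H PT ω) 1 (σn ^ 2) k)

/-! ### Widely-linear zero forcing with IQ coefficients `a₁`, `a₂` -/

/-- The effective real channel matrix. -/
def wlChannel (H : Matrix (Fin K) (Fin N) ℂ) (a₁ a₂ : Fin N → ℂ) :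
    Matrix (Fin K ⊕ Fin K) (Fin N ⊕ Fin N) ℝ :=
  realRep H * iqMat a₁ a₂

/-- The Gram matrix of the effective real channel. -/
def wlGram (H : Matrix (Fin K) (Fin N) ℂ) (a₁ a₂ : Fin N → ℂ) :
    Matrix (Fin K ⊕ Fin K) (Fin K ⊕ Fin K) ℝ :=
  wlChannel H a₁ a₂ * (wlChannel H a₁ a₂).transpose

/-- The trace of the inverse of the Gram matrix. -/
def wlTrace (H : Matrix (Fin K) (Fin N) ℂ) (a₁ a₂ : Fin N → ℂ) : ℝ :=
  ((wlGram H a₁ a₂)⁻¹).trace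

/-- The power normalization factor of WL-ZF for transmit power `PT`. -/
def wlLambda (P : Measure Ω) (H : Ω → Matrix (Fin K) (Fin N) ℂ) (a₁ a₂ : Ω → Fin N → ℂ)
    (PT : ℝ) : ℝ :=
  2 * PT / ∫ ω, wlTrace (H ω) (a₁ ω) (a₂ ω) ∂P

/-- The (real) WL-ZF precoder. -/
def wlPrecoder (P : Measure Ω) (H : Ω → Matrix (Fin K) (Fin N) ℂ) (a₁ a₂ : Ω → Fin N → ℂ)
    (PT : ℝ) (ω : Ω) : Matrix (Fin N ⊕ Fin N) (Fin K ⊕ Fin K) ℝ :=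
  Real.sqrt (wlLambda P H a₁ a₂ PT) •
    ((wlChannel (H ω) (a₁ ω) (a₂ ω)).transpose * (wlGram (H ω) (a₁ ω) (a₂ ω))⁻¹)

/-- The sum rate of WL-ZF: `2K` real streams of power `1/2`, noise power `σn ^ 2 / 2` each. -/
def wlRate (P : Measure Ω) (H : Ω → Matrix (Fin K) (Fin N) ℂ) (a₁ a₂ : Ω → Fin N → ℂ)
    (σn : ℝ) (ω : Ω) (PT : ℝ) : ℝ :=
  ∑ i : Fin K ⊕ Fin K, (1 / 2 : ℝ) * Real.logb 2
    (1 + sinr (wlChannel (H ω) (a₁ ω) (a₂ ω) * wlPrecoder P H a₁ a₂ PT ω)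
      (1 / 2) (σn ^ 2 / 2) i)

/-- WL-ZF is well defined: the inverse in its precoder exists almost surely, and the expectation
in its power normalization factor is finite. -/
structure WellDefined (P : Measure Ω) (H : Ω → Matrix (Fin K) (Fin N) ℂ)
    (a₁ a₂ : Ω → Fin N → ℂ) : Prop where
  isUnit_det : ∀ᵐ ω ∂P, IsUnit (wlGram (H ω) (a₁ ω) (a₂ ω)).det
  integrable : Integrable (fun ω => wlTrace (H ω) (a₁ ω) (a₂ ω)) P

/-- `Δ` is the power offset of WL-ZF with IQ coefficients `a₁`, `a₂` minus that of ZF with ideal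
IQ branches (both have multiplexing gain `K`). -/
def IsOffsetLoss (P : Measure Ω) (H : Ω → Matrix (Fin K) (Fin N) ℂ) (a₁ a₂ : Ω → Fin N → ℂ)
    (σn Δ : ℝ) : Prop :=
  ∃ LWL LZF : ℝ,
    (∀ᵐ ω ∂P, HasMultiplexingGain (wlRate P H a₁ a₂ σn ω) K ∧
      HasPowerOffset (wlRate P H a₁ a₂ σn ω) K LWL) ∧
    (∀ᵐ ω ∂P, HasMultiplexingGain (zfRate P H σn ω) K ∧
      HasPowerOffset (zfRate P H σn ω) K LZF) ∧
    Δ = LWL - LZF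

/-! ### Random models -/

/-- The entries of `H` are i.i.d. circularly symmetric complex Gaussian with mean zero and unit
variance: all real and imaginary parts are independent with law `N(0, 1/2)`. -/
structure IsRayleigh (P : Measure Ω) (H : Ω → Matrix (Fin K) (Fin N) ℂ) : Prop where
  re_law : ∀ k n, HasLaw (fun ω => (H ω k n).re) (gaussianReal 0 (1 / 2)) P
  im_law : ∀ k n, HasLaw (fun ω => (H ω k n).im) (gaussianReal 0 (1 / 2)) P
  indep : iIndepFun (fun (q : (Fin K × Fin N) ⊕ (Fin K × Fin N)) ω =>
    Sum.elim (fun r => (H ω r.1 r.2).re) (fun r => (H ω r.1 r.2).im) q) P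

/-- The real random variables `X n` are i.i.d. with mean zero and variance `σ ^ 2`. -/
structure IsIIDCentered (P : Measure Ω) (X : Fin N → Ω → ℝ) (σ : ℝ) : Prop where
  indep : iIndepFun X P
  ident : ∀ m n, IdentDistrib (X m) (X n) P P
  memLp : ∀ n, MemLp (X n) 2 P
  mean : ∀ n, ∫ ω, X n ω ∂P = 0
  var : ∀ n, variance (X n) P = σ ^ 2

/-- The random model: Rayleigh channel `H`, i.i.d. centered gain mismatches `g n`, i.i.d. centered
phase mismatches `θ n`, the channel being independent of the mismatches. -/
structure IsModel (P : Measure Ω) (H : Ω → Matrix (Fin K) (Fin N) ℂ) (g θ : Fin N → Ω → ℝ)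
    (σg σθ : ℝ) : Prop where
  channel : IsRayleigh P H
  gain_nonneg : 0 ≤ σg
  phase_nonneg : 0 ≤ σθ
  gain : IsIIDCentered P g σg
  phase : IsIIDCentered P θ σθ
  indep : IndepFun (fun ω (k : Fin K) (n : Fin N) => H ω k n)
    (fun ω (n : Fin N) => (g n ω, θ n ω)) P

/-- The random diagonal of `A₁` determined by the mismatches. -/
def diag₁ (σg : ℝ) (g θ : Fin N → Ω → ℝ) : Ω → Fin N → ℂ :=
  fun ω n => iqCoeff₁ σg (g n ω) (θ n ω)

/-- The random diagonal of `A₂` determined by the mismatches. -/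
def diag₂ (σg : ℝ) (g θ : Fin N → Ω → ℝ) : Ω → Fin N → ℂ :=
  fun ω n => iqCoeff₂ σg (g n ω) (θ n ω)

/-- The contribution of mismatches larger than `δ` to the second moments of the mismatches and to
the expected trace; it vanishes if no mismatch ever exceeds `δ` in absolute value. -/
def tailTerm (P : Measure Ω) (H : Ω → Matrix (Fin K) (Fin N) ℂ) (g θ : Fin N → Ω → ℝ)
    (σg δ : ℝ) : ℝ :=
  ∫ ω in {ω | ∃ n, δ < max |g n ω| |θ n ω|},
    (1 + (∑ n, ((g n ω) ^ 2 + (θ n ω) ^ 2)) +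
      wlTrace (H ω) (diag₁ σg g θ ω) (diag₂ σg g θ ω)) ∂P

end Precoding

/-- The second-order value of the power offset loss. -/
def lossApprox (K N : ℕ) (σg σθ : ℝ) : ℝ :=
  Real.logb 2 (1 + (σθ ^ 2 + 4 * σg ^ 2) * (((K : ℝ) + 1) / ((N : ℝ) + 1)))

/-- The simplified value of the power offset loss, in terms of `β = K / N`. -/
def lossLarge (σg β : ℝ) : ℝ := Real.logb 2 (1 + 4 * σg ^ 2 * β)

/-- The accuracy of the simplification at `β = K / N`; it tends to zero as `N → ∞`, `σθ → 0`. -/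
def simplificationError (K N : ℕ) (σg σθ : ℝ) : ℝ :=
  (σθ ^ 2 * (((K : ℝ) + 1) / ((N : ℝ) + 1)) +
    4 * σg ^ 2 * ((1 - (K : ℝ) / (N : ℝ)) / ((N : ℝ) + 1))) / Real.log 2

end WLZF

end

/-! Write `H̃`, `Ã` for the real representations, `T` for `wlTrace` and `t = K / (N - K)`. For both
schemes the channel times the precoder is a scalar matrix, so all streams have the same SINR and the
sum rate is exactly `K log₂ (1 + a P_T)`. This gives gain `K` and offset `-log₂ a`, and the loss is
`Δ = log₂ (E T / (2 t))` (`isOffsetLoss`). What remains is integrability of `T` and an expansion of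
`E T` to second order in the mismatches.

Integrability. If `Tr (M Mᵀ)⁻¹` is large, the form `q(x) = |Mᵀ x|²` is small at some point of a
chart `x k = 1`, hence on a box around it. So the trace is bounded by the integral of `q ^
(-(2K+1)/2)` over the charts (`trace_inv_le_chartIntegral`). By AM-GM, `q` dominates a product of
powers of the `2N` coordinates of `xᵀ H̃`, which for fixed `x` are i.i.d. Gaussian. Each coordinate
enters with exponent `-(2K+1)/(2N)`, which is larger than `-1` because `K < N`
(`lintegral_chanBound_lt_top`). The resulting bound is a function of `H` times one factor per
antenna depending on its gain, which is the form needed for unbounded gains.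

Exact moments. Gaussian integration by parts for `(H Hᴴ + ε)⁻¹ H`, where everything is bounded,
followed by `ε → 0`, gives `E Tr (H Hᴴ)⁻¹ = t` (`integral_zfTrace_re`). Put `p = Hᴴ (H Hᴴ)⁻¹ H` and
`q = Hᴴ (H Hᴴ)⁻² H`. The law of `H` is invariant under `H ↦ H U` for unitary `U`: diagonal `U` kills
the moments `E[q_ab p_cd]` with unbalanced indices, and a reflection mixing two antennas relates the
remaining ones. Together with `Tr p = K` and `q p = q` this determines `∑ E[q_nn p_nn] = t
(K+1)/(N+1)` (`sum_mixedMoment_diag`).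

Expansion. One has `Ã Ãᵀ = (1 + σg²)⁻¹ (1 + D)`, where `D` has size at most `4 δ` if all mismatches
are at most `δ ≤ 1`. In the expansion of the inverse, the first-order term contributes only `-2 ∑
g_n² q_nn`, and the leading part of the second-order term is `2 Re ∑ c_n c̄_m q_mn p_mn` with `c =
2g - jθ` (`abs_trace_inv_sub_le`). In expectation only `n = m` survives, so `E T` is approximately
`2 t (1 + σg²) (1 - σg² + (σθ² + 4σg²)(K+1)/(N+1))`, where the normalization cancels `-σg²` up to
fourth order.

Large mismatches. Their contribution is the tail term. If the variances are not small compared with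
`δ²`, the tail term dominates every other quantity; otherwise the expansion applies
(`IsModel.abs_ratio_sub_le`). The lower bound `E T ≥ 2 t / (4 N)` makes the logarithm Lipschitz with
a constant depending only on `N` (`exists_offsetLoss`). For bounded mismatches the tail vanishes.
For Gaussian gains it is of order `σg³`, hence negligible against `σg²`
(`IsModel.tailTerm_le_of_gaussian`). -/

namespace WLZF
open Matrix
open scoped ENNReal

/-! ### Quadratic forms of Gram matrices -/

section GramForm

variable {ι κ : Type*} [Fintype ι] [Fintype κ]

/-- The quadratic form `x ↦ |Mᵀ x|²` of the Gram matrix `M Mᵀ`. -/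
def gramForm (M : Matrix ι κ ℝ) (x : ι → ℝ) : ℝ := ∑ j, (x ᵥ* M) j ^ 2

/-- The squared Frobenius norm. -/
def frobSq (M : Matrix ι κ ℝ) : ℝ := ∑ i, ∑ j, M i j ^ 2

lemma gramForm_nonneg (M : Matrix ι κ ℝ) (x : ι → ℝ) : 0 ≤ gramForm M x :=
  Finset.sum_nonneg fun _ _ => sq_nonneg _

lemma gramForm_eq_dotProduct (M : Matrix ι κ ℝ) (x : ι → ℝ) :
    gramForm M x = x ⬝ᵥ ((M * Mᵀ) *ᵥ x) := by
  rw [← Matrix.mulVec_mulVec, Matrix.dotProduct_mulVec, Matrix.mulVec_transpose]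
  simp [gramForm, dotProduct, sq]

lemma gramForm_add_le (M : Matrix ι κ ℝ) (x y : ι → ℝ) :
    gramForm M (x + y) ≤ 2 * gramForm M x + 2 * gramForm M y := by
  simp only [gramForm, Matrix.add_vecMul, Pi.add_apply, Finset.mul_sum, ← Finset.sum_add_distrib]
  exact Finset.sum_le_sum fun j _ => by nlinarith [sq_nonneg ((x ᵥ* M) j - (y ᵥ* M) j)]

lemma gramForm_le_frobSq (M : Matrix ι κ ℝ) (x : ι → ℝ) :
    gramForm M x ≤ frobSq M * ∑ i, x i ^ 2 := by
  rw [gramForm, frobSq, Finset.sum_comm, Finset.sum_mul]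
  refine Finset.sum_le_sum fun j _ => ?_
  rw [mul_comm]
  exact Finset.sum_mul_sq_le_sq_mul_sq _ _ _

lemma gramForm_smul (M : Matrix ι κ ℝ) (c : ℝ) (x : ι → ℝ) :
    gramForm M (c • x) = c ^ 2 * gramForm M x := by
  simp [gramForm, Matrix.smul_vecMul, mul_pow, Finset.mul_sum]

lemma frobSq_nonneg (M : Matrix ι κ ℝ) : 0 ≤ frobSq M :=
  Finset.sum_nonneg fun _ _ => Finset.sum_nonneg fun _ _ => sq_nonneg _

variable [DecidableEq ι]

/-- Sum over the affine charts `x k = 1` of the integral of a negative power of the Gram form. -/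
noncomputable def chartIntegral (M : Matrix ι κ ℝ) : ℝ≥0∞ :=
  ∑ k, ∫⁻ y in Set.Icc (fun _ : ι => (-2 : ℝ)) (fun _ => 2),
    ENNReal.ofReal (gramForm M (Function.update y k 1)) ^ (-(((Fintype.card ι : ℝ) + 1) / 2))

/-- The constant comparing the chart integral with the trace of the inverse. -/
noncomputable def chartConst (m : ℕ) : ℝ := (2 + 2 * (m : ℝ)) ^ (((m : ℝ) + 1) / 2)

lemma chartConst_pos (m : ℕ) : 0 < chartConst m := by unfold chartConst; positivity

/-- Let `m = card ι`. Since the form is at most `Λ |x|²`, it stays below `(2 + 2m) l` on a box at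
`v` with sides `r = √(l/Λ)` in the `m - 1` free directions of the chart. The chart integral is
therefore at least a constant times `l ^ (-(m+1)/2) * r ^ (m-1) = l⁻¹ Λ ^ (-(m-1)/2)`; the exponent
`(m+1)/2` is chosen to leave exactly one power of `l⁻¹`. -/
lemma inv_le_chart (M : Matrix ι κ ℝ) {Λ l : ℝ} (hM : frobSq M ≤ Λ) (hl : 0 < l) (hlΛ : l ≤ Λ)
    (v : ι → ℝ) (k : ι) (hk : v k = 1) (hv : ∀ j, |v j| ≤ 1) (hvl : gramForm M v ≤ l) :
    ENNReal.ofReal l⁻¹ ≤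
      ENNReal.ofReal (chartConst (Fintype.card ι) * Λ ^ (((Fintype.card ι : ℝ) - 1) / 2)) *
        chartIntegral M := by
  have hΛ : 0 < Λ := hl.trans_le hlΛ
  set m := Fintype.card ι with hm
  have hm1 : 1 ≤ m := Fintype.card_pos_iff.2 ⟨k⟩
  set r := Real.sqrt (l / Λ) with hr
  have hr0 : 0 < r := Real.sqrt_pos.2 (by positivity)
  have hr1 : r ≤ 1 := Real.sqrt_le_one.2 ((div_le_one hΛ).2 hlΛ)
  have hr2 : Λ * r ^ 2 = l := by
    rw [hr, Real.sq_sqrt (by positivity)]; field_simp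
  -- Coordinate `k` is overwritten by `Function.update y k 1`, so it runs over the dummy interval
  -- `[0, 1]` of length one.
  set a : ι → ℝ := Function.update v k 0 with ha
  set b : ι → ℝ := Function.update (fun j => v j + r) k 1 with hb
  have hsub : Set.Icc a b ⊆ Set.Icc (fun _ : ι => (-2 : ℝ)) (fun _ => 2) := by
    intro y hy
    refine ⟨fun j => (?_ : (-2 : ℝ) ≤ y j), fun j => (?_ : y j ≤ 2)⟩
    · refine le_trans ?_ (hy.1 j)
      by_cases h : j = k
      · subst h; simp [ha]
      · simp only [ha, Function.update_of_ne h]; linarith [neg_le_of_abs_le (hv j)]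
    · refine le_trans (hy.2 j) ?_
      by_cases h : j = k
      · subst h; simp [hb]
      · simp only [hb, Function.update_of_ne h]; linarith [le_of_abs_le (hv j)]
  have hvol : volume (Set.Icc a b) = ENNReal.ofReal (r ^ (m - 1)) := by
    rw [Real.volume_Icc_pi, ← Finset.mul_prod_erase _ _ (Finset.mem_univ k)]
    rw [Finset.prod_congr rfl (g := fun _ => ENNReal.ofReal r)]
    · rw [Finset.prod_const, Finset.card_erase_of_mem (Finset.mem_univ k)]
      simp [ha, hb, ENNReal.ofReal_pow hr0.le, hm]
    · intro j hj
      have h := Finset.ne_of_mem_erase hj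
      simp [ha, hb, Function.update_of_ne h]
  have hpt : ∀ y ∈ Set.Icc a b, gramForm M (Function.update y k 1) ≤ (2 + 2 * m) * l := by
    intro y hy
    have hd : Function.update y k 1 = v + (Function.update y k 1 - v) := by simp
    rw [hd]
    refine (gramForm_add_le M _ _).trans ?_
    have h2 : gramForm M (Function.update y k 1 - v) ≤ Λ * (m * r ^ 2) := by
      refine (gramForm_le_frobSq M _).trans ?_
      gcongr
      calc ∑ i, (Function.update y k 1 - v) i ^ 2 ≤ ∑ _i : ι, r ^ 2 := by
            refine Finset.sum_le_sum fun j _ => ?_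
            by_cases h : j = k
            · subst h; simp [hk]; positivity
            · have h1 := hy.1 j
              have h2 := hy.2 j
              simp only [ha, hb, Function.update_of_ne h] at h1 h2
              simp only [Pi.sub_apply, Function.update_of_ne h]
              apply sq_le_sq' <;> linarith
        _ = m * r ^ 2 := by simp [hm]
    have h3 : Λ * (m * r ^ 2) = m * l := by rw [← hr2]; ring
    linarith
  have hint : ENNReal.ofReal ((2 + 2 * m) * l) ^ (-(((m : ℝ) + 1) / 2)) *
      ENNReal.ofReal (r ^ (m - 1)) ≤ chartIntegral M := by
    rw [← hvol, ← setLIntegral_const]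
    calc _ ≤ ∫⁻ y in Set.Icc a b, ENNReal.ofReal (gramForm M (Function.update y k 1)) ^
          (-(((m : ℝ) + 1) / 2)) := by
            refine setLIntegral_mono' measurableSet_Icc fun y hy => ?_
            rw [ENNReal.rpow_neg, ENNReal.rpow_neg]
            gcongr
            exact hpt y hy
      _ ≤ ∫⁻ y in Set.Icc (fun _ : ι => (-2 : ℝ)) (fun _ => 2),
          ENNReal.ofReal (gramForm M (Function.update y k 1)) ^ (-(((m : ℝ) + 1) / 2)) :=
            lintegral_mono_set hsub
      _ ≤ chartIntegral M :=
            Finset.single_le_sum (f := fun k => ∫⁻ y in Set.Icc (fun _ : ι => (-2 : ℝ)) (fun _ => 2),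
              ENNReal.ofReal (gramForm M (Function.update y k 1)) ^ (-(((m : ℝ) + 1) / 2)))
              (fun _ _ => zero_le) (Finset.mem_univ k)
  refine le_trans (le_of_eq ?_) (mul_le_mul_right hint _)
  rw [ENNReal.ofReal_rpow_of_pos (by positivity), ← ENNReal.ofReal_mul (by positivity),
    ← ENNReal.ofReal_mul (by unfold chartConst; positivity)]
  congr 1
  rw [chartConst, hr, ← Real.rpow_natCast, Real.sqrt_eq_rpow, ← Real.rpow_mul (by positivity),
    Nat.cast_sub hm1, Real.mul_rpow (by positivity) hl.le, Real.div_rpow hl.le hΛ.le,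
    Real.rpow_neg (by positivity), Real.rpow_neg hl.le]
  have e1 : (1 / 2 : ℝ) * ((m : ℝ) - (1 : ℕ)) = ((m : ℝ) - 1) / 2 := by push_cast; ring
  rw [e1]
  have e2 : l ^ (((m : ℝ) + 1) / 2) = l ^ (((m : ℝ) - 1) / 2) * l := by
    rw [← Real.rpow_add_one hl.ne']; congr 1; ring
  rw [e2]
  have p1 : 0 < Λ ^ (((m : ℝ) - 1) / 2) := Real.rpow_pos_of_pos hΛ _
  have p2 : 0 < l ^ (((m : ℝ) - 1) / 2) := Real.rpow_pos_of_pos hl _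
  have p3 : (0 : ℝ) < (2 + 2 * (m : ℝ)) ^ (((m : ℝ) + 1) / 2) := by positivity
  field_simp

lemma exists_abs_le_one_of_ne_zero {z : ι → ℝ} (hz : z ≠ 0) :
    ∃ k, 0 < |z k| ∧ (∀ j, |z j| ≤ |z k|) := by
  obtain ⟨i, hi⟩ := Function.ne_iff.1 hz
  obtain ⟨k, -, hk⟩ := Finset.exists_max_image Finset.univ (fun j => |z j|) ⟨i, Finset.mem_univ i⟩
  exact ⟨k, (abs_pos.2 hi).trans_le (hk i (Finset.mem_univ i)), fun j => hk j (Finset.mem_univ j)⟩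

/-- A kernel vector, divided by its largest entry, lies in a chart and has form zero. Then
`inv_le_chart` applies with `l = 1/(n+1)` for every `n`, which forces an infinite chart integral. -/
lemma isUnit_det_of_chartIntegral_ne_top (M : Matrix ι κ ℝ) (hJ : chartIntegral M ≠ ∞) :
    IsUnit (M * Mᵀ).det := by
  rw [isUnit_iff_ne_zero]
  intro h0
  obtain ⟨z, hz, hMz⟩ := Matrix.exists_mulVec_eq_zero_iff.2 h0
  obtain ⟨k, hk, hmax⟩ := exists_abs_le_one_of_ne_zero hz
  have hkz : z k ≠ 0 := abs_pos.1 hk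
  set v := (z k)⁻¹ • z with hv
  have hv0 : gramForm M v = 0 := by
    rw [hv, gramForm_smul, gramForm_eq_dotProduct, hMz]; simp
  set Λ := frobSq M + 1 with hΛ
  have hΛ0 : 1 ≤ Λ := by linarith [frobSq_nonneg M]
  set B := ENNReal.ofReal (chartConst (Fintype.card ι) * Λ ^ (((Fintype.card ι : ℝ) - 1) / 2)) *
        chartIntegral M with hB
  have hBtop : B ≠ ∞ := ENNReal.mul_ne_top ENNReal.ofReal_ne_top hJ
  have key : ∀ n : ℕ, ((n : ℝ≥0∞) + 1) ≤ B := by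
    intro n
    have h := inv_le_chart M (Λ := Λ) (l := ((n : ℝ) + 1)⁻¹) (by linarith) (by positivity)
      ((inv_le_one_of_one_le₀ (by linarith [n.cast_nonneg (α := ℝ)])).trans hΛ0) v k
      (by simp [hv, hkz]) (fun j => ?_) (by rw [hv0]; positivity)
    · rw [inv_inv] at h
      refine le_trans (le_of_eq ?_) h
      rw [ENNReal.ofReal_add (by positivity) zero_le_one]; simp
    · simp only [hv, Pi.smul_apply, smul_eq_mul, abs_mul, abs_inv]
      rw [inv_mul_le_iff₀ hk, mul_one]; exact hmax j
  obtain ⟨n, hn⟩ := ENNReal.exists_nat_gt hBtop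
  exact absurd ((key n).trans_lt' (ENNReal.lt_add_right (by simp) one_ne_zero)) (not_lt.2 hn.le)

/-- The trace of the inverse Gram matrix is bounded by the chart integral. -/
lemma trace_inv_le_chartIntegral (M : Matrix ι κ ℝ) {Λ : ℝ} (hM : frobSq M ≤ Λ)
    (hJ : chartIntegral M ≠ ∞) :
    ENNReal.ofReal ((M * Mᵀ)⁻¹).trace ≤ Fintype.card ι *
      (ENNReal.ofReal (chartConst (Fintype.card ι) * Λ ^ (((Fintype.card ι : ℝ) - 1) / 2)) *
        chartIntegral M) := by
  have hdet := isUnit_det_of_chartIntegral_ne_top M hJ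
  set G := M * Mᵀ with hG
  have hGT : Gᵀ = G := by simp [hG, Matrix.transpose_mul]
  have hmul : G * G⁻¹ = 1 := Matrix.mul_nonsing_inv _ hdet
  rw [Matrix.trace]
  refine (Finset.le_sum_of_subadditive ENNReal.ofReal (by simp)
    (fun _ _ => ENNReal.ofReal_add_le) _ _).trans ?_
  rw [show (Fintype.card ι : ℝ≥0∞) = (Finset.univ : Finset ι).card by simp, ← nsmul_eq_mul]
  refine Finset.sum_le_card_nsmul _ _ _ fun i _ => ?_
  rw [Matrix.diag_apply]
  -- The column `z = G⁻¹ eᵢ` satisfies `q(z) = z i = (G⁻¹) i i`. Divided by its largest entry `z k`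
  -- it lies in chart `k`, and there `q ≤ z i / (z k)² ≤ 1 / z i`.
  set z : ι → ℝ := fun j => G⁻¹ j i with hz
  have hGz : G *ᵥ z = Pi.single i 1 := by
    ext j
    have := congrFun (congrFun hmul j) i
    rw [Matrix.mul_apply, Matrix.one_apply] at this
    simp only [Matrix.mulVec, dotProduct, hz, this, Pi.single_apply]
  have hqz : gramForm M z = z i := by
    rw [gramForm_eq_dotProduct, hGz]; simp
  have hzne : z ≠ 0 := by
    intro h
    have := congrFun hGz i
    rw [h] at this; simp at this
  obtain ⟨k, hk, hmax⟩ := exists_abs_le_one_of_ne_zero hzne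
  have hkz : z k ≠ 0 := abs_pos.1 hk
  have hzi : 0 ≤ z i := by rw [← hqz]; exact gramForm_nonneg _ _
  rcases hzi.eq_or_lt with h0 | hpos
  · have : G⁻¹ i i = 0 := h0.symm
    simp [this]
  have hii : gramForm M (Pi.single i 1) ≤ Λ := by
    refine (gramForm_le_frobSq M _).trans ?_
    rw [Finset.sum_eq_single i] <;> simp +contextual [hM]
  -- Positivity of the form at `eᵢ - z / z i`; this yields the condition `l ≤ Λ` for `l = 1 / z i`.
  have hcs : 1 / z i ≤ gramForm M (Pi.single i 1) := by
    have hadd : gramForm M (Pi.single i 1 + (-(1 / z i)) • z) =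
        gramForm M (Pi.single i 1) - 1 / z i := by
      have e : gramForm M (Pi.single i 1 + (-(1 / z i)) • z) = gramForm M (Pi.single i 1) +
          2 * (-(1 / z i)) * (Pi.single i 1 ⬝ᵥ (G *ᵥ z)) + (-(1 / z i)) ^ 2 * gramForm M z := by
        rw [hG, ← Matrix.mulVec_mulVec, Matrix.dotProduct_mulVec, Matrix.mulVec_transpose]
        simp only [gramForm, Matrix.add_vecMul, Matrix.smul_vecMul, Pi.add_apply, Pi.smul_apply,
          dotProduct, Finset.mul_sum, ← Finset.sum_add_distrib, smul_eq_mul]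
        exact Finset.sum_congr rfl fun j _ => by ring
      rw [e, hGz, hqz]
      simp
      field_simp
      ring
    have := gramForm_nonneg M (Pi.single i 1 + (-(1 / z i)) • z)
    linarith
  set v := (z k)⁻¹ • z with hv
  have hvq : gramForm M v ≤ (z i)⁻¹ := by
    rw [hv, gramForm_smul, hqz]
    have h1 : z i ≤ |z k| := (le_abs_self _).trans (hmax i)
    rw [inv_pow, ← sq_abs, inv_mul_le_iff₀ (by positivity), ← div_eq_mul_inv, le_div_iff₀ hpos]
    nlinarith
  have h := inv_le_chart M (Λ := Λ) (l := (z i)⁻¹) hM (by positivity)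
    (by rw [← one_div]; exact hcs.trans hii) v k (by simp [hv, hkz]) (fun j => ?_) hvq
  · rwa [inv_inv] at h
  · simp only [hv, Pi.smul_apply, smul_eq_mul, abs_mul, abs_inv]
    rw [inv_mul_le_iff₀ hk, mul_one]; exact hmax j

end GramForm

/-! ### Order properties of the inverse -/

section Inverse

variable {ι : Type*} [Fintype ι] [DecidableEq ι]

/-- The form of `A` is nonnegative at `A⁻¹ x - y`. This is the variational description of `xᵀ A⁻¹ x`
as a supremum over `y`, from which antitonicity of inversion follows by choosing `y`. -/
lemma two_mul_dotProduct_sub_le {A : Matrix ι ι ℝ} (hA : A.PosDef) (x y : ι → ℝ) :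
    2 * (x ⬝ᵥ y) - y ⬝ᵥ (A *ᵥ y) ≤ x ⬝ᵥ (A⁻¹ *ᵥ x) := by
  have hdet : IsUnit A.det := (Matrix.isUnit_iff_isUnit_det A).1 hA.isUnit
  have hAT : Aᵀ = A := by simpa using hA.isHermitian.eq
  have h := hA.posSemidef.dotProduct_mulVec_nonneg (A⁻¹ *ᵥ x - y)
  have e1 : A *ᵥ (A⁻¹ *ᵥ x - y) = x - A *ᵥ y := by
    rw [Matrix.mulVec_sub, Matrix.mulVec_mulVec, Matrix.mul_nonsing_inv _ hdet, Matrix.one_mulVec]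
  have e2 : (A⁻¹ *ᵥ x) ⬝ᵥ (A *ᵥ y) = x ⬝ᵥ y := by
    rw [Matrix.dotProduct_mulVec, ← Matrix.mulVec_transpose, hAT, Matrix.mulVec_mulVec,
      Matrix.mul_nonsing_inv _ hdet, Matrix.one_mulVec]
  rw [e1] at h
  simp only [star_trivial, sub_dotProduct, dotProduct_sub, e2] at h
  rw [dotProduct_comm _ x, dotProduct_comm y x] at h
  linarith

/-- Inversion of positive definite matrices is antitone, with a scalar factor. -/
lemma dotProduct_inv_antitone {A B : Matrix ι ι ℝ} {c : ℝ} (hc : 0 < c) (hA : A.PosDef)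
    (hB : IsUnit B.det)
    (h : ∀ y, c * (y ⬝ᵥ (A *ᵥ y)) ≤ y ⬝ᵥ (B *ᵥ y)) (x : ι → ℝ) :
    c * (x ⬝ᵥ (B⁻¹ *ᵥ x)) ≤ x ⬝ᵥ (A⁻¹ *ᵥ x) := by
  -- With `y = c B⁻¹ x` and `s = xᵀ B⁻¹ x`, the hypothesis bounds `yᵀ A y` by `c s`, so the left
  -- side is at least `2 c s - c s`.
  have h1 := two_mul_dotProduct_sub_le hA x (c • (B⁻¹ *ᵥ x))
  have h2 := h (B⁻¹ *ᵥ x)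
  have e1 : B *ᵥ (B⁻¹ *ᵥ x) = x := by
    rw [Matrix.mulVec_mulVec, Matrix.mul_nonsing_inv _ hB, Matrix.one_mulVec]
  rw [e1, dotProduct_comm _ x] at h2
  simp only [dotProduct_smul, smul_dotProduct, Matrix.mulVec_smul, smul_eq_mul] at h1
  nlinarith

lemma trace_eq_sum_dotProduct (A : Matrix ι ι ℝ) :
    A.trace = ∑ i, (Pi.single i 1 : ι → ℝ) ⬝ᵥ (A *ᵥ Pi.single i 1) := by
  simp [Matrix.trace]

lemma trace_inv_antitone {A B : Matrix ι ι ℝ} {c : ℝ} (hc : 0 < c) (hA : A.PosDef)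
    (hB : IsUnit B.det)
    (h : ∀ y, c * (y ⬝ᵥ (A *ᵥ y)) ≤ y ⬝ᵥ (B *ᵥ y)) :
    c * (B⁻¹).trace ≤ (A⁻¹).trace := by
  rw [trace_eq_sum_dotProduct, trace_eq_sum_dotProduct, Finset.mul_sum]
  exact Finset.sum_le_sum fun i _ => dotProduct_inv_antitone hc hA hB h _

lemma posDef_of_le {A B : Matrix ι ι ℝ} {c : ℝ} (hc : 0 < c) (hA : A.PosDef) (hBT : Bᵀ = B)
    (h : ∀ y, c * (y ⬝ᵥ (A *ᵥ y)) ≤ y ⬝ᵥ (B *ᵥ y)) : B.PosDef := by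
  refine Matrix.PosDef.of_dotProduct_mulVec_pos (by simpa [Matrix.IsHermitian] using hBT) fun x hx => ?_
  have := hA.dotProduct_mulVec_pos hx
  simp only [star_trivial] at this ⊢
  exact lt_of_lt_of_le (by positivity) (h x)

lemma posDef_gram_of_isUnit {κ : Type*} [Fintype κ] {M : Matrix ι κ ℝ}
    (h : IsUnit (M * Mᵀ).det) : (M * Mᵀ).PosDef := by
  have := Matrix.posSemidef_self_mul_conjTranspose M
  rw [Matrix.conjTranspose_eq_transpose_of_trivial] at this
  exact this.posDef_iff_isUnit.2 ((Matrix.isUnit_iff_isUnit_det _).2 h)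

end Inverse
end WLZF

namespace WLZF
open Matrix
open scoped ENNReal NNReal

/-! ### Linear images of Gaussian vectors -/

section GaussianLaw

lemma sum_charExponent {α : Type*} [Fintype α] (f : α → ℂ) (w : ℂ) :
    ∑ i, (f i * 0 * Complex.I - w * f i ^ 2 / 2) = - (w / 2) * ∑ i, f i ^ 2 := by
  rw [Finset.mul_sum]
  exact Finset.sum_congr rfl fun i _ => by ring

/-- The image of an i.i.d. Gaussian vector under a map with adjoint `L'` satisfying
`|L' t|² = c |t|²` is again i.i.d. Gaussian. -/
lemma map_pi_gaussianReal {ι κ : Type*} [Fintype ι] [Fintype κ] (v c : ℝ≥0)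
    (L : (ι → ℝ) → κ → ℝ) (L' : (κ → ℝ) → ι → ℝ) (hL : Measurable L)
    (hadj : ∀ t x, ∑ j, t j * L x j = ∑ i, L' t i * x i)
    (hnorm : ∀ t, ∑ i, L' t i ^ 2 = c * ∑ j, t j ^ 2) :
    (Measure.pi fun _ : ι => gaussianReal 0 v).map L =
      Measure.pi fun _ : κ => gaussianReal 0 (c * v) := by
  have : IsProbabilityMeasure ((Measure.pi fun _ : ι => gaussianReal 0 v).map L) :=
    Measure.isProbabilityMeasure_map hL.aemeasurable
  refine charFun_eq_pi_iff.1 fun t => ?_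
  -- The characteristic function of the image at `t` is that of the source at `L' t`. For a centered
  -- i.i.d. Gaussian vector it depends only on the norm of its argument.
  have h1 : charFun (((Measure.pi fun _ : ι => gaussianReal 0 v).map L).map (WithLp.toLp 2)) t =
      charFun ((Measure.pi fun _ : ι => gaussianReal 0 v).map (WithLp.toLp 2))
        (WithLp.toLp 2 (L' t.ofLp)) := by
    rw [charFun_apply, charFun_apply, Measure.map_map (by fun_prop) hL,
      integral_map (by fun_prop) (by fun_prop), integral_map (by fun_prop) (by fun_prop)]
    congr 1
    ext x
    congr 3
    simp only [PiLp.inner_apply, Function.comp, RCLike.inner_apply, conj_trivial]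
    exact hadj _ _
  rw [h1, charFun_pi]
  simp only [charFun_gaussianReal, ← Complex.exp_sum]
  congr 1
  have h2 := hnorm t.ofLp
  have h3 : ∑ i, ((L' t.ofLp i : ℝ) : ℂ) ^ 2 = c * ∑ j, ((t.ofLp j : ℝ) : ℂ) ^ 2 := by
    have := congrArg (fun r : ℝ => (r : ℂ)) h2
    push_cast at this
    exact this
  push_cast
  rw [sum_charExponent, sum_charExponent, h3]
  ring

/-- The density is at most `(2πv) ^ (-1/2) ≤ 1`. The point is uniformity over all `v ≥ 1/2`, the
variances that occur on the charts. -/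
lemma gaussianReal_le_smul_volume {v : ℝ≥0} (hv : 1 / 2 ≤ v) : gaussianReal 0 v ≤ volume := by
  have hv0 : v ≠ 0 := by rintro rfl; simp at hv
  rw [gaussianReal_of_var_ne_zero _ hv0]
  refine (withDensity_mono (ae_of_all _ fun x => ?_)).trans_eq withDensity_one
  rw [Pi.one_apply, gaussianPDF_def, ENNReal.ofReal_le_one, gaussianPDFReal]
  have hv' : (1 / 2 : ℝ) ≤ v := by exact_mod_cast hv
  refine mul_le_one₀ (inv_le_one_of_one_le₀ (Real.one_le_sqrt.2 ?_)) (Real.exp_pos _).le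
    (Real.exp_le_one_iff.2 ?_)
  · nlinarith [Real.pi_gt_three]
  · rw [neg_div]; exact neg_nonpos.2 (by positivity)

lemma lintegral_abs_rpow_neg_lt_top {β : ℝ} (hβ : β < 1) :
    ∫⁻ z in Set.Icc (-1 : ℝ) 1, ENNReal.ofReal |z| ^ (-β) < ∞ := by
  have h01 : ∫⁻ z in Set.Ioc (0 : ℝ) 1, ENNReal.ofReal |z| ^ (-β) < ∞ := by
    have h := (intervalIntegral.intervalIntegrable_rpow' (a := 0) (b := 1) (r := -β)
      (by linarith)).1
    refine lt_of_le_of_lt (le_of_eq ?_) h.2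
    refine setLIntegral_congr_fun measurableSet_Ioc fun z hz => ?_
    simp only
    rw [abs_of_pos hz.1, ENNReal.ofReal_rpow_of_pos hz.1, Real.enorm_of_nonneg]
    exact Real.rpow_nonneg hz.1.le _
  have h10 : ∫⁻ z in Set.Ico (-1 : ℝ) 0, ENNReal.ofReal |z| ^ (-β) < ∞ := by
    have := (Measure.measurePreserving_neg (volume : Measure ℝ)).setLIntegral_comp_preimage_emb
      (MeasurableEquiv.neg ℝ).measurableEmbedding (fun z => ENNReal.ofReal |z| ^ (-β)) (Set.Ioc 0 1)
    simp only [abs_neg, Set.neg_preimage, Set.neg_Ioc, neg_zero] at this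
    rw [this]; exact h01
  have hsub : Set.Icc (-1 : ℝ) 1 ⊆ (Set.Ico (-1 : ℝ) 0 ∪ {0}) ∪ Set.Ioc 0 1 := by
    intro z hz
    rcases lt_trichotomy z 0 with h | h | h
    · exact Or.inl (Or.inl ⟨hz.1, h⟩)
    · exact Or.inl (Or.inr h)
    · exact Or.inr ⟨h, hz.2⟩
  refine (lintegral_mono_set hsub).trans_lt ((lintegral_union_le _ _ _).trans_lt ?_)
  refine ENNReal.add_lt_top.2 ⟨(lintegral_union_le _ _ _).trans_lt (ENNReal.add_lt_top.2
    ⟨h10, ?_⟩), h01⟩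
  simp

/-- Negative moments of order less than one, for a measure dominated by a multiple of Lebesgue
measure near the singularity. -/
lemma lintegral_abs_sub_rpow_neg_le {ν : Measure ℝ} {D : ℝ≥0∞} (hν : ν ≤ D • volume) {β : ℝ}
    (hβ : 0 ≤ β) (a : ℝ) :
    ∫⁻ z, ENNReal.ofReal |z - a| ^ (-β) ∂ν ≤
      D * (∫⁻ z in Set.Icc (-1 : ℝ) 1, ENNReal.ofReal |z| ^ (-β)) + ν Set.univ := by
  have hpt : ∀ z : ℝ, ENNReal.ofReal |z - a| ^ (-β) ≤
      (Set.Icc (-1 : ℝ) 1).indicator (fun z => ENNReal.ofReal |z| ^ (-β)) (z - a) + 1 := by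
    intro z
    by_cases hz : z - a ∈ Set.Icc (-1 : ℝ) 1
    · rw [Set.indicator_of_mem hz]; exact le_self_add
    · rw [Set.indicator_of_notMem hz, zero_add, ENNReal.rpow_neg, ENNReal.inv_le_one]
      have h1 : 1 ≤ |z - a| := by
        by_contra h
        exact hz (Set.mem_Icc.2 (abs_le.1 (not_le.1 h).le))
      calc (1 : ℝ≥0∞) = 1 ^ β := (ENNReal.one_rpow β).symm
        _ ≤ _ := ENNReal.rpow_le_rpow (ENNReal.one_le_ofReal.2 h1) hβ
  refine (lintegral_mono hpt).trans ?_
  rw [lintegral_add_right _ measurable_const, lintegral_one]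
  refine add_le_add_left ?_ _
  refine (lintegral_mono' hν le_rfl).trans (le_of_eq ?_)
  rw [lintegral_smul_measure, smul_eq_mul, lintegral_sub_right_eq_self
    (fun z => (Set.Icc (-1 : ℝ) 1).indicator (fun z => ENNReal.ofReal |z| ^ (-β)) z) a,
    lintegral_indicator measurableSet_Icc]

lemma lintegral_pi_prod {κ : Type*} [Fintype κ] (ν : Measure ℝ) [IsProbabilityMeasure ν]
    {f : ℝ → ℝ≥0∞} (hf : Measurable f) :
    ∫⁻ x, ∏ j, f (x j) ∂(Measure.pi fun _ : κ => ν) = (∫⁻ z, f z ∂ν) ^ Fintype.card κ := by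
  have h := lintegral_prod_eq_prod_lintegral_of_indepFun (μ := Measure.pi fun _ : κ => ν)
    Finset.univ (fun j x => f (x j)) (iIndepFun_pi (X := fun _ => f) fun _ => hf.aemeasurable)
    (fun j => hf.comp (measurable_pi_apply j))
  rw [h, Finset.prod_congr rfl (g := fun _ => ∫⁻ z, f z ∂ν)
    fun j _ => (measurePreserving_eval (fun _ : κ => ν) j).lintegral_comp hf,
    Finset.prod_const, Finset.card_univ]

end GaussianLaw

/-! ### The channel as a function of a Gaussian vector -/

section Channel

variable {K N : ℕ}

/-- Indices of the real and imaginary parts of the channel coefficients. -/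
abbrev ChanIdx (K N : ℕ) := (Fin K × Fin N) ⊕ (Fin K × Fin N)

/-- The joint law of the real and imaginary parts of the channel coefficients. -/
noncomputable def chanLaw (K N : ℕ) : Measure (ChanIdx K N → ℝ) :=
  Measure.pi fun _ => gaussianReal 0 (1 / 2)

instance : IsProbabilityMeasure (chanLaw K N) := by unfold chanLaw; infer_instance

/-- The channel matrix with given real and imaginary parts. -/
def chan (x : ChanIdx K N → ℝ) : Matrix (Fin K) (Fin N) ℂ :=
  fun k n => ⟨x (Sum.inl (k, n)), x (Sum.inr (k, n))⟩

/-- The real and imaginary parts of a matrix. -/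
def coords (H : Matrix (Fin K) (Fin N) ℂ) : ChanIdx K N → ℝ :=
  Sum.elim (fun r => (H r.1 r.2).re) (fun r => (H r.1 r.2).im)

@[simp] lemma chan_coords (H : Matrix (Fin K) (Fin N) ℂ) : chan (coords H) = H := by
  ext k n
  simp [chan, coords]

@[simp] lemma coords_chan (x : ChanIdx K N → ℝ) : coords (chan x) = x := by
  ext (i | i) <;> simp [chan, coords]

lemma IsRayleigh.hasLaw {Ω : Type u} [MeasurableSpace Ω] {P : Measure Ω}
    {H : Ω → Matrix (Fin K) (Fin N) ℂ} (h : IsRayleigh P H) :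
    HasLaw (fun ω => coords (H ω)) (chanLaw K N) P := by
  have := h.indep.isProbabilityMeasure
  refine iIndepFun.hasLaw_pi (X := fun (q : ChanIdx K N) ω => coords (H ω) q)
    (fun q => ?_) h.indep
  rcases q with q | q
  · exact h.re_law _ _
  · exact h.im_law _ _

/-- For `α` the exponent, the product of the negative powers of the coordinates of `x ᵥ* Ht`,
integrated over the charts `x k = 1`. -/
noncomputable def chartProd (α : ℝ) (H : Matrix (Fin K) (Fin N) ℂ) : ℝ≥0∞ :=
  ∑ k, ∫⁻ y in Set.Icc (fun _ : Fin K ⊕ Fin K => (-2 : ℝ)) (fun _ => 2),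
    ∏ j, ENNReal.ofReal |(Function.update y k 1 ᵥ* realRep H) j| ^ (-α)

lemma frobSq_realRep (H : Matrix (Fin K) (Fin N) ℂ) :
    frobSq (realRep H) = 2 * ∑ i, coords H i ^ 2 := by
  simp only [frobSq, realRep, Fintype.sum_sum_type, coords, Sum.elim_inl, Sum.elim_inr,
    Matrix.fromBlocks_apply₁₁, Matrix.fromBlocks_apply₁₂, Matrix.fromBlocks_apply₂₁,
    Matrix.fromBlocks_apply₂₂, Matrix.map_apply, Matrix.neg_apply, neg_sq,
    Fintype.sum_prod_type, Finset.sum_add_distrib]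
  ring

/-- The image of the channel under a real combination of the rows of its real representation. -/
lemma map_vecMul_realRep (x : Fin K ⊕ Fin K → ℝ) :
    (chanLaw K N).map (fun z => x ᵥ* realRep (chan z)) =
      Measure.pi fun _ => gaussianReal 0 ((∑ i, x i ^ 2).toNNReal * (1 / 2)) := by
  have hx : 0 ≤ ∑ i, x i ^ 2 := Finset.sum_nonneg fun _ _ => sq_nonneg _
  -- The explicit adjoint of `z ↦ xᵀ H̃`. Its squared norm at `t` is `|x|² |t|²`, because the cross
  -- terms of the real and imaginary parts cancel.
  refine map_pi_gaussianReal (1 / 2) (∑ i, x i ^ 2).toNNReal _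
    (fun t => Sum.elim
      (fun r => t (Sum.inl r.2) * x (Sum.inl r.1) + t (Sum.inr r.2) * x (Sum.inr r.1))
      (fun r => t (Sum.inl r.2) * x (Sum.inr r.1) - t (Sum.inr r.2) * x (Sum.inl r.1))) ?_ ?_ ?_
  · refine measurable_pi_lambda _ fun j => ?_
    simp only [Matrix.vecMul, dotProduct]
    refine Finset.measurable_sum _ fun i _ => Measurable.const_mul ?_ _
    rcases i with i | i <;> rcases j with j | j <;> simp only [realRep, chan,
      Matrix.fromBlocks_apply₁₁, Matrix.fromBlocks_apply₁₂, Matrix.fromBlocks_apply₂₁,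
      Matrix.fromBlocks_apply₂₂, Matrix.map_apply, Matrix.neg_apply] <;> fun_prop
  · intro t z
    simp only [Matrix.vecMul, dotProduct, Fintype.sum_sum_type, realRep, chan, Sum.elim_inl,
      Sum.elim_inr, Matrix.fromBlocks_apply₁₁, Matrix.fromBlocks_apply₁₂,
      Matrix.fromBlocks_apply₂₁, Matrix.fromBlocks_apply₂₂, Matrix.map_apply, Matrix.neg_apply,
      Fintype.sum_prod_type_right, ← Finset.sum_add_distrib, Finset.mul_sum]
    refine Finset.sum_congr rfl fun n _ => Finset.sum_congr rfl fun k _ => ?_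
    ring
  · intro t
    rw [Real.coe_toNNReal _ hx]
    simp only [Fintype.sum_sum_type, Sum.elim_inl, Sum.elim_inr,
      Fintype.sum_prod_type_right, ← Finset.sum_add_distrib]
    rw [Finset.mul_sum]
    refine Finset.sum_congr rfl fun n _ => ?_
    rw [Finset.sum_mul]
    refine Finset.sum_congr rfl fun k _ => ?_
    ring

lemma measurable_vecMul_realRep_apply (k : Fin K ⊕ Fin K) (j : Fin N ⊕ Fin N) :
    Measurable fun p : (ChanIdx K N → ℝ) × (Fin K ⊕ Fin K → ℝ) =>
      (Function.update p.2 k 1 ᵥ* realRep (chan p.1)) j := by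
  simp only [Matrix.vecMul, dotProduct]
  refine Finset.measurable_sum _ fun i _ => Measurable.mul ?_ ?_
  · by_cases h : i = k
    · subst h; simp
    · simp only [Function.update_of_ne h]; fun_prop
  · rcases i with i | i <;> rcases j with j | j <;> simp only [realRep, chan,
      Matrix.fromBlocks_apply₁₁, Matrix.fromBlocks_apply₁₂, Matrix.fromBlocks_apply₂₁,
      Matrix.fromBlocks_apply₂₂, Matrix.map_apply, Matrix.neg_apply] <;> fun_prop

lemma measurable_prod_vecMul (α : ℝ) (k : Fin K ⊕ Fin K) :
    Measurable fun p : (ChanIdx K N → ℝ) × (Fin K ⊕ Fin K → ℝ) =>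
      ∏ j, ENNReal.ofReal |(Function.update p.2 k 1 ᵥ* realRep (chan p.1)) j| ^ (-α) := by
  refine Finset.measurable_prod _ fun j _ => ?_
  refine Measurable.pow_const ?_ _
  exact ((measurable_vecMul_realRep_apply k j).norm).ennreal_ofReal

lemma measurable_prod_vecMul_left (α : ℝ) (k : Fin K ⊕ Fin K) (y : Fin K ⊕ Fin K → ℝ) :
    Measurable fun z : ChanIdx K N → ℝ =>
      ∏ j, ENNReal.ofReal |(Function.update y k 1 ᵥ* realRep (chan z)) j| ^ (-α) :=
  (measurable_prod_vecMul α k).of_uncurry_right (f := fun z y =>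
    ∏ j, ENNReal.ofReal |(Function.update y k 1 ᵥ* realRep (chan z)) j| ^ (-α))

lemma measurable_prod_vecMul_right (α : ℝ) (k : Fin K ⊕ Fin K) (z : ChanIdx K N → ℝ) :
    Measurable fun y : Fin K ⊕ Fin K → ℝ =>
      ∏ j, ENNReal.ofReal |(Function.update y k 1 ᵥ* realRep (chan z)) j| ^ (-α) :=
  (measurable_prod_vecMul α k).of_uncurry_left (f := fun z y =>
    ∏ j, ENNReal.ofReal |(Function.update y k 1 ᵥ* realRep (chan z)) j| ^ (-α))

lemma measurable_chartProd (α : ℝ) :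
    Measurable fun z : ChanIdx K N → ℝ => chartProd α (chan z) := by
  refine Finset.measurable_sum _ fun k _ => ?_
  exact (measurable_prod_vecMul α k).lintegral_prod_right'

/-- Uniform bound for the negative moments of `x ᵥ* Ht` over the charts. -/
lemma lintegral_prod_vecMul_le {β : ℝ} (hβ : 0 ≤ β) (k : Fin K ⊕ Fin K)
    (y : Fin K ⊕ Fin K → ℝ) :
    ∫⁻ z, ∏ j, ENNReal.ofReal |(Function.update y k 1 ᵥ* realRep (chan z)) j| ^ (-β)
      ∂(chanLaw K N) ≤
      ((∫⁻ z in Set.Icc (-1 : ℝ) 1, ENNReal.ofReal |z| ^ (-β)) + 1) ^ (N + N) := by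
  set x := Function.update y k 1 with hx
  have h1 : (1 : ℝ) ≤ ∑ i, x i ^ 2 := by
    refine le_trans ?_ (Finset.single_le_sum (f := fun i => x i ^ 2) (fun i _ => sq_nonneg _)
      (Finset.mem_univ k))
    simp [hx]
  -- On the chart `x k = 1` one has `|x|² ≥ 1`, so the variance never degenerates.
  have hv : (1 / 2 : ℝ≥0) ≤ (∑ i, x i ^ 2).toNNReal * (1 / 2) :=
    le_mul_of_one_le_left (by simp) (Real.one_le_toNNReal.2 h1)
  have hf : Measurable fun z : ℝ => ENNReal.ofReal |z| ^ (-β) :=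
    Measurable.pow_const (measurable_id.norm).ennreal_ofReal _
  have hm : Measurable fun z => x ᵥ* realRep (chan (K := K) (N := N) z) := by
    refine measurable_pi_lambda _ fun j => ?_
    exact (measurable_vecMul_realRep_apply k j).comp measurable_prodMk_right
  have e : ∫⁻ z, ∏ j, ENNReal.ofReal |(x ᵥ* realRep (chan z)) j| ^ (-β) ∂(chanLaw K N) =
      ∫⁻ w, ∏ j, ENNReal.ofReal |w j| ^ (-β)
        ∂((chanLaw K N).map (fun z => x ᵥ* realRep (chan z))) := by
    have hg : Measurable fun w : Fin N ⊕ Fin N → ℝ => ∏ j, ENNReal.ofReal |w j| ^ (-β) :=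
      Finset.measurable_prod _ fun j _ => hf.comp (measurable_pi_apply j)
    exact (lintegral_map hg hm).symm
  rw [e, map_vecMul_realRep, lintegral_pi_prod _ hf]
  simp only [Fintype.card_sum, Fintype.card_fin]
  refine pow_le_pow_left' ?_ _
  have := lintegral_abs_sub_rpow_neg_le (D := 1)
    ((gaussianReal_le_smul_volume hv).trans_eq (one_smul _ _).symm) hβ 0
  simp only [sub_zero, one_mul, measure_univ] at this
  exact this

/-- The random constant in the bound for the trace of the inverse Gram matrix. -/
noncomputable def chanBound (H : Matrix (Fin K) (Fin N) ℂ) : ℝ≥0∞ :=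
  ENNReal.ofReal (1 + frobSq (realRep H)) ^ ((2 * (K : ℝ) - 1) / 2) *
    chartProd ((2 * (K : ℝ) + 1) / (2 * N)) H

lemma frobSq_realRep_le_norm (z : ChanIdx K N → ℝ) :
    frobSq (realRep (chan z)) ≤ 2 * Fintype.card (ChanIdx K N) * ‖z‖ ^ 2 := by
  rw [frobSq_realRep, coords_chan, mul_assoc]
  gcongr
  calc ∑ i, z i ^ 2 ≤ ∑ _i : ChanIdx K N, ‖z‖ ^ 2 := by
        refine Finset.sum_le_sum fun i _ => ?_
        rw [← sq_abs]
        exact pow_le_pow_left₀ (abs_nonneg _) (norm_le_pi_norm z i) 2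
    _ = _ := by simp

lemma measurable_frobSq_realRep :
    Measurable fun z : ChanIdx K N → ℝ => frobSq (realRep (chan z)) := by
  simp only [frobSq_realRep, coords_chan]
  fun_prop

lemma measurable_chanBound :
    Measurable fun z : ChanIdx K N → ℝ => chanBound (chan z) := by
  unfold chanBound
  exact (Measurable.pow_const (measurable_frobSq_realRep.const_add 1).ennreal_ofReal _).mul
    (measurable_chartProd _)

instance : IsGaussian (chanLaw K N) := by
  have h := (iIndepFun_pi (μ := fun _ : ChanIdx K N => gaussianReal 0 (1 / 2))
    (X := fun _ => id) fun _ => aemeasurable_id).hasGaussianLaw fun i =>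
      (measurePreserving_eval (fun _ : ChanIdx K N => gaussianReal 0 (1 / 2)) i).hasLaw.hasGaussianLaw
  have h2 := h.isGaussian_map
  rwa [show (fun (ω : ChanIdx K N → ℝ) x => Function.eval x ω) = id from rfl, Measure.map_id] at h2

/-- The Frobenius norm is dominated by a multiple of the norm of a Gaussian vector, which has
moments of every order; the exponent `2 s` is first raised to an integer. -/
lemma lintegral_one_add_frobSq_rpow_lt_top {s : ℝ} (hs : 0 ≤ s) :
    ∫⁻ z, ENNReal.ofReal (1 + frobSq (realRep (chan (K := K) (N := N) z))) ^ s ∂(chanLaw K N)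
      < ∞ := by
  obtain ⟨D, hD⟩ : ∃ D : ℝ, D = 2 * Fintype.card (ChanIdx K N) := ⟨_, rfl⟩
  obtain ⟨M, hM⟩ := exists_nat_ge (2 * s)
  have hid := (IsGaussian.memLp_id (chanLaw K N) (M : ℝ≥0∞) (ENNReal.natCast_ne_top M)).norm
  have hmem := (memLp_const (μ := chanLaw K N) (p := (M : ℝ≥0∞)) (1 : ℝ)).add hid
  have hint : Integrable (fun z : ChanIdx K N → ℝ => ((1 : ℝ) + ‖z‖) ^ M) (chanLaw K N) := by
    have h3 : ∀ z : ChanIdx K N → ℝ, 0 ≤ (1 : ℝ) + ‖z‖ := fun z => by positivity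
    have h4 := hmem.integrable_norm_pow'
    refine h4.congr (ae_of_all _ fun z => ?_)
    simp only [Pi.add_apply, id_eq, Real.norm_of_nonneg (h3 z)]
  have hint2 := hint.const_mul ((1 + D) ^ s)
  refine lt_of_le_of_lt (lintegral_mono fun z => ?_) hint2.lintegral_lt_top
  have h0 : 0 < 1 + frobSq (realRep (chan z)) := by linarith [frobSq_nonneg (realRep (chan z))]
  rw [ENNReal.ofReal_rpow_of_pos h0]
  refine ENNReal.ofReal_le_ofReal ?_
  have hz : 0 ≤ ‖z‖ := norm_nonneg z
  have hD0 : 0 ≤ D := by rw [hD]; positivity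
  calc (1 + frobSq (realRep (chan z))) ^ s ≤ ((1 + D) * (1 + ‖z‖) ^ 2) ^ s := by
        refine Real.rpow_le_rpow h0.le ?_ hs
        have := frobSq_realRep_le_norm z
        rw [← hD] at this
        nlinarith [mul_nonneg hD0 hz, mul_nonneg hz hz]
    _ = (1 + D) ^ s * (1 + ‖z‖) ^ (2 * s) := by
        rw [Real.mul_rpow (by positivity) (by positivity), Real.rpow_mul (by positivity)]
        norm_num
    _ ≤ (1 + D) ^ s * (1 + ‖z‖) ^ M := by
        rw [← Real.rpow_natCast (1 + ‖z‖) M]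
        gcongr
        linarith

/-- The Frobenius factor and the product of negative powers are dependent. Young's inequality
separates them at the price of a slightly larger exponent `β`, still below one. The first part has a
finite moment; the second is bounded uniformly over the charts, which have finite volume. -/
lemma lintegral_chanBound_lt_top (hK : 0 < K) (hKN : K < N) :
    ∫⁻ z, chanBound (chan z) ∂(chanLaw K N) < ∞ := by
  set α : ℝ := (2 * (K : ℝ) + 1) / (2 * N) with hα
  set s : ℝ := (2 * (K : ℝ) - 1) / 2 with hs
  have hK1 : (1 : ℝ) ≤ K := by exact_mod_cast hK
  have hKN1 : (K : ℝ) + 1 ≤ N := by exact_mod_cast hKN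
  have hN0 : (0 : ℝ) < N := by linarith
  have hα0 : 0 < α := by rw [hα]; positivity
  have hα1 : α < 1 := by rw [hα, div_lt_one (by positivity)]; linarith
  have hs0 : 0 ≤ s := by rw [hs]; linarith
  -- Midpoint of `α` and `1`: `q = β / α > 1` is an admissible Young exponent, and `α q = β < 1`
  -- keeps the singularity integrable.
  set β := (α + 1) / 2 with hβ
  set q := β / α with hq
  have hq1 : 1 < q := by rw [hq, lt_div_iff₀ hα0]; linarith
  set p := q / (q - 1) with hp
  have hpq : p.HolderConjugate q := (Real.HolderConjugate.conjExponent hq1).symm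
  have hpt : ∀ z : ChanIdx K N → ℝ, chanBound (chan z) ≤
      ∑ k, ∫⁻ y in Set.Icc (fun _ : Fin K ⊕ Fin K => (-2 : ℝ)) (fun _ => 2),
        (ENNReal.ofReal (1 + frobSq (realRep (chan z))) ^ (s * p) / ENNReal.ofReal p +
        (∏ j, ENNReal.ofReal |(Function.update y k 1 ᵥ* realRep (chan z)) j| ^ (-β)) /
          ENNReal.ofReal q) := by
    intro z
    rw [chanBound, chartProd, Finset.mul_sum]
    refine Finset.sum_le_sum fun k _ => ?_
    have hm := measurable_prod_vecMul_right (N := N) α k z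
    rw [← lintegral_const_mul _ hm]
    refine lintegral_mono fun y => ?_
    refine (ENNReal.young_inequality _ _ hpq).trans_eq ?_
    rw [ENNReal.rpow_mul]
    congr 2
    -- If a coordinate vanishes, both sides are `∞`: no factor is zero, so the infinite factor is
    -- not cancelled by the convention `0 * ∞ = 0`.
    by_cases h0 : ∃ j, (Function.update y k 1 ᵥ* realRep (chan z)) j = 0
    · obtain ⟨j0, hj0⟩ := h0
      have htop : ∀ γ : ℝ, 0 < γ →
          ∏ j, ENNReal.ofReal |(Function.update y k 1 ᵥ* realRep (chan z)) j| ^ (-γ) = ∞ := by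
        intro γ hγ
        rw [← Finset.mul_prod_erase _ _ (Finset.mem_univ j0), hj0, abs_zero, ENNReal.ofReal_zero,
          ENNReal.zero_rpow_of_neg (by linarith), ENNReal.top_mul]
        refine Finset.prod_ne_zero_iff.2 fun j _ => ?_
        rw [ENNReal.rpow_neg]
        exact ENNReal.inv_ne_zero.2 (ENNReal.rpow_ne_top_of_nonneg hγ.le ENNReal.ofReal_ne_top)
      rw [htop α hα0, htop β (by linarith), ENNReal.top_rpow_of_pos (by linarith)]
    · push Not at h0
      have hne : ∀ j, ENNReal.ofReal |(Function.update y k 1 ᵥ* realRep (chan z)) j| ≠ 0 :=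
        fun j => by simpa using h0 j
      rw [← ENNReal.prod_rpow_of_ne_top]
      · refine Finset.prod_congr rfl fun j _ => ?_
        rw [← ENNReal.rpow_mul]
        congr 1
        rw [hq]; field_simp
      · intro j _
        exact ENNReal.rpow_ne_top_of_ne_zero (hne j) ENNReal.ofReal_ne_top
  refine (lintegral_mono hpt).trans_lt ?_
  have hmF : Measurable fun z : ChanIdx K N → ℝ =>
      ENNReal.ofReal (1 + frobSq (realRep (chan z))) ^ (s * p) / ENNReal.ofReal p :=
    (Measurable.pow_const (measurable_frobSq_realRep.const_add 1).ennreal_ofReal _).div_const _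
  have hjoint : ∀ k, Measurable fun w : (ChanIdx K N → ℝ) × (Fin K ⊕ Fin K → ℝ) =>
      ENNReal.ofReal (1 + frobSq (realRep (chan w.1))) ^ (s * p) / ENNReal.ofReal p +
        (∏ j, ENNReal.ofReal |(Function.update w.2 k 1 ᵥ* realRep (chan w.1)) j| ^ (-β)) /
          ENNReal.ofReal q := fun k =>
    (hmF.comp measurable_fst).add ((measurable_prod_vecMul β k).div_const _)
  rw [lintegral_finsetSum _ fun k _ => (hjoint k).lintegral_prod_right']
  refine ENNReal.sum_lt_top.2 fun k _ => ?_
  rw [lintegral_lintegral_swap (hjoint k).aemeasurable]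
  have hbound : ∀ y : Fin K ⊕ Fin K → ℝ,
      ∫⁻ z, (ENNReal.ofReal (1 + frobSq (realRep (chan z))) ^ (s * p) / ENNReal.ofReal p +
        (∏ j, ENNReal.ofReal |(Function.update y k 1 ᵥ* realRep (chan z)) j| ^ (-β)) /
          ENNReal.ofReal q) ∂(chanLaw K N) ≤
      (∫⁻ z, ENNReal.ofReal (1 + frobSq (realRep (chan (K := K) (N := N) z))) ^ (s * p)
        ∂(chanLaw K N)) / ENNReal.ofReal p +
      ((∫⁻ z in Set.Icc (-1 : ℝ) 1, ENNReal.ofReal |z| ^ (-β)) + 1) ^ (N + N) /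
        ENNReal.ofReal q := by
    intro y
    rw [lintegral_add_left hmF]
    simp only [div_eq_mul_inv]
    have hm1 : Measurable fun z : ChanIdx K N → ℝ =>
      ENNReal.ofReal (1 + frobSq (realRep (chan z))) ^ (s * p) :=
      Measurable.pow_const (measurable_frobSq_realRep.const_add 1).ennreal_ofReal _
    have hm2 := measurable_prod_vecMul_left (N := N) β k y
    rw [lintegral_mul_const _ hm1, lintegral_mul_const _ hm2]
    gcongr
    exact lintegral_prod_vecMul_le (by linarith) k y
  refine (lintegral_mono hbound).trans_lt ?_
  rw [lintegral_const]
  have hp0 : 0 < p := hpq.pos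
  refine ENNReal.mul_lt_top (ENNReal.add_lt_top.2 ⟨?_, ?_⟩) ?_
  · exact ENNReal.div_lt_top (lintegral_one_add_frobSq_rpow_lt_top (by positivity)).ne
      (by simpa using hp0)
  · refine ENNReal.div_lt_top (ENNReal.pow_ne_top (ENNReal.add_lt_top.2
      ⟨lintegral_abs_rpow_neg_lt_top (by linarith), ENNReal.one_lt_top⟩).ne) ?_
    simpa using (by linarith : 0 < q)
  · rw [Measure.restrict_apply_univ, Real.volume_Icc_pi]
    exact ENNReal.prod_lt_top fun _ _ => ENNReal.ofReal_lt_top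

end Channel
end WLZF

namespace WLZF
open Matrix
open scoped ENNReal NNReal

/-! ### Algebra of the real representation -/

section RealRep

variable {l m n : Type*} [Fintype m] [Fintype n]

lemma realRep_mul (X : Matrix l m ℂ) (Y : Matrix m n ℂ) :
    realRep (X * Y) = realRep X * realRep Y := by
  ext (i | i) (j | j) <;>
    simp [realRep, Matrix.mul_apply, Fintype.sum_sum_type, Finset.sum_add_distrib,
      Finset.sum_sub_distrib] <;> ring

lemma realRep_conjTranspose (X : Matrix l m ℂ) : realRep Xᴴ = (realRep X)ᵀ := by
  ext (i | i) (j | j) <;> simp [realRep]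

lemma realRep_one [DecidableEq n] : realRep (1 : Matrix n n ℂ) = 1 := by
  ext (i | i) (j | j) <;> simp [realRep, Matrix.one_apply, apply_ite]

lemma trace_realRep (X : Matrix n n ℂ) : (realRep X).trace = 2 * X.trace.re := by
  simp [realRep, Matrix.trace, Fintype.sum_sum_type]
  ring

lemma isUnit_det_realRep [DecidableEq n] {X : Matrix n n ℂ} :
    IsUnit (realRep X).det ↔ IsUnit X.det := by
  constructor
  · intro h
    rw [isUnit_iff_ne_zero] at h ⊢
    intro h0
    obtain ⟨v, hv, hXv⟩ := Matrix.exists_mulVec_eq_zero_iff.2 h0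
    refine h (Matrix.exists_mulVec_eq_zero_iff.1
      ⟨Sum.elim (fun i => (v i).re) (fun i => (v i).im), ?_, ?_⟩)
    · intro h1
      refine hv (funext fun i => Complex.ext ?_ ?_)
      · exact congrFun h1 (Sum.inl i)
      · exact congrFun h1 (Sum.inr i)
    · ext (i | i)
      · have := congrArg Complex.re (congrFun hXv i)
        simpa [realRep, Matrix.mulVec, dotProduct, Fintype.sum_sum_type, Finset.sum_add_distrib,
          sub_eq_add_neg] using this
      · have := congrArg Complex.im (congrFun hXv i)
        simp only [Matrix.mulVec, dotProduct, Complex.im_sum, Complex.mul_im, Pi.zero_apply,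
          Complex.zero_im, Finset.sum_add_distrib] at this
        simpa [realRep, Matrix.mulVec, dotProduct, Fintype.sum_sum_type, add_comm] using this
  · intro h
    have : realRep X * realRep X⁻¹ = 1 := by
      rw [← realRep_mul, Matrix.mul_nonsing_inv _ h, realRep_one]
    exact Matrix.isUnit_det_of_right_inverse this

lemma realRep_inv [DecidableEq n] {X : Matrix n n ℂ} (h : IsUnit X.det) :
    (realRep X)⁻¹ = realRep X⁻¹ := by
  refine Matrix.inv_eq_right_inv ?_
  rw [← realRep_mul, Matrix.mul_nonsing_inv _ h, realRep_one]

end RealRep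

/-! ### The Gram form of the channel with IQ imbalance -/

section IQ

variable {K N : ℕ}

lemma gramForm_mul {ι κ l : Type*} [Fintype ι] [Fintype κ] [Fintype l] (A : Matrix ι κ ℝ)
    (B : Matrix κ l ℝ) (x : ι → ℝ) : gramForm (A * B) x = gramForm B (x ᵥ* A) := by
  simp [gramForm, Matrix.vecMul_vecMul]

lemma vecMul_iqMat_inl (a₁ a₂ : Fin N → ℂ) (G : Fin N ⊕ Fin N → ℝ) (n : Fin N) :
    (G ᵥ* iqMat a₁ a₂) (Sum.inl n) =
      G (Sum.inl n) * ((a₁ n).re + (a₂ n).re) + G (Sum.inr n) * ((a₁ n).im + (a₂ n).im) := by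
  simp [Matrix.vecMul, dotProduct, iqMat, realRep, conjMat, Fintype.sum_sum_type,
    Matrix.fromBlocks_multiply, Matrix.diagonal_apply, apply_ite, Finset.sum_ite_eq', mul_add,
    Finset.sum_add_distrib]
  ring

lemma vecMul_iqMat_inr (a₁ a₂ : Fin N → ℂ) (G : Fin N ⊕ Fin N → ℝ) (n : Fin N) :
    (G ᵥ* iqMat a₁ a₂) (Sum.inr n) =
      G (Sum.inl n) * (-(a₁ n).im + (a₂ n).im) + G (Sum.inr n) * ((a₁ n).re - (a₂ n).re) := by
  simp [Matrix.vecMul, dotProduct, iqMat, realRep, conjMat, Fintype.sum_sum_type,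
    Matrix.fromBlocks_multiply, Matrix.diagonal_apply, apply_ite, Finset.sum_ite_eq', mul_add,
    Finset.sum_add_distrib, sub_eq_add_neg]
  ring

/-- The contribution of one antenna to the Gram form, up to normalization. -/
noncomputable def antennaForm (g θ a b : ℝ) : ℝ :=
  (1 + g) ^ 2 * a ^ 2 + (1 - g) ^ 2 * b ^ 2 - 2 * (1 - g ^ 2) * Real.sin θ * a * b

lemma gramForm_wlChannel (H : Matrix (Fin K) (Fin N) ℂ) (σg : ℝ) (g θ : Fin N → ℝ)
    (x : Fin K ⊕ Fin K → ℝ) :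
    gramForm (wlChannel H (fun n => iqCoeff₁ σg (g n) (θ n)) (fun n => iqCoeff₂ σg (g n) (θ n))) x
      = (1 + σg ^ 2)⁻¹ * ∑ n, antennaForm (g n) (θ n) ((x ᵥ* realRep H) (Sum.inl n))
        ((x ᵥ* realRep H) (Sum.inr n)) := by
  rw [wlChannel, gramForm_mul, gramForm, Fintype.sum_sum_type, ← Finset.sum_add_distrib,
    Finset.mul_sum]
  refine Finset.sum_congr rfl fun n _ => ?_
  rw [vecMul_iqMat_inl, vecMul_iqMat_inr]
  set a := (x ᵥ* realRep H) (Sum.inl n)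
  set b := (x ᵥ* realRep H) (Sum.inr n)
  have hs : (1 / Real.sqrt (1 + σg ^ 2)) ^ 2 = (1 + σg ^ 2)⁻¹ := by
    rw [div_pow, Real.sq_sqrt (by positivity), one_pow, one_div]
  rw [← hs]
  set s := 1 / Real.sqrt (1 + σg ^ 2)
  have hsin : Real.sin (θ n) = 2 * Real.sin (θ n / 2) * Real.cos (θ n / 2) := by
    rw [← Real.sin_two_mul]; congr 1; ring
  have hc : Real.cos (θ n / 2) ^ 2 = 1 - Real.sin (θ n / 2) ^ 2 := by
    rw [← Real.sin_sq_add_cos_sq (θ n / 2)]; ring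
  have e1 : (iqCoeff₁ σg (g n) (θ n)).re = s * Real.cos (θ n / 2) := by
    simp only [iqCoeff₁, Complex.re_ofReal_mul, Complex.add_re, Complex.ofReal_re,
      Complex.I_mul_re, Complex.ofReal_im, neg_zero, add_zero, s]
  have e2 : (iqCoeff₁ σg (g n) (θ n)).im = s * (g n * Real.sin (θ n / 2)) := by
    simp only [iqCoeff₁, Complex.im_ofReal_mul, Complex.add_im, Complex.ofReal_re,
      Complex.I_mul_im, Complex.ofReal_im, zero_add, s]
  have e3 : (iqCoeff₂ σg (g n) (θ n)).re = s * (g n * Real.cos (θ n / 2)) := by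
    simp only [iqCoeff₂, Complex.re_ofReal_mul, Complex.sub_re, Complex.ofReal_re,
      Complex.I_mul_re, Complex.ofReal_im, neg_zero, sub_zero, s]
  have e4 : (iqCoeff₂ σg (g n) (θ n)).im = s * (-Real.sin (θ n / 2)) := by
    simp only [iqCoeff₂, Complex.im_ofReal_mul, Complex.sub_im, Complex.ofReal_re,
      Complex.I_mul_im, Complex.ofReal_im, zero_sub, s]
  rw [e1, e2, e3, e4, antennaForm, hsin]
  set c := Real.cos (θ n / 2)
  set d := Real.sin (θ n / 2)
  linear_combination (s ^ 2 * ((1 + g n) ^ 2 * a ^ 2 + (1 - g n) ^ 2 * b ^ 2)) * hc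

/-- AM-GM bounds the cross term by `|sin θ|` times the sum of the two squares, so the form lies
between `1 - |sin θ|` and `1 + |sin θ| ≤ 2` times that sum. -/
lemma antennaForm_bounds (g θ a b : ℝ) :
    (1 - |Real.sin θ|) * ((1 + g) ^ 2 * a ^ 2 + (1 - g) ^ 2 * b ^ 2) ≤ antennaForm g θ a b ∧
      antennaForm g θ a b ≤ 2 * ((1 + g) ^ 2 * a ^ 2 + (1 - g) ^ 2 * b ^ 2) := by
  have hs := abs_le.1 (le_refl |Real.sin θ|)
  have hs1 := Real.abs_sin_le_one θ
  have h0 : 2 * |(1 + g) * a * ((1 - g) * b)| ≤ (1 + g) ^ 2 * a ^ 2 + (1 - g) ^ 2 * b ^ 2 := by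
    rw [abs_mul]
    nlinarith [sq_nonneg (|(1 + g) * a| - |(1 - g) * b|), sq_abs ((1 + g) * a),
      sq_abs ((1 - g) * b)]
  have h1 : |2 * (1 - g ^ 2) * Real.sin θ * a * b| ≤
      |Real.sin θ| * ((1 + g) ^ 2 * a ^ 2 + (1 - g) ^ 2 * b ^ 2) := by
    have : 2 * (1 - g ^ 2) * Real.sin θ * a * b =
      Real.sin θ * (2 * ((1 + g) * a * ((1 - g) * b))) := by ring
    rw [this, abs_mul, abs_mul 2, abs_two]
    exact mul_le_mul_of_nonneg_left h0 (abs_nonneg _)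
  have h2 := abs_le.1 h1
  have h3 : 0 ≤ (1 + g) ^ 2 * a ^ 2 + (1 - g) ^ 2 * b ^ 2 := by positivity
  unfold antennaForm
  constructor
  · linarith [h2.2]
  · nlinarith [h2.1]

/-- The weights of the coordinates in the Gram form. -/
def gainWeight (g : Fin N → ℝ) : Fin N ⊕ Fin N → ℝ :=
  Sum.elim (fun n => (1 + g n) ^ 2) (fun n => (1 - g n) ^ 2)

lemma gramForm_wlChannel_lower (H : Matrix (Fin K) (Fin N) ℂ) (σg : ℝ) (g θ : Fin N → ℝ) {c : ℝ}
    (hθ : ∀ n, |Real.sin (θ n)| ≤ 1 - c) (x : Fin K ⊕ Fin K → ℝ) :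
    c / (1 + σg ^ 2) * ∑ j, gainWeight g j * (x ᵥ* realRep H) j ^ 2 ≤
    gramForm (wlChannel H (fun n => iqCoeff₁ σg (g n) (θ n))
      (fun n => iqCoeff₂ σg (g n) (θ n))) x := by
  rw [gramForm_wlChannel, div_mul_eq_mul_div, div_eq_inv_mul]
  refine mul_le_mul_of_nonneg_left ?_ (by positivity)
  rw [Fintype.sum_sum_type, ← Finset.sum_add_distrib, Finset.mul_sum]
  refine Finset.sum_le_sum fun n _ => le_trans ?_ (antennaForm_bounds _ _ _ _).1
  simp only [gainWeight, Sum.elim_inl, Sum.elim_inr]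
  exact mul_le_mul_of_nonneg_right (by linarith [hθ n]) (by positivity)

lemma gramForm_wlChannel_upper (H : Matrix (Fin K) (Fin N) ℂ) (σg : ℝ) (g θ : Fin N → ℝ)
    (x : Fin K ⊕ Fin K → ℝ) :
    gramForm (wlChannel H (fun n => iqCoeff₁ σg (g n) (θ n))
      (fun n => iqCoeff₂ σg (g n) (θ n))) x ≤
    2 / (1 + σg ^ 2) * ∑ j, gainWeight g j * (x ᵥ* realRep H) j ^ 2 := by
  rw [gramForm_wlChannel, div_mul_eq_mul_div, div_eq_inv_mul]
  refine mul_le_mul_of_nonneg_left ?_ (by positivity)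
  rw [Fintype.sum_sum_type, ← Finset.sum_add_distrib, Finset.mul_sum]
  exact Finset.sum_le_sum fun n _ => (antennaForm_bounds _ _ _ _).2

/-- Bound for the chart integral of a channel whose Gram form dominates a weighted sum of squares
of coordinates. -/
lemma chartIntegral_le {κ : Type*} [Fintype κ] (hN : 0 < N) (M : Matrix (Fin K ⊕ Fin K) κ ℝ)
    (H : Matrix (Fin K) (Fin N) ℂ) {c : ℝ} (hc : 0 < c) {w : Fin N ⊕ Fin N → ℝ}
    (hw : ∀ j, 0 < w j)
    (h : ∀ x, c * ∑ j, w j * (x ᵥ* realRep H) j ^ 2 ≤ gramForm M x) :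
    chartIntegral M ≤ ENNReal.ofReal (c * (∏ j, w j) ^ (1 / (2 * N : ℝ))) ^
      (-((2 * (K : ℝ) + 1) / 2)) * chartProd ((2 * (K : ℝ) + 1) / (2 * N)) H := by
  have hN' : (0 : ℝ) < N := by exact_mod_cast hN
  rw [chartIntegral, chartProd, Finset.mul_sum]
  refine Finset.sum_le_sum fun k _ => ?_
  have hne : ENNReal.ofReal (c * (∏ j, w j) ^ (1 / (2 * N : ℝ))) ≠ 0 := by
    have : 0 < ∏ j, w j := Finset.prod_pos fun j _ => hw j
    simp only [ne_eq, ENNReal.ofReal_eq_zero, not_le]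
    positivity
  rw [← lintegral_const_mul' _ _ (ENNReal.rpow_ne_top_of_ne_zero hne ENNReal.ofReal_ne_top)]
  refine lintegral_mono fun y => ?_
  set x := Function.update y k 1
  set G := x ᵥ* realRep H
  -- AM-GM with equal weights `1/(2N)`. It turns the sum into a product, in which the weights `w`
  -- enter only through `∏ w j` and separate from the channel.
  have hamgm : ∏ j, (w j * G j ^ 2) ^ (1 / (2 * N : ℝ)) ≤ ∑ j, w j * G j ^ 2 := by
    have h1 := Real.geom_mean_le_arith_mean_weighted Finset.univ
      (fun _ : Fin N ⊕ Fin N => 1 / (2 * N : ℝ)) (fun j => w j * G j ^ 2)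
      (fun _ _ => by positivity) (by simp; field_simp; norm_num)
      (fun j _ => mul_nonneg (hw j).le (sq_nonneg _))
    refine h1.trans (Finset.sum_le_sum fun j _ => ?_)
    refine mul_le_of_le_one_left (mul_nonneg (hw j).le (sq_nonneg _)) ?_
    rw [div_le_one (by positivity)]
    have : (1 : ℝ) ≤ N := by exact_mod_cast hN
    linarith
  have h2 : c * (∏ j, w j) ^ (1 / (2 * N : ℝ)) * ∏ j, |G j| ^ (1 / N : ℝ) ≤ gramForm M x := by
    refine le_trans (le_of_eq ?_) (le_trans (mul_le_mul_of_nonneg_left hamgm hc.le) (h x))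
    rw [mul_assoc, ← Real.finsetProd_rpow _ _ (fun j _ => (hw j).le), ← Finset.prod_mul_distrib]
    congr 1
    refine Finset.prod_congr rfl fun j _ => ?_
    rw [Real.mul_rpow (hw j).le (sq_nonneg _), ← sq_abs (G j), ← Real.rpow_natCast (|G j|) 2,
      ← Real.rpow_mul (abs_nonneg _)]
    congr 2
    push_cast
    field_simp
  have e1 : (-(((Fintype.card (Fin K ⊕ Fin K) : ℝ) + 1) / 2)) = -((2 * (K : ℝ) + 1) / 2) := by
    simp; ring
  rw [e1]
  have hp : 0 ≤ (2 * (K : ℝ) + 1) / 2 := by positivity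
  have e2 : ∏ j, ENNReal.ofReal |G j| ^ (-((2 * (K : ℝ) + 1) / (2 * N))) =
      (ENNReal.ofReal (∏ j, |G j| ^ (1 / N : ℝ))) ^ (-((2 * (K : ℝ) + 1) / 2)) := by
    rw [ENNReal.ofReal_prod_of_nonneg (fun j _ => by positivity),
      ← ENNReal.prod_rpow_of_ne_top (fun _ _ => ENNReal.ofReal_ne_top)]
    refine Finset.prod_congr rfl fun j _ => ?_
    rw [← ENNReal.ofReal_rpow_of_nonneg (abs_nonneg _) (by positivity), ← ENNReal.rpow_mul]
    congr 1
    field_simp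
  rw [e2, ← ENNReal.mul_rpow_of_ne_top ENNReal.ofReal_ne_top ENNReal.ofReal_ne_top,
    ← ENNReal.ofReal_mul (by have : 0 < ∏ j, w j := Finset.prod_pos fun j _ => hw j
                             positivity)]
  rw [ENNReal.rpow_neg, ENNReal.rpow_neg]
  refine ENNReal.inv_le_inv.2 (ENNReal.rpow_le_rpow (ENNReal.ofReal_le_ofReal h2) hp)

lemma frobSq_le_of_gramForm_le {ι κ l : Type*} [Fintype ι] [DecidableEq ι] [Fintype κ] [Fintype l]
    (A : Matrix ι κ ℝ) (B : Matrix ι l ℝ) {c : ℝ}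
    (h : ∀ x, gramForm A x ≤ c * gramForm B x) : frobSq A ≤ c * frobSq B := by
  have e : ∀ (κ' : Type _) [Fintype κ'] (C : Matrix ι κ' ℝ),
      frobSq C = ∑ i, gramForm C (Pi.single i 1) := by
    intro κ' _ C
    simp [frobSq, gramForm]
  have e' : frobSq B = ∑ i, gramForm B (Pi.single i 1) := by simp [frobSq, gramForm]
  rw [e, e', Finset.mul_sum]
  exact Finset.sum_le_sum fun i _ => h _

/-- The prefactor in `chanBound` is a power of `1 + frobSq`, hence nonzero, and cannot hide an
infinite product. -/
lemma chartProd_ne_top {H : Matrix (Fin K) (Fin N) ℂ} (hY : chanBound H ≠ ∞) :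
    chartProd ((2 * (K : ℝ) + 1) / (2 * N)) H ≠ ∞ := by
  intro h
  refine hY ?_
  rw [chanBound, h, ENNReal.mul_top]
  have : 0 < 1 + frobSq (realRep H) := by linarith [frobSq_nonneg (realRep H)]
  rw [ENNReal.ofReal_rpow_of_pos this]
  simpa using Real.rpow_pos_of_pos this _

lemma isUnit_det_of_chanBound_ne_top {κ : Type*} [Fintype κ] (hN : 0 < N)
    (M : Matrix (Fin K ⊕ Fin K) κ ℝ)
    {H : Matrix (Fin K) (Fin N) ℂ} (hY : chanBound H ≠ ∞) {c : ℝ} (hc : 0 < c)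
    {w : Fin N ⊕ Fin N → ℝ} (hw : ∀ j, 0 < w j)
    (h : ∀ x, c * ∑ j, w j * (x ᵥ* realRep H) j ^ 2 ≤ gramForm M x) :
    IsUnit (M * Mᵀ).det := by
  refine isUnit_det_of_chartIntegral_ne_top M (ne_top_of_le_ne_top ?_
    (chartIntegral_le hN M H hc hw h))
  have : 0 < ∏ j, w j := Finset.prod_pos fun j _ => hw j
  exact ENNReal.mul_ne_top (ENNReal.rpow_ne_top_of_ne_zero (ENNReal.ofReal_pos.2 (by positivity)).ne'
    ENNReal.ofReal_ne_top) (chartProd_ne_top hY)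

/-- Bound for the trace of the inverse Gram matrix in terms of `chanBound`. -/
lemma trace_inv_le_chanBound {κ : Type*} [Fintype κ] (hK : 0 < K) (hN : 0 < N)
    (M : Matrix (Fin K ⊕ Fin K) κ ℝ)
    {H : Matrix (Fin K) (Fin N) ℂ} (hY : chanBound H ≠ ∞) {c B : ℝ} (hc : 0 < c) (hB : 0 < B)
    {w : Fin N ⊕ Fin N → ℝ} (hw : ∀ j, 0 < w j)
    (h : ∀ x, c * ∑ j, w j * (x ᵥ* realRep H) j ^ 2 ≤ gramForm M x)
    (h' : ∀ x, gramForm M x ≤ B * gramForm (realRep H) x) :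
    ENNReal.ofReal ((M * Mᵀ)⁻¹).trace ≤
      ENNReal.ofReal (2 * K * chartConst (2 * K) * B ^ ((2 * (K : ℝ) - 1) / 2) *
        (c * (∏ j, w j) ^ (1 / (2 * N : ℝ))) ^ (-((2 * (K : ℝ) + 1) / 2))) * chanBound H := by
  have hwp : 0 < ∏ j, w j := Finset.prod_pos fun j _ => hw j
  have hJ := chartIntegral_le hN M H hc hw h
  have hJtop : chartIntegral M ≠ ∞ := ne_top_of_le_ne_top
    (ENNReal.mul_ne_top (ENNReal.rpow_ne_top_of_ne_zero (ENNReal.ofReal_pos.2 (by positivity)).ne'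
    ENNReal.ofReal_ne_top) (chartProd_ne_top hY)) hJ
  have hF := frobSq_nonneg (realRep H)
  have hM : frobSq M ≤ B * (1 + frobSq (realRep H)) := by
    refine (frobSq_le_of_gramForm_le M (realRep H) h').trans ?_
    nlinarith
  refine (trace_inv_le_chartIntegral M hM hJtop).trans ?_
  have hcard : Fintype.card (Fin K ⊕ Fin K) = 2 * K := by simp; ring
  have hK1 : (1 : ℝ) ≤ K := by exact_mod_cast hK
  rw [hcard, Nat.cast_mul, Nat.cast_two, Real.mul_rpow hB.le (by positivity), chanBound]
  refine (mul_le_mul_right (mul_le_mul_right hJ _) _).trans (le_of_eq ?_)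
  have hc0 : 0 ≤ chartConst (2 * K) := (chartConst_pos _).le
  have hX : 0 < c * (∏ j, w j) ^ (1 / (2 * N : ℝ)) := by positivity
  rw [ENNReal.ofReal_rpow_of_pos hX, ENNReal.ofReal_rpow_of_pos (by positivity),
    ENNReal.ofReal_mul (p := chartConst (2 * K)) hc0, ENNReal.ofReal_mul (by positivity),
    ENNReal.ofReal_mul (p := 2 * K * chartConst (2 * K) * B ^ ((2 * (K : ℝ) - 1) / 2))
      (by positivity), ENNReal.ofReal_mul (p := 2 * K * chartConst (2 * K)) (by positivity),
    ENNReal.ofReal_mul (p := 2 * (K : ℝ)) (by positivity)]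
  have : ENNReal.ofReal (2 * (K : ℝ)) = ((2 * K : ℕ) : ℝ≥0∞) := by
    rw [← ENNReal.ofReal_natCast]; push_cast; rfl
  rw [this]
  push_cast
  ring

lemma ae_chanBound_ne_top (hK : 0 < K) (hKN : K < N) :
    ∀ᵐ z ∂(chanLaw K N), chanBound (chan z) ≠ ∞ := by
  filter_upwards [ae_lt_top measurable_chanBound (lintegral_chanBound_lt_top hK hKN).ne] with z hz
  exact hz.ne

lemma sum_one_mul_sq (H : Matrix (Fin K) (Fin N) ℂ) (x : Fin K ⊕ Fin K → ℝ) :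
    (1 : ℝ) * ∑ j, (fun _ => (1 : ℝ)) j * (x ᵥ* realRep H) j ^ 2 = gramForm (realRep H) x := by
  simp [gramForm]

lemma isUnit_det_realRep_gram (hN : 0 < N) {H : Matrix (Fin K) (Fin N) ℂ}
    (hY : chanBound H ≠ ∞) : IsUnit (realRep H * (realRep H)ᵀ).det :=
  isUnit_det_of_chanBound_ne_top hN _ hY one_pos (w := fun _ => 1) (fun _ => one_pos)
    fun x => (sum_one_mul_sq H x).le

lemma isUnit_det_gram (hN : 0 < N) {H : Matrix (Fin K) (Fin N) ℂ}
    (hY : chanBound H ≠ ∞) : IsUnit (H * Hᴴ).det := by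
  have := isUnit_det_realRep_gram hN hY
  rwa [← realRep_conjTranspose, ← realRep_mul, isUnit_det_realRep] at this

lemma realRep_gram_inv {H : Matrix (Fin K) (Fin N) ℂ} (h : IsUnit (H * Hᴴ).det) :
    (realRep H * (realRep H)ᵀ)⁻¹ = realRep (H * Hᴴ)⁻¹ := by
  rw [← realRep_conjTranspose, ← realRep_mul, realRep_inv h]

lemma trace_realRep_gram_inv {H : Matrix (Fin K) (Fin N) ℂ} (h : IsUnit (H * Hᴴ).det) :
    ((realRep H * (realRep H)ᵀ)⁻¹).trace = 2 * (zfTrace H).re := by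
  rw [realRep_gram_inv h, trace_realRep, zfTrace]

end IQ
end WLZF

namespace WLZF
open Matrix
open scoped ENNReal NNReal

/-! ### Measurability of matrix operations -/

section Measurability

variable {α : Type*} [MeasurableSpace α] {𝕜 : Type*} [RCLike 𝕜]

lemma measurable_matrix_mul {l m n : Type*} [Fintype m] {A : α → Matrix l m 𝕜}
    {B : α → Matrix m n 𝕜} (hA : ∀ i j, Measurable fun a => A a i j)
    (hB : ∀ i j, Measurable fun a => B a i j) (i : l) (j : n) :
    Measurable fun a => (A a * B a) i j := by
  simp only [Matrix.mul_apply]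
  exact Finset.measurable_sum _ fun k _ => (hA i k).mul (hB k j)

lemma measurable_matrix_det {n : Type*} [Fintype n] [DecidableEq n] {A : α → Matrix n n 𝕜}
    (hA : ∀ i j, Measurable fun a => A a i j) : Measurable fun a => (A a).det := by
  simp only [Matrix.det_apply]
  exact Finset.measurable_sum _ fun σ _ =>
    (Finset.measurable_prod _ fun i _ => hA _ _).const_smul (Equiv.Perm.sign σ)

lemma measurable_matrix_inv {n : Type*} [Fintype n] [DecidableEq n] {A : α → Matrix n n 𝕜}
    (hA : ∀ i j, Measurable fun a => A a i j) (i j : n) : Measurable fun a => (A a)⁻¹ i j := by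
  simp only [Matrix.inv_def, Matrix.smul_apply, Matrix.adjugate_apply, smul_eq_mul,
    Ring.inverse_eq_inv']
  refine (measurable_matrix_det hA).inv.mul (measurable_matrix_det fun k l => ?_)
  by_cases h : k = j
  · subst h; simp
  · simpa [Matrix.updateRow_ne h] using hA k l

lemma measurable_matrix_trace {n : Type*} [Fintype n] {A : α → Matrix n n 𝕜}
    (hA : ∀ i j, Measurable fun a => A a i j) : Measurable fun a => (A a).trace :=
  Finset.measurable_sum _ fun i _ => hA i i

end Measurability

section Invariance

variable {K N : ℕ}

lemma measurable_chan (k : Fin K) (n : Fin N) : Measurable fun z => chan (K := K) z k n :=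
  measurable_of_re_im (measurable_pi_apply _) (measurable_pi_apply _)

lemma measurable_chan_conjTranspose (k : Fin K) (n : Fin N) :
    Measurable fun z => (chan (K := K) z)ᴴ n k := by
  simp only [Matrix.conjTranspose_apply]
  exact Complex.continuous_conj.measurable.comp (measurable_chan k n)

lemma measurable_coords : Measurable fun H : Fin K → Fin N → ℂ => coords H := by
  refine measurable_pi_lambda _ fun i => ?_
  rcases i with i | i
  · exact Complex.measurable_re.comp
      ((measurable_pi_apply i.2).comp (measurable_pi_apply i.1))
  · exact Complex.measurable_im.comp
      ((measurable_pi_apply i.2).comp (measurable_pi_apply i.1))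

lemma sum_coords_mul_coords (A B : Matrix (Fin K) (Fin N) ℂ) :
    ∑ i, coords A i * coords B i = (A * Bᴴ).trace.re := by
  simp [coords, Matrix.trace, Matrix.mul_apply, Fintype.sum_sum_type, Fintype.sum_prod_type,
    Finset.sum_add_distrib]

/-- The law of the channel is invariant under unitary transformations of the antennas. -/
lemma map_mul_unitary {U : Matrix (Fin N) (Fin N) ℂ} (hU : Uᴴ * U = 1) :
    (chanLaw K N).map (fun z => coords (chan z * U)) = chanLaw K N := by
  have h := map_pi_gaussianReal (1 / 2) 1 (fun z : ChanIdx K N → ℝ => coords (chan z * U))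
    (fun t => coords (chan t * Uᴴ)) ?_ ?_ ?_
  · rw [one_mul] at h; exact h
  · have : Measurable fun z : ChanIdx K N → ℝ => (fun k n => (chan z * U) k n) :=
      measurable_pi_lambda _ fun k => measurable_pi_lambda _ fun n =>
        measurable_matrix_mul (B := fun _ => U) measurable_chan (fun _ _ => measurable_const) k n
    exact measurable_coords.comp this
  · intro t x
    have h1 := sum_coords_mul_coords (chan t) (chan x * U)
    have h2 := sum_coords_mul_coords (chan t * Uᴴ) (chan x)
    simp only [coords_chan] at h1 h2
    rw [h1, h2, Matrix.conjTranspose_mul, Matrix.mul_assoc]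
  · intro t
    have h1 := sum_coords_mul_coords (chan t) (chan t)
    have h2 := sum_coords_mul_coords (chan t * Uᴴ) (chan t * Uᴴ)
    simp only [coords_chan, ← sq] at h1 h2
    rw [h1, h2, Matrix.conjTranspose_mul, Matrix.conjTranspose_conjTranspose, Matrix.mul_assoc,
      ← Matrix.mul_assoc Uᴴ, hU, Matrix.one_mul]
    simp

lemma integral_mul_unitary {U : Matrix (Fin N) (Fin N) ℂ} (hU : Uᴴ * U = 1)
    {F : Matrix (Fin K) (Fin N) ℂ → ℂ} (hF : Measurable fun z => F (chan z)) :
    ∫ z, F (chan z * U) ∂(chanLaw K N) = ∫ z, F (chan z) ∂(chanLaw K N) := by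
  have hm : Measurable fun z : ChanIdx K N → ℝ => coords (chan z * U) :=
    measurable_coords.comp (measurable_pi_lambda _ fun k => measurable_pi_lambda _ fun n =>
        measurable_matrix_mul (B := fun _ => U) measurable_chan (fun _ _ => measurable_const) k n)
  conv_rhs => rw [← map_mul_unitary hU]
  rw [integral_map hm.aemeasurable hF.aestronglyMeasurable]
  simp

end Invariance

/-! ### Gaussian integration by parts -/

section Stein

lemma integrable_gaussianReal_iff {v : ℝ≥0} (hv : v ≠ 0) {f : ℝ → ℂ} :
    Integrable f (gaussianReal 0 v) ↔ Integrable (fun x : ℝ => gaussianPDFReal 0 v x • f x) := by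
  rw [gaussianReal_of_var_ne_zero _ hv, integrable_withDensity_iff_integrable_smul'
    (measurable_gaussianPDF _ _) (ae_of_all _ fun _ => gaussianPDF_lt_top)]
  simp [toReal_gaussianPDF]

lemma hasDerivAt_gaussianPDFReal {v : ℝ≥0} (hv : v ≠ 0) (x : ℝ) :
    HasDerivAt (gaussianPDFReal 0 v) (-(x / v) * gaussianPDFReal 0 v x) x := by
  have hv' : (v : ℝ) ≠ 0 := by exact_mod_cast hv
  have h : HasDerivAt (fun x : ℝ => (Real.sqrt (2 * Real.pi * v))⁻¹ *
      Real.exp (-(x - 0) ^ 2 / (2 * v))) ((Real.sqrt (2 * Real.pi * v))⁻¹ *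
      (Real.exp (-(x - 0) ^ 2 / (2 * v)) * (-(2 * (x - 0) ^ 1 * 1) / (2 * v)))) x := by
    refine HasDerivAt.const_mul _ (HasDerivAt.exp ?_)
    refine HasDerivAt.div_const (HasDerivAt.neg ?_) _
    simpa using (((hasDerivAt_id x).sub_const 0).fun_pow 2)
  rw [gaussianPDFReal_def]
  convert h using 1
  field_simp
  ring

/-- Gaussian integration by parts in one variable. -/
lemma integral_mul_gaussianReal {v : ℝ≥0} (hv : v ≠ 0) {f f' : ℝ → ℂ}
    (hf : ∀ x, HasDerivAt f (f' x) x) (h1 : Integrable f (gaussianReal 0 v))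
    (h2 : Integrable f' (gaussianReal 0 v))
    (h3 : Integrable (fun x : ℝ => (x : ℂ) * f x) (gaussianReal 0 v)) :
    ∫ x : ℝ, (x : ℂ) * f x ∂(gaussianReal 0 v) = v * ∫ x, f' x ∂(gaussianReal 0 v) := by
  have hv' : (v : ℂ) ≠ 0 := by exact_mod_cast hv
  rw [integrable_gaussianReal_iff hv] at h1 h2 h3
  have hρ : ∀ x, HasDerivAt (fun x => ((gaussianPDFReal 0 v x : ℝ) : ℂ))
      ((-(x / v) * gaussianPDFReal 0 v x : ℝ) : ℂ) x := fun x =>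
    (hasDerivAt_gaussianPDFReal hv x).ofReal_comp
  -- The density satisfies `ρ' = -(x/v) ρ`, so the weight `x` is a derivative; integrability of the
  -- products makes the boundary terms vanish.
  have key := integral_mul_deriv_eq_deriv_mul_of_integrable (u := f)
    (v := fun x => ((gaussianPDFReal 0 v x : ℝ) : ℂ)) (u' := f')
    (v' := fun x => ((-(x / v) * gaussianPDFReal 0 v x : ℝ) : ℂ))
    (fun x _ => hf x) (fun x _ => hρ x) ?_ ?_ ?_
  · rw [integral_gaussianReal_eq_integral_smul hv, integral_gaussianReal_eq_integral_smul hv]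
    have e1 : ∫ x, f x * ((-(x / v) * gaussianPDFReal 0 v x : ℝ) : ℂ) =
        -(v : ℂ)⁻¹ * ∫ x : ℝ, gaussianPDFReal 0 v x • ((x : ℂ) * f x) := by
      rw [← integral_const_mul]
      congr 1
      ext x
      simp only [Complex.real_smul]
      push_cast
      field_simp
    have e2 : ∫ x, f' x * ((gaussianPDFReal 0 v x : ℝ) : ℂ) =
        ∫ x : ℝ, gaussianPDFReal 0 v x • f' x := by
      congr 1
      ext x
      simp only [Complex.real_smul, mul_comm]
    rw [e1, e2] at key
    field_simp at key
    linear_combination -key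
  · refine (h3.const_mul (-(v : ℂ)⁻¹)).congr (ae_of_all _ fun x => ?_)
    simp only [Complex.real_smul, Pi.mul_apply]
    push_cast
    field_simp
  · refine h2.congr (ae_of_all _ fun x => ?_)
    simp only [Complex.real_smul, Pi.mul_apply, mul_comm]
  · refine h1.congr (ae_of_all _ fun x => ?_)
    simp only [Complex.real_smul, Pi.mul_apply, mul_comm]

variable {ι : Type*} [Fintype ι] [DecidableEq ι]

/-- Resampling one coordinate does not change the product law. With Fubini this reduces integration
by parts in coordinate `i` to the one-variable case, the other coordinates being frozen. -/
lemma measurePreserving_update (ν : Measure ℝ) [IsProbabilityMeasure ν] (i : ι) :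
    MeasurePreserving (fun p : (ι → ℝ) × ℝ => Function.update p.1 i p.2)
      ((Measure.pi fun _ => ν).prod ν) (Measure.pi fun _ => ν) := by
  have hm : Measurable fun p : (ι → ℝ) × ℝ => Function.update p.1 i p.2 := by
    refine measurable_pi_lambda _ fun j => ?_
    by_cases h : j = i
    · subst h; simpa using measurable_snd
    · simp only [Function.update_of_ne h]; fun_prop
  refine ⟨hm, (Measure.pi_eq fun s hs => ?_).symm⟩
  rw [Measure.map_apply hm (MeasurableSet.univ_pi hs)]
  have : (fun p : (ι → ℝ) × ℝ => Function.update p.1 i p.2) ⁻¹' Set.univ.pi s =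
      (Set.univ.pi (Function.update s i Set.univ)) ×ˢ s i := by
    ext p
    simp only [Set.mem_preimage, Set.mem_univ_pi, Set.mem_prod]
    constructor
    · intro h
      refine ⟨fun j => ?_, by simpa using h i⟩
      by_cases hj : j = i
      · subst hj; simp
      · simpa [Function.update_of_ne hj] using h j
    · rintro ⟨h1, h2⟩ j
      by_cases hj : j = i
      · subst hj; simpa using h2
      · simpa [Function.update_of_ne hj] using h1 j
  rw [this, Measure.prod_prod, Measure.pi_pi, ← Finset.mul_prod_erase _ _ (Finset.mem_univ i),
    ← Finset.mul_prod_erase _ _ (Finset.mem_univ i)]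
  simp only [Function.update_self, measure_univ, one_mul]
  rw [mul_comm]
  congr 1
  refine Finset.prod_congr rfl fun j hj => ?_
  rw [Function.update_of_ne (Finset.ne_of_mem_erase hj)]

/-- Gaussian integration by parts in one coordinate. -/
lemma integral_coord_mul {v : ℝ≥0} (hv : v ≠ 0) (i : ι) {f f' : (ι → ℝ) → ℂ}
    (hf : ∀ z t, HasDerivAt (fun t => f (Function.update z i t)) (f' (Function.update z i t)) t)
    (h1 : Integrable f (Measure.pi fun _ => gaussianReal 0 v))
    (h2 : Integrable f' (Measure.pi fun _ => gaussianReal 0 v))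
    (h3 : Integrable (fun z => (z i : ℂ) * f z) (Measure.pi fun _ => gaussianReal 0 v)) :
    ∫ z, (z i : ℂ) * f z ∂(Measure.pi fun _ => gaussianReal 0 v) =
      v * ∫ z, f' z ∂(Measure.pi fun _ => gaussianReal 0 v) := by
  have hmp := measurePreserving_update (ι := ι) (gaussianReal 0 v) i
  have hint : ∀ {F : (ι → ℝ) → ℂ}, Integrable F (Measure.pi fun _ => gaussianReal 0 v) →
      Integrable (fun p : (ι → ℝ) × ℝ => F (Function.update p.1 i p.2))
        ((Measure.pi fun _ => gaussianReal 0 v).prod (gaussianReal 0 v)) ∧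
      ∫ z, F z ∂(Measure.pi fun _ => gaussianReal 0 v) =
        ∫ z, ∫ t, F (Function.update z i t) ∂(gaussianReal 0 v)
          ∂(Measure.pi fun _ => gaussianReal 0 v) := by
    intro F hF
    have hF2 : Integrable (fun p : (ι → ℝ) × ℝ => F (Function.update p.1 i p.2))
        ((Measure.pi fun _ => gaussianReal 0 v).prod (gaussianReal 0 v)) :=
      (hmp.integrable_comp hF.aestronglyMeasurable).2 hF
    refine ⟨hF2, ?_⟩
    rw [← integral_prod (fun p : (ι → ℝ) × ℝ => F (Function.update p.1 i p.2)) hF2]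
    conv_lhs => rw [← hmp.map_eq]
    rw [integral_map hmp.measurable.aemeasurable]
    rw [hmp.map_eq]
    exact hF.aestronglyMeasurable
  rw [(hint h3).2, (hint h2).2, ← integral_const_mul]
  refine integral_congr_ae ?_
  filter_upwards [(hint h1).1.prod_right_ae, (hint h2).1.prod_right_ae,
    (hint h3).1.prod_right_ae] with z z1 z2 z3
  simp only [Function.update_self] at z3 ⊢
  exact integral_mul_gaussianReal hv (hf z) z1 z2 z3

end Stein

/-! ### Derivative of the matrix inverse -/

section Deriv

variable {n : Type*} [Fintype n] [DecidableEq n]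

lemma differentiableAt_matrix_det {A : ℝ → Matrix n n ℂ} {t : ℝ}
    (h : ∀ i j, DifferentiableAt ℝ (fun t => A t i j) t) :
    DifferentiableAt ℝ (fun t => (A t).det) t := by
  simp only [Matrix.det_apply]
  refine DifferentiableAt.fun_sum fun σ _ => ?_
  refine DifferentiableAt.fun_const_smul ?_ (Equiv.Perm.sign σ)
  exact DifferentiableAt.fun_finsetProd fun i _ => h _ _

/-- Cramer's rule gives differentiability of the entries; their derivatives are then identified by
differentiating `A A⁻¹ = 1`. Everything is entrywise, so no norm on matrices has to be chosen. -/
lemma hasDerivAt_matrix_inv {A : ℝ → Matrix n n ℂ} {A' : Matrix n n ℂ} {t : ℝ}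
    (h : ∀ i j, HasDerivAt (fun t => A t i j) (A' i j) t) (hu : ∀ t, IsUnit (A t).det) (i j : n) :
    HasDerivAt (fun t => (A t)⁻¹ i j) ((-((A t)⁻¹ * A' * (A t)⁻¹)) i j) t := by
  have hd : ∀ i j, DifferentiableAt ℝ (fun t => (A t)⁻¹ i j) t := by
    intro i j
    simp only [Matrix.inv_def, Matrix.smul_apply, Matrix.adjugate_apply, smul_eq_mul,
      Ring.inverse_eq_inv']
    refine DifferentiableAt.fun_mul (DifferentiableAt.fun_inv
      (differentiableAt_matrix_det fun i j => (h i j).differentiableAt) (hu t).ne_zero)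
      (differentiableAt_matrix_det fun k l => ?_)
    by_cases hk : k = j
    · subst hk; simp
    · simpa [Matrix.updateRow_ne hk] using (h k l).differentiableAt
  set D : Matrix n n ℂ := fun i j => deriv (fun t => (A t)⁻¹ i j) t with hD
  have hD' : ∀ i j, HasDerivAt (fun t => (A t)⁻¹ i j) (D i j) t := fun i j => (hd i j).hasDerivAt
  have hprod : A' * (A t)⁻¹ + A t * D = 0 := by
    ext i j
    have h1 : HasDerivAt (fun t => (A t * (A t)⁻¹) i j) ((A' * (A t)⁻¹ + A t * D) i j) t := by
      simp only [Matrix.mul_apply, Matrix.add_apply, ← Finset.sum_add_distrib]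
      exact HasDerivAt.fun_sum fun k _ => (h i k).mul (hD' k j)
    have h2 : (fun t => (A t * (A t)⁻¹) i j) = fun _ => (1 : Matrix n n ℂ) i j :=
      funext fun s => by rw [Matrix.mul_nonsing_inv _ (hu s)]
    rw [h2] at h1
    exact h1.unique (hasDerivAt_const _ _)
  have : D = -((A t)⁻¹ * A' * (A t)⁻¹) := by
    have h3 := congrArg (fun M => (A t)⁻¹ * M) hprod
    simp only [Matrix.mul_add, ← Matrix.mul_assoc, Matrix.nonsing_inv_mul _ (hu t),
      Matrix.one_mul, Matrix.mul_zero] at h3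
    exact eq_neg_of_add_eq_zero_right h3
  rw [← this]
  exact hD' i j

end Deriv
end WLZF

namespace WLZF
open Matrix
open scoped ENNReal NNReal ComplexOrder

/-! ### The regularized inverse -/

section Regularized

variable {K N : ℕ}

lemma trace_eq_ofReal_re {n : Type*} [Fintype n] {A : Matrix n n ℂ} (hA : A.PosSemidef) :
    A.trace = (A.trace.re : ℂ) ∧ 0 ≤ A.trace.re := by
  have h := Complex.le_def.1 hA.trace_nonneg
  exact ⟨Complex.ext rfl (by simpa using h.2.symm), by simpa using h.1⟩

lemma diag_eq_ofReal_re {n : Type*} [Fintype n] {A : Matrix n n ℂ} (hA : A.PosSemidef) (i : n) :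
    A i i = ((A i i).re : ℂ) ∧ 0 ≤ (A i i).re := by
  have h := Complex.le_def.1 (hA.diag_nonneg (i := i))
  exact ⟨Complex.ext rfl (by simpa using h.2.symm), by simpa using h.1⟩

lemma norm_diag_le_trace {n : Type*} [Fintype n] {A : Matrix n n ℂ} (hA : A.PosSemidef) (i : n) :
    ‖A i i‖ ≤ A.trace.re := by
  have h := diag_eq_ofReal_re hA
  rw [(h i).1, Complex.norm_real, Real.norm_of_nonneg (h i).2, Matrix.trace, Complex.re_sum]
  exact Finset.single_le_sum (f := fun i => (A i i).re) (fun j _ => (h j).2) (Finset.mem_univ i)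

lemma norm_sq_le_trace {m n : Type*} [Fintype m] [Fintype n] (X : Matrix m n ℂ) (i : m) (j : n) :
    ‖X i j‖ ^ 2 ≤ ((Xᴴ * X) j j).re := by
  rw [Matrix.mul_apply, Complex.re_sum]
  refine le_trans (le_of_eq ?_) (Finset.single_le_sum
    (f := fun i => (Xᴴ j i * X i j).re) (fun k _ => ?_) (Finset.mem_univ i))
  · simp [Complex.sq_norm, Complex.normSq_apply]
  · simp only [Matrix.conjTranspose_apply, RCLike.star_def, Complex.mul_re, Complex.conj_re,
      Complex.conj_im]
    nlinarith [mul_self_nonneg (X k j).re, mul_self_nonneg (X k j).im]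

/-- The regularized inverse `(H Hᴴ + ε)⁻¹`. -/
noncomputable def regInv (ε : ℝ) (H : Matrix (Fin K) (Fin N) ℂ) : Matrix (Fin K) (Fin K) ℂ :=
  (H * Hᴴ + (ε : ℂ) • 1)⁻¹

lemma posDef_reg {ε : ℝ} (hε : 0 < ε) (H : Matrix (Fin K) (Fin N) ℂ) :
    (H * Hᴴ + (ε : ℂ) • 1).PosDef := by
  refine Matrix.PosDef.posSemidef_add (Matrix.posSemidef_self_mul_conjTranspose H) ?_
  exact Matrix.PosDef.one.smul (by exact_mod_cast hε)

lemma isUnit_det_reg {ε : ℝ} (hε : 0 < ε) (H : Matrix (Fin K) (Fin N) ℂ) :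
    IsUnit (H * Hᴴ + (ε : ℂ) • 1).det :=
  (Matrix.isUnit_iff_isUnit_det _).1 (posDef_reg hε H).isUnit

lemma posSemidef_regInv {ε : ℝ} (hε : 0 < ε) (H : Matrix (Fin K) (Fin N) ℂ) :
    (regInv ε H).PosSemidef := (posDef_reg hε H).inv.posSemidef

lemma regInv_mul_gram {ε : ℝ} (hε : 0 < ε) (H : Matrix (Fin K) (Fin N) ℂ) :
    regInv ε H * (H * Hᴴ) = 1 - (ε : ℂ) • regInv ε H := by
  have h := Matrix.nonsing_inv_mul _ (isUnit_det_reg hε H)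
  rw [Matrix.mul_add, Matrix.mul_smul, Matrix.mul_one] at h
  exact eq_sub_of_add_eq h

lemma posSemidef_reg_proj {ε : ℝ} (hε : 0 < ε) (H : Matrix (Fin K) (Fin N) ℂ) :
    (Hᴴ * regInv ε H * H).PosSemidef :=
  (posSemidef_regInv hε H).conjTranspose_mul_mul_same H

/-- Cyclicity and `R H Hᴴ = 1 - ε R`. Since the left side is nonnegative, this gives `ε Tr R ≤ K`,
the source of the bounds at fixed `ε` that make integration by parts legitimate. -/
lemma trace_reg_proj {ε : ℝ} (hε : 0 < ε) (H : Matrix (Fin K) (Fin N) ℂ) :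
    (Hᴴ * regInv ε H * H).trace = K - ε * (regInv ε H).trace := by
  rw [Matrix.mul_assoc, Matrix.trace_mul_comm, Matrix.mul_assoc, regInv_mul_gram hε]
  simp [Matrix.trace_sub, Matrix.trace_smul]

lemma mul_trace_regInv_le {ε : ℝ} (hε : 0 < ε) (H : Matrix (Fin K) (Fin N) ℂ) :
    ε * (regInv ε H).trace.re ≤ K := by
  have h := (trace_eq_ofReal_re (posSemidef_reg_proj hε H)).2
  rw [trace_reg_proj hε] at h
  simp at h
  linarith

lemma trace_regInv_le {ε : ℝ} (hε : 0 < ε) (H : Matrix (Fin K) (Fin N) ℂ) :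
    (regInv ε H).trace.re ≤ K / ε := by
  rw [le_div_iff₀ hε, mul_comm]; exact mul_trace_regInv_le hε H

lemma norm_regInv_diag_le {ε : ℝ} (hε : 0 < ε) (H : Matrix (Fin K) (Fin N) ℂ) (k : Fin K) :
    ‖regInv ε H k k‖ ≤ K / ε :=
  (norm_diag_le_trace (posSemidef_regInv hε H) k).trans (trace_regInv_le hε H)

lemma norm_reg_proj_diag_le {ε : ℝ} (hε : 0 < ε) (H : Matrix (Fin K) (Fin N) ℂ) (n : Fin N) :
    ‖(Hᴴ * regInv ε H * H) n n‖ ≤ K := by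
  refine (norm_diag_le_trace (posSemidef_reg_proj hε H) n).trans ?_
  rw [trace_reg_proj hε]
  have := (trace_eq_ofReal_re (posSemidef_regInv hε H)).2
  simp
  positivity

/-- The squared entries of `R H` are bounded by `Tr (R H)ᴴ (R H) = Tr R (1 - ε R) ≤ Tr R ≤ K / ε`.
-/
lemma norm_sq_regInv_mul_le {ε : ℝ} (hε : 0 < ε) (H : Matrix (Fin K) (Fin N) ℂ) (k : Fin K)
    (n : Fin N) : ‖(regInv ε H * H) k n‖ ^ 2 ≤ K / ε := by
  have hps : ((regInv ε H * H)ᴴ * (regInv ε H * H)).PosSemidef :=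
    Matrix.posSemidef_conjTranspose_mul_self _
  have hR : (regInv ε H)ᴴ = regInv ε H := (posSemidef_regInv hε H).isHermitian
  refine (norm_sq_le_trace _ k n).trans (((Complex.re_le_norm _).trans
    (norm_diag_le_trace hps n)).trans (le_trans ?_ (trace_regInv_le hε H)))
  rw [Matrix.conjTranspose_mul, hR, Matrix.mul_assoc, Matrix.trace_mul_comm, Matrix.mul_assoc,
    Matrix.mul_assoc, regInv_mul_gram hε, Matrix.mul_sub, Matrix.mul_one, Matrix.trace_sub,
    Matrix.mul_smul, Matrix.trace_smul]
  have h2 : (regInv ε H * regInv ε H).PosSemidef := by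
    have := Matrix.posSemidef_conjTranspose_mul_self (regInv ε H)
    rwa [hR] at this
  have h3 := (trace_eq_ofReal_re h2).2
  simp only [smul_eq_mul, Complex.sub_re, Complex.re_ofReal_mul]
  nlinarith

/-! #### Measurability -/

lemma measurable_gram (k l : Fin K) :
    Measurable fun z : ChanIdx K N → ℝ => (chan z * (chan z)ᴴ) k l :=
  measurable_matrix_mul measurable_chan (fun n k => measurable_chan_conjTranspose k n) k l

lemma measurable_regInv (ε : ℝ) (k l : Fin K) :
    Measurable fun z : ChanIdx K N → ℝ => regInv ε (chan z) k l := by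
  refine measurable_matrix_inv (fun i j => ?_) k l
  simp only [Matrix.add_apply]
  exact (measurable_gram i j).add measurable_const

lemma measurable_regInv_mul (ε : ℝ) (k : Fin K) (n : Fin N) :
    Measurable fun z : ChanIdx K N → ℝ => (regInv ε (chan z) * chan z) k n :=
  measurable_matrix_mul (measurable_regInv ε) measurable_chan k n

lemma measurable_reg_proj (ε : ℝ) (m n : Fin N) :
    Measurable fun z : ChanIdx K N → ℝ => ((chan z)ᴴ * regInv ε (chan z) * chan z) m n :=
  measurable_matrix_mul (measurable_matrix_mul (fun n k => measurable_chan_conjTranspose k n)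
    (measurable_regInv ε)) measurable_chan m n

lemma measurable_trace_regInv (ε : ℝ) :
    Measurable fun z : ChanIdx K N → ℝ => (regInv ε (chan z)).trace :=
  measurable_matrix_trace (measurable_regInv ε)

/-! #### Derivatives -/

lemma mul_single_mul_apply (A : Matrix (Fin K) (Fin K) ℂ) (B : Matrix (Fin N) (Fin N) ℂ) (c : ℂ)
    (k : Fin K) (n : Fin N) (i : Fin K) (j : Fin N) :
    (A * Matrix.single k n c * B) i j = c * A i k * B n j := by
  rw [Matrix.mul_apply, Finset.sum_eq_single n]
  · simp [mul_comm]
  · intro b _ hb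
    simp [Matrix.mul_apply, hb.symm]
  · simp

lemma hasDerivAt_chan_inl (z : ChanIdx K N → ℝ) (k : Fin K) (n : Fin N) (t : ℝ) (i : Fin K)
    (j : Fin N) : HasDerivAt (fun t => chan (Function.update z (Sum.inl (k, n)) t) i j)
      (Matrix.single k n (1 : ℂ) i j) t := by
  by_cases h : k = i ∧ n = j
  · obtain ⟨rfl, rfl⟩ := h
    have : (fun t => chan (Function.update z (Sum.inl (k, n)) t) k n) =
        fun t : ℝ => (t : ℂ) + Complex.I * (z (Sum.inr (k, n)) : ℂ) := by
      ext t
      apply Complex.ext <;> simp [chan]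
    rw [this]
    simpa using ((hasDerivAt_id t).ofReal_comp).add_const (Complex.I * (z (Sum.inr (k, n)) : ℂ))
  · have hne : (Sum.inl (i, j) : ChanIdx K N) ≠ Sum.inl (k, n) := by
      intro h2; simp at h2; exact h ⟨h2.1.symm, h2.2.symm⟩
    have : (fun t => chan (Function.update z (Sum.inl (k, n)) t) i j) = fun _ => chan z i j := by
      ext t
      simp only [chan, Function.update_of_ne hne]
      rw [Function.update_of_ne (by simp)]
    rw [this, Matrix.single_apply, if_neg h]
    exact hasDerivAt_const _ _

lemma hasDerivAt_chan_inr (z : ChanIdx K N → ℝ) (k : Fin K) (n : Fin N) (t : ℝ) (i : Fin K)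
    (j : Fin N) : HasDerivAt (fun t => chan (Function.update z (Sum.inr (k, n)) t) i j)
      (Matrix.single k n Complex.I i j) t := by
  by_cases h : k = i ∧ n = j
  · obtain ⟨rfl, rfl⟩ := h
    have : (fun t => chan (Function.update z (Sum.inr (k, n)) t) k n) =
        fun t : ℝ => (t : ℂ) * Complex.I + (z (Sum.inl (k, n)) : ℂ) := by
      ext t
      apply Complex.ext <;> simp [chan]
    rw [this]
    simpa using (((hasDerivAt_id t).ofReal_comp).mul_const Complex.I).add_const
      (z (Sum.inl (k, n)) : ℂ)
  · have hne : (Sum.inr (i, j) : ChanIdx K N) ≠ Sum.inr (k, n) := by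
      intro h2; simp at h2; exact h ⟨h2.1.symm, h2.2.symm⟩
    have : (fun t => chan (Function.update z (Sum.inr (k, n)) t) i j) = fun _ => chan z i j := by
      ext t
      simp only [chan, Function.update_of_ne hne]
      rw [Function.update_of_ne (by simp)]
    rw [this, Matrix.single_apply, if_neg h]
    exact hasDerivAt_const _ _

lemma hasDerivAt_matrix_mul {l m n : Type*} [Fintype m] {A : ℝ → Matrix l m ℂ}
    {B : ℝ → Matrix m n ℂ} {A' : Matrix l m ℂ} {B' : Matrix m n ℂ} {t : ℝ}
    (hA : ∀ i j, HasDerivAt (fun t => A t i j) (A' i j) t)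
    (hB : ∀ i j, HasDerivAt (fun t => B t i j) (B' i j) t) (i : l) (j : n) :
    HasDerivAt (fun t => (A t * B t) i j) ((A' * B t + A t * B') i j) t := by
  simp only [Matrix.mul_apply, Matrix.add_apply, ← Finset.sum_add_distrib]
  exact HasDerivAt.fun_sum fun k _ => (hA i k).mul (hB k j)

/-- The directions `c = 1` and `c = I` are those of the real and imaginary parts of the entry `(k,
n)`. The conjugate of `c` comes from the occurrence of `Hᴴ` in the inverse, and the square it
multiplies cancels when the two directions are combined. -/
lemma hasDerivAt_regInv_mul {ε : ℝ} (hε : 0 < ε) {X : ℝ → Matrix (Fin K) (Fin N) ℂ} {c : ℂ}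
    {k : Fin K} {n : Fin N} {t : ℝ}
    (hX : ∀ i j, HasDerivAt (fun t => X t i j) (Matrix.single k n c i j) t) :
    HasDerivAt (fun t => (regInv ε (X t) * X t) k n)
      (c * (regInv ε (X t) k k * (1 - ((X t)ᴴ * regInv ε (X t) * X t) n n)) -
        starRingEnd ℂ c * (regInv ε (X t) * X t) k n ^ 2) t := by
  have hXs : ∀ i j, HasDerivAt (fun t => (X t)ᴴ i j) ((Matrix.single k n c)ᴴ i j) t := by
    intro i j
    simp only [Matrix.conjTranspose_apply]
    exact (hX j i).star
  have hA : ∀ i j, HasDerivAt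
      (fun t => (X t * (X t)ᴴ + (ε : ℂ) • 1 : Matrix (Fin K) (Fin K) ℂ) i j)
      ((Matrix.single k n c * (X t)ᴴ + X t * (Matrix.single k n c)ᴴ) i j) t := by
    intro i j
    exact (hasDerivAt_matrix_mul hX hXs i j).add_const _
  have hR : ∀ i j, HasDerivAt (fun t => regInv ε (X t) i j) ((-(regInv ε (X t) *
      (Matrix.single k n c * (X t)ᴴ + X t * (Matrix.single k n c)ᴴ) * regInv ε (X t))) i j) t :=
    hasDerivAt_matrix_inv hA (fun t => isUnit_det_reg hε (X t))
  have hRX := hasDerivAt_matrix_mul hR hX k n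
  convert hRX using 1
  set R := regInv ε (X t)
  have e0 : (R * Matrix.single k n c) k n = c * R k k := by
    have := mul_single_mul_apply R 1 c k n k n
    simpa using this
  have e1 : (R * Matrix.single k n c * ((X t)ᴴ * R * X t)) k n =
      c * R k k * ((X t)ᴴ * R * X t) n n := mul_single_mul_apply R _ c k n k n
  have e2 : (R * X t * (Matrix.single k n c)ᴴ * (R * X t)) k n =
      starRingEnd ℂ c * (R * X t) k n * (R * X t) k n := by
    rw [Matrix.conjTranspose_single, Matrix.mul_apply, Finset.sum_eq_single k]
    · simp [mul_comm]
    · intro b _ hb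
      simp [Matrix.mul_apply, hb.symm]
    · simp
  have e3 : -(R * (Matrix.single k n c * (X t)ᴴ + X t * (Matrix.single k n c)ᴴ) * R) * X t =
      -(R * Matrix.single k n c * ((X t)ᴴ * R * X t)) -
        R * X t * (Matrix.single k n c)ᴴ * (R * X t) := by
    simp only [Matrix.mul_add, Matrix.add_mul, Matrix.neg_mul, Matrix.mul_assoc, neg_add,
      sub_eq_add_neg]
  rw [e3, Matrix.add_apply, Matrix.sub_apply, Matrix.neg_apply, e0, e1, e2]
  ring

end Regularized
end WLZF

namespace WLZF
open Matrix
open scoped ENNReal NNReal ComplexOrder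

/-! ### The expected trace of the inverse Gram matrix -/

section ZFMoment

variable {K N : ℕ}

lemma integrable_coord (i : ChanIdx K N) :
    Integrable (fun z : ChanIdx K N → ℝ => ((z i : ℝ) : ℂ)) (chanLaw K N) := by
  have h := (IsGaussian.memLp_id (chanLaw K N) 1 (by simp)).integrable le_rfl
  refine Integrable.ofReal ?_
  refine h.norm.mono (measurable_pi_apply i).aestronglyMeasurable (ae_of_all _ fun z => ?_)
  simpa using norm_le_pi_norm z i

lemma integrable_of_measurable_of_bound {F : (ChanIdx K N → ℝ) → ℂ} (hF : Measurable F) {C : ℝ}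
    (hC : ∀ z, ‖F z‖ ≤ C) : Integrable F (chanLaw K N) :=
  Integrable.of_bound hF.aestronglyMeasurable C (ae_of_all _ hC)

/-- Write the conjugate of `H k n` as `x - I y` and integrate by parts in `x` and `y`, each of
variance `1/2`. With `f = (R H) k n` the two contributions are `(a - f²)/2` and `-I (I a + I f²)/2 =
(a + f²)/2`, whose sum is `a`. -/
lemma integral_conj_mul_regInv {ε : ℝ} (hε : 0 < ε) (k : Fin K) (n : Fin N) :
    Integrable (fun z => starRingEnd ℂ (chan z k n) * (regInv ε (chan z) * chan z) k n)
        (chanLaw K N) ∧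
      ∫ z, starRingEnd ℂ (chan z k n) * (regInv ε (chan z) * chan z) k n ∂(chanLaw K N) =
        ∫ z, regInv ε (chan z) k k * (1 - ((chan z)ᴴ * regInv ε (chan z) * chan z) n n)
          ∂(chanLaw K N) := by
  set μ := chanLaw K N with hμ
  set f : (ChanIdx K N → ℝ) → ℂ := fun z => (regInv ε (chan z) * chan z) k n with hf
  set a : (ChanIdx K N → ℝ) → ℂ := fun z =>
    regInv ε (chan z) k k * (1 - ((chan z)ᴴ * regInv ε (chan z) * chan z) n n) with ha
  have hε' : 0 ≤ K / ε := by positivity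
  have hfm : Measurable f := measurable_regInv_mul ε k n
  have ham : Measurable a := (measurable_regInv ε k k).mul
    (measurable_const.sub (measurable_reg_proj ε n n))
  have hfb : ∀ z, ‖f z‖ ≤ Real.sqrt (K / ε) := fun z =>
    Real.le_sqrt_of_sq_le (norm_sq_regInv_mul_le hε _ k n)
  have hab : ∀ z, ‖a z‖ ≤ K / ε * (1 + K) := by
    intro z
    rw [ha, norm_mul]
    refine mul_le_mul (norm_regInv_diag_le hε _ k) ((norm_sub_le _ _).trans ?_)
      (norm_nonneg _) hε'
    rw [norm_one]
    linarith [norm_reg_proj_diag_le hε (chan z) n]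
  have hfi : Integrable f μ := integrable_of_measurable_of_bound hfm hfb
  have hai : Integrable a μ := integrable_of_measurable_of_bound ham hab
  have hf2i : Integrable (fun z => f z ^ 2) μ :=
    integrable_of_measurable_of_bound (hfm.pow_const 2) (C := K / ε) fun z => by
      rw [norm_pow]; exact norm_sq_regInv_mul_le hε _ k n
  have hzi : ∀ i, Integrable (fun z : ChanIdx K N → ℝ => ((z i : ℝ) : ℂ) * f z) μ := fun i =>
    (integrable_coord i).mul_bdd hfm.aestronglyMeasurable (ae_of_all _ hfb)
  have s1 := integral_coord_mul (v := 1 / 2) (by simp) (Sum.inl (k, n) : ChanIdx K N) (f := f)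
    (f' := fun z => a z - f z ^ 2) (fun z t => by
      have h := hasDerivAt_regInv_mul hε (t := t) (hasDerivAt_chan_inl z k n t)
      simpa using h) hfi (hai.sub hf2i) (hzi _)
  have s2 := integral_coord_mul (v := 1 / 2) (by simp) (Sum.inr (k, n) : ChanIdx K N) (f := f)
    (f' := fun z => Complex.I * a z + Complex.I * f z ^ 2) (fun z t => by
      have h := hasDerivAt_regInv_mul hε (t := t) (hasDerivAt_chan_inr z k n t)
      simpa using h) hfi ((hai.const_mul _).add (hf2i.const_mul _)) (hzi _)
  have e : (fun z => starRingEnd ℂ (chan z k n) * f z) = fun z : ChanIdx K N → ℝ =>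
      ((z (Sum.inl (k, n)) : ℝ) : ℂ) * f z -
        Complex.I * (((z (Sum.inr (k, n)) : ℝ) : ℂ) * f z) := by
    ext z
    have : starRingEnd ℂ (chan z k n) = (z (Sum.inl (k, n)) : ℂ) -
      Complex.I * (z (Sum.inr (k, n)) : ℂ) := by
      apply Complex.ext <;> simp [chan]
    rw [this]; ring
  constructor
  · change Integrable (fun z => starRingEnd ℂ (chan z k n) * f z) μ
    rw [e]
    exact (hzi _).sub ((hzi _).const_mul _)
  · change ∫ z, starRingEnd ℂ (chan z k n) * f z ∂μ = ∫ z, a z ∂μ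
    rw [e, integral_sub (hzi _) ((hzi _).const_mul _), integral_const_mul]
    change ∫ z : ChanIdx K N → ℝ, (z (Sum.inl (k, n)) : ℂ) * f z
      ∂(Measure.pi fun _ => gaussianReal 0 (1 / 2)) - Complex.I *
      ∫ z : ChanIdx K N → ℝ, (z (Sum.inr (k, n)) : ℂ) * f z
      ∂(Measure.pi fun _ => gaussianReal 0 (1 / 2)) = ∫ z, a z ∂μ
    rw [s1, s2]
    change ((1 / 2 : ℝ≥0) : ℂ) * ∫ z, (a z - f z ^ 2) ∂μ - Complex.I * (((1 / 2 : ℝ≥0) : ℂ) *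
      ∫ z, (Complex.I * a z + Complex.I * f z ^ 2) ∂μ) = _
    rw [integral_sub hai hf2i, integral_add (hai.const_mul _) (hf2i.const_mul _),
      integral_const_mul, integral_const_mul]
    push_cast
    linear_combination (-(1 / 2 : ℂ)) * (∫ z, a z ∂μ + ∫ z, f z ^ 2 ∂μ) * Complex.I_sq

/-- Sum of the entrywise identities: on the left `Tr Hᴴ R H = K - ε Tr R`, on the right `Tr R` times
`N - Tr Hᴴ R H`. -/
lemma integral_reg_identity {ε : ℝ} (hε : 0 < ε) :
    ∫ z, ((K : ℝ) - ε * (regInv ε (chan (K := K) (N := N) z)).trace.re) ∂(chanLaw K N) =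
      ∫ z, (regInv ε (chan z)).trace.re *
        ((N : ℝ) - K + ε * (regInv ε (chan z)).trace.re) ∂(chanLaw K N) := by
  have hε' : 0 ≤ K / ε := by positivity
  have h1 : ∫ z, ∑ k, ∑ n, starRingEnd ℂ (chan z k n) * (regInv ε (chan z) * chan z) k n
      ∂(chanLaw K N) = ∫ z, ∑ k, ∑ n, regInv ε (chan z) k k *
        (1 - ((chan z)ᴴ * regInv ε (chan z) * chan z) n n) ∂(chanLaw K N) := by
    rw [integral_finsetSum _ fun k _ => integrable_finsetSum _ fun n _ =>
      (integral_conj_mul_regInv hε k n).1, integral_finsetSum]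
    · refine Finset.sum_congr rfl fun k _ => ?_
      rw [integral_finsetSum _ fun n _ => (integral_conj_mul_regInv hε k n).1, integral_finsetSum]
      · exact Finset.sum_congr rfl fun n _ => (integral_conj_mul_regInv hε k n).2
      · intro n _
        refine integrable_of_measurable_of_bound ((measurable_regInv ε k k).mul
          (measurable_const.sub (measurable_reg_proj ε n n))) (C := K / ε * (1 + K)) fun z => ?_
        rw [norm_mul]
        refine mul_le_mul (norm_regInv_diag_le hε _ k) ((norm_sub_le _ _).trans ?_)
          (norm_nonneg _) hε'
        rw [norm_one]
        linarith [norm_reg_proj_diag_le hε (chan z) n]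
    · intro k _
      refine integrable_finsetSum _ fun n _ => ?_
      refine integrable_of_measurable_of_bound ((measurable_regInv ε k k).mul
          (measurable_const.sub (measurable_reg_proj ε n n))) (C := K / ε * (1 + K)) fun z => ?_
      rw [norm_mul]
      refine mul_le_mul (norm_regInv_diag_le hε _ k) ((norm_sub_le _ _).trans ?_)
          (norm_nonneg _) hε'
      rw [norm_one]
      linarith [norm_reg_proj_diag_le hε (chan z) n]
  have e1 : ∀ z : ChanIdx K N → ℝ,
      ∑ k, ∑ n, starRingEnd ℂ (chan z k n) * (regInv ε (chan z) * chan z) k n =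
        (((K : ℝ) - ε * (regInv ε (chan z)).trace.re : ℝ) : ℂ) := by
    intro z
    have h2 := trace_reg_proj hε (chan z)
    rw [(trace_eq_ofReal_re (posSemidef_regInv hε (chan z))).1] at h2
    push_cast
    rw [← h2, Matrix.mul_assoc, Matrix.trace, Finset.sum_comm]
    simp [Matrix.mul_apply (M := (chan z)ᴴ)]
  have e2 : ∀ z : ChanIdx K N → ℝ, ∑ k, ∑ n, regInv ε (chan z) k k *
        (1 - ((chan z)ᴴ * regInv ε (chan z) * chan z) n n) =
      (((regInv ε (chan z)).trace.re *
        ((N : ℝ) - K + ε * (regInv ε (chan z)).trace.re) : ℝ) : ℂ) := by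
    intro z
    have h2 := trace_reg_proj hε (chan z)
    rw [(trace_eq_ofReal_re (posSemidef_regInv hε (chan z))).1] at h2
    have h3 := (trace_eq_ofReal_re (posSemidef_regInv hε (chan z))).1
    simp only [← Finset.mul_sum, ← Finset.sum_mul]
    have h4 : ∑ k, regInv ε (chan z) k k = (((regInv ε (chan z)).trace.re : ℝ) : ℂ) := by
      rw [← h3]; rfl
    have h5 : ∑ n, (1 - ((chan z)ᴴ * regInv ε (chan z) * chan z) n n) =
        (N : ℂ) - ((chan z)ᴴ * regInv ε (chan z) * chan z).trace := by
      simp [Matrix.trace]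
    rw [h4, h5, h2]
    push_cast
    ring
  simp only [e1, e2] at h1
  rw [integral_complex_ofReal, integral_complex_ofReal] at h1
  exact_mod_cast h1

lemma realRep_reg (ε : ℝ) (H : Matrix (Fin K) (Fin N) ℂ) :
    realRep (H * Hᴴ + (ε : ℂ) • 1) = realRep H * (realRep H)ᵀ + ε • 1 := by
  rw [← realRep_conjTranspose, ← realRep_mul]
  ext (i | i) (j | j) <;> by_cases h : i = j <;> simp [realRep, h]

/-- Adding `ε` increases the Gram matrix, so antitonicity of the inverse applies in the real
representation. This supplies the dominating function for `ε → 0`. -/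
lemma trace_regInv_le_zfTrace {ε : ℝ} (hε : 0 < ε) {H : Matrix (Fin K) (Fin N) ℂ}
    (hH : IsUnit (H * Hᴴ).det) : (regInv ε H).trace.re ≤ (zfTrace H).re := by
  have hdet := isUnit_det_reg hε H
  have hA : (realRep H * (realRep H)ᵀ).PosDef := by
    refine posDef_gram_of_isUnit ?_
    rw [← realRep_conjTranspose, ← realRep_mul, isUnit_det_realRep]; exact hH
  have h := trace_inv_antitone (c := 1) one_pos hA (isUnit_det_realRep.2 hdet) fun y => ?_
  · rw [trace_realRep_gram_inv hH, realRep_inv hdet, trace_realRep] at h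
    change 1 * (2 * (regInv ε H).trace.re) ≤ _ at h
    linarith
  · rw [realRep_reg, Matrix.add_mulVec, dotProduct_add, Matrix.smul_mulVec, Matrix.one_mulVec,
      dotProduct_smul, smul_eq_mul]
    have : 0 ≤ y ⬝ᵥ y := by simpa using dotProduct_star_self_nonneg y
    nlinarith [mul_nonneg hε.le this]

lemma tendsto_trace_regInv {H : Matrix (Fin K) (Fin N) ℂ} (hH : IsUnit (H * Hᴴ).det) :
    Tendsto (fun ε : ℝ => (regInv ε H).trace.re) (𝓝 0) (𝓝 (zfTrace H).re) := by
  have hc : Continuous fun ε : ℝ => (H * Hᴴ + (ε : ℂ) • 1 : Matrix (Fin K) (Fin K) ℂ) := by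
    fun_prop
  have h0 : ContinuousAt (fun ε : ℝ => (regInv ε H).trace.re) 0 := by
    refine Complex.continuous_re.continuousAt.comp ?_
    simp only [regInv, Matrix.inv_def, Ring.inverse_eq_inv']
    simp only [Matrix.trace_smul, smul_eq_mul]
    refine ContinuousAt.mul (ContinuousAt.inv₀ hc.matrix_det.continuousAt ?_)
      hc.matrix_adjugate.matrix_trace.continuousAt
    simpa using hH.ne_zero
  have h1 := h0.tendsto
  simpa [regInv, zfTrace] using h1

lemma zfTrace_re_nonneg (H : Matrix (Fin K) (Fin N) ℂ) :
    zfTrace H = ((zfTrace H).re : ℂ) ∧ 0 ≤ (zfTrace H).re :=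
  trace_eq_ofReal_re (Matrix.posSemidef_self_mul_conjTranspose H).inv

lemma measurable_zfTrace : Measurable fun z : ChanIdx K N → ℝ => zfTrace (chan z) :=
  measurable_matrix_trace (measurable_matrix_inv measurable_gram)

lemma integrable_zfTrace_re (hK : 0 < K) (hKN : K < N) :
    Integrable (fun z : ChanIdx K N → ℝ => (zfTrace (chan z)).re) (chanLaw K N) := by
  have hN : 0 < N := by omega
  have hm : Measurable fun z : ChanIdx K N → ℝ => (zfTrace (chan z)).re :=
    Complex.measurable_re.comp measurable_zfTrace
  rw [← lintegral_ofReal_ne_top_iff_integrable hm.aestronglyMeasurable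
    (ae_of_all _ fun z => (zfTrace_re_nonneg _).2)]
  refine ne_top_of_le_ne_top (b := ENNReal.ofReal (2 * K * chartConst (2 * K) *
    1 ^ ((2 * (K : ℝ) - 1) / 2) * (1 * (∏ _j : Fin N ⊕ Fin N, (1 : ℝ)) ^ (1 / (2 * N : ℝ))) ^
      (-((2 * (K : ℝ) + 1) / 2))) * ∫⁻ z, chanBound (chan (K := K) (N := N) z) ∂(chanLaw K N))
    (ENNReal.mul_ne_top ENNReal.ofReal_ne_top (lintegral_chanBound_lt_top hK hKN).ne) ?_
  rw [← lintegral_const_mul _ measurable_chanBound]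
  refine lintegral_mono_ae ?_
  filter_upwards [ae_chanBound_ne_top hK hKN] with z hz
  refine le_trans (ENNReal.ofReal_le_ofReal ?_) (trace_inv_le_chanBound hK hN (realRep (chan z)) hz
    one_pos one_pos (fun _ => one_pos) (fun x => (sum_one_mul_sq _ x).le)
    (fun x => (one_mul _).ge))
  rw [trace_realRep_gram_inv (isUnit_det_gram hN hz)]
  linarith [(zfTrace_re_nonneg (chan z)).2]

/-- Let `ε → 0` along `1/(j+1)` in `integral_reg_identity`, the integrands being dominated by `K`
and by `N Tr (H Hᴴ)⁻¹`. The limit reads `K = (N - K) E Tr (H Hᴴ)⁻¹`. -/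
lemma integral_zfTrace_re (hK : 0 < K) (hKN : K < N) :
    ∫ z, (zfTrace (chan (K := K) (N := N) z)).re ∂(chanLaw K N) = (K : ℝ) / (N - K) := by
  have hN : 0 < N := by omega
  have hKN' : (K : ℝ) < N := by exact_mod_cast hKN
  have hint := integrable_zfTrace_re hK hKN
  set e : ℕ → ℝ := fun j => 1 / ((j : ℝ) + 1) with he
  have he0 : ∀ j, 0 < e j := fun j => by positivity
  have hlim : Tendsto e atTop (𝓝 0) := tendsto_one_div_add_atTop_nhds_zero_nat
  have hm : ∀ j, Measurable fun z : ChanIdx K N → ℝ => (regInv (e j) (chan z)).trace.re :=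
    fun j => Complex.measurable_re.comp (measurable_trace_regInv _)
  have hae : ∀ᵐ z ∂(chanLaw K N), IsUnit (chan (K := K) (N := N) z * (chan z)ᴴ).det := by
    filter_upwards [ae_chanBound_ne_top hK hKN] with z hz
    exact isUnit_det_gram hN hz
  have t1 : Tendsto (fun j => ∫ z, ((K : ℝ) - e j *
      (regInv (e j) (chan (K := K) (N := N) z)).trace.re) ∂(chanLaw K N)) atTop
      (𝓝 (∫ _z, ((K : ℝ) - 0) ∂(chanLaw K N))) := by
    refine tendsto_integral_of_dominated_convergence (fun _ => (K : ℝ))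
      (fun j => (measurable_const.sub ((hm j).const_mul _)).aestronglyMeasurable)
      (integrable_const _) (fun j => ae_of_all _ fun z => ?_) ?_
    · have h1 := mul_trace_regInv_le (he0 j) (chan z)
      have h2 := mul_nonneg (he0 j).le (trace_eq_ofReal_re (posSemidef_regInv (he0 j) (chan z))).2
      rw [Real.norm_of_nonneg (by linarith)]
      linarith
    · filter_upwards [hae] with z hz
      have := (hlim.mul ((tendsto_trace_regInv hz).comp hlim))
      rw [zero_mul] at this
      exact tendsto_const_nhds.sub this
  have t2 : Tendsto (fun j => ∫ z, (regInv (e j) (chan (K := K) (N := N) z)).trace.re *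
        ((N : ℝ) - K + e j * (regInv (e j) (chan z)).trace.re) ∂(chanLaw K N)) atTop
      (𝓝 (∫ z, (zfTrace (chan z)).re * ((N : ℝ) - K + 0) ∂(chanLaw K N))) := by
    refine tendsto_integral_of_dominated_convergence (fun z => (zfTrace (chan z)).re * (N : ℝ))
      (fun j => ((hm j).mul (measurable_const.add ((hm j).const_mul _))).aestronglyMeasurable)
      (hint.mul_const _) (fun j => ?_) ?_
    · filter_upwards [hae] with z hz
      have h1 := mul_trace_regInv_le (he0 j) (chan z)
      have h0 := (trace_eq_ofReal_re (posSemidef_regInv (he0 j) (chan z))).2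
      have h2 := mul_nonneg (he0 j).le h0
      have h3 : 0 ≤ (N : ℝ) - K + e j * (regInv (e j) (chan z)).trace.re := by linarith
      rw [Real.norm_of_nonneg (mul_nonneg h0 h3)]
      exact mul_le_mul (trace_regInv_le_zfTrace (he0 j) hz) (by linarith) h3
        (zfTrace_re_nonneg _).2
    · filter_upwards [hae] with z hz
      have h1 := (tendsto_trace_regInv hz).comp hlim
      have := hlim.mul h1
      rw [zero_mul] at this
      exact h1.mul (tendsto_const_nhds.add this)
  simp only [integral_reg_identity (he0 _)] at t1
  have h := tendsto_nhds_unique t1 t2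
  rw [integral_mul_const] at h
  simp only [sub_zero, add_zero, integral_const, probReal_univ, one_smul] at h
  rw [eq_div_iff (by linarith), ← h]

end ZFMoment
end WLZF

namespace WLZF
open Matrix
open scoped ENNReal NNReal ComplexOrder

/-! ### The mixed moment -/

section MixedMoment

variable {K N : ℕ}

/-- The orthogonal projection `Hᴴ (H Hᴴ)⁻¹ H` onto the row space. -/
noncomputable def zfProj (H : Matrix (Fin K) (Fin N) ℂ) : Matrix (Fin N) (Fin N) ℂ :=
  Hᴴ * (H * Hᴴ)⁻¹ * H

/-- The matrix `Hᴴ (H Hᴴ)⁻² H`. -/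
noncomputable def zfPow (H : Matrix (Fin K) (Fin N) ℂ) : Matrix (Fin N) (Fin N) ℂ :=
  Hᴴ * (H * Hᴴ)⁻¹ ^ 2 * H

lemma conjTranspose_gram_inv (H : Matrix (Fin K) (Fin N) ℂ) :
    ((H * Hᴴ)⁻¹)ᴴ = (H * Hᴴ)⁻¹ := by
  rw [Matrix.conjTranspose_nonsing_inv, Matrix.conjTranspose_mul, Matrix.conjTranspose_conjTranspose]

lemma zfProj_conjTranspose (H : Matrix (Fin K) (Fin N) ℂ) : (zfProj H)ᴴ = zfProj H := by
  rw [zfProj, Matrix.conjTranspose_mul, Matrix.conjTranspose_mul, conjTranspose_gram_inv,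
    Matrix.conjTranspose_conjTranspose, Matrix.mul_assoc]

lemma zfPow_eq (H : Matrix (Fin K) (Fin N) ℂ) :
    zfPow H = ((H * Hᴴ)⁻¹ * H)ᴴ * ((H * Hᴴ)⁻¹ * H) := by
  rw [zfPow, Matrix.conjTranspose_mul, conjTranspose_gram_inv, pow_two]
  simp only [Matrix.mul_assoc]

/-- In the singular case the matrix inverse is zero by convention and both sides vanish. The
algebraic identities for `zfProj` and `zfPow` thus need no rank assumption and hold for every
channel. -/
lemma gram_inv_mul_gram_mul_inv (H : Matrix (Fin K) (Fin N) ℂ) :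
    (H * Hᴴ)⁻¹ * (H * Hᴴ) * (H * Hᴴ)⁻¹ = (H * Hᴴ)⁻¹ := by
  by_cases h : IsUnit (H * Hᴴ).det
  · rw [Matrix.nonsing_inv_mul _ h, Matrix.one_mul]
  · rw [Matrix.nonsing_inv_apply_not_isUnit _ h]; simp

lemma zfProj_sq (H : Matrix (Fin K) (Fin N) ℂ) : zfProj H * zfProj H = zfProj H := by
  have : zfProj H * zfProj H = Hᴴ * ((H * Hᴴ)⁻¹ * (H * Hᴴ) * (H * Hᴴ)⁻¹) * H := by
    simp only [zfProj, Matrix.mul_assoc]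
  rw [this, gram_inv_mul_gram_mul_inv, zfProj]

lemma zfPow_mul_zfProj (H : Matrix (Fin K) (Fin N) ℂ) : zfPow H * zfProj H = zfPow H := by
  have : zfPow H * zfProj H =
      Hᴴ * ((H * Hᴴ)⁻¹ * ((H * Hᴴ)⁻¹ * (H * Hᴴ) * (H * Hᴴ)⁻¹)) * H := by
    simp only [zfPow, zfProj, pow_two, Matrix.mul_assoc]
  rw [this, gram_inv_mul_gram_mul_inv, zfPow, pow_two]

lemma trace_zfPow (H : Matrix (Fin K) (Fin N) ℂ) : (zfPow H).trace = zfTrace H := by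
  have : zfPow H = Hᴴ * ((H * Hᴴ)⁻¹ * ((H * Hᴴ)⁻¹ * H)) := by
    simp only [zfPow, pow_two, Matrix.mul_assoc]
  rw [this, Matrix.trace_mul_comm, zfTrace, ← gram_inv_mul_gram_mul_inv H, Matrix.mul_assoc,
    Matrix.trace_mul_comm]
  rw [gram_inv_mul_gram_mul_inv]
  congr 1
  conv_rhs => rw [← gram_inv_mul_gram_mul_inv H]
  simp only [Matrix.mul_assoc]

lemma trace_zfProj {H : Matrix (Fin K) (Fin N) ℂ} (hH : IsUnit (H * Hᴴ).det) :
    (zfProj H).trace = K := by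
  rw [zfProj, Matrix.mul_assoc, Matrix.trace_mul_comm, Matrix.mul_assoc,
    Matrix.nonsing_inv_mul _ hH]
  simp

/-- Entries of a Gram matrix are dominated by the diagonal. -/
lemma norm_conjTranspose_mul_self_le {m n : Type*} [Fintype m] (X : Matrix m n ℂ) (i j : n) :
    ‖(Xᴴ * X) i j‖ ≤ (((Xᴴ * X) i i).re + ((Xᴴ * X) j j).re) / 2 := by
  have h : ∀ i, ((Xᴴ * X) i i).re = ∑ k, ‖X k i‖ ^ 2 := by
    intro i
    rw [Matrix.mul_apply, Complex.re_sum]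
    refine Finset.sum_congr rfl fun k _ => ?_
    simp [Complex.sq_norm, Complex.normSq_apply]
  rw [h, h, Matrix.mul_apply, ← Finset.sum_add_distrib, Finset.sum_div]
  refine (norm_sum_le _ _).trans (Finset.sum_le_sum fun k _ => ?_)
  rw [norm_mul, Matrix.conjTranspose_apply, norm_star]
  nlinarith [sq_nonneg (‖X k i‖ - ‖X k j‖)]

lemma norm_zfPow_le (H : Matrix (Fin K) (Fin N) ℂ) (i j : Fin N) :
    ‖zfPow H i j‖ ≤ (zfTrace H).re := by
  have hps : (zfPow H).PosSemidef := by
    rw [zfPow_eq]; exact Matrix.posSemidef_conjTranspose_mul_self _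
  have hd : ∀ i, (zfPow H i i).re ≤ (zfTrace H).re := fun i => by
    rw [← trace_zfPow]
    exact (Complex.re_le_norm _).trans (norm_diag_le_trace hps i)
  have h := norm_conjTranspose_mul_self_le ((H * Hᴴ)⁻¹ * H) i j
  rw [← zfPow_eq] at h
  linarith [hd i, hd j]

lemma norm_zfProj_le (H : Matrix (Fin K) (Fin N) ℂ) (i j : Fin N) : ‖zfProj H i j‖ ≤ 1 := by
  have e : (zfProj H)ᴴ * zfProj H = zfProj H := by rw [zfProj_conjTranspose, zfProj_sq]
  have hd : ∀ i, (zfProj H i i).re ≤ 1 := fun i => by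
    have h := norm_sq_le_trace (zfProj H) i i
    rw [e] at h
    have h2 := Complex.re_le_norm (zfProj H i i)
    nlinarith [norm_nonneg (zfProj H i i)]
  have h := norm_conjTranspose_mul_self_le (zfProj H) i j
  rw [e] at h
  linarith [hd i, hd j]

lemma gram_mul_unitary (H : Matrix (Fin K) (Fin N) ℂ) {U : Matrix (Fin N) (Fin N) ℂ}
    (hU : Uᴴ * U = 1) : H * U * (H * U)ᴴ = H * Hᴴ := by
  have hU' : U * Uᴴ = 1 := mul_eq_one_comm.1 hU
  rw [Matrix.conjTranspose_mul, Matrix.mul_assoc, ← Matrix.mul_assoc U, hU', Matrix.one_mul]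

lemma zfProj_mul_unitary (H : Matrix (Fin K) (Fin N) ℂ) {U : Matrix (Fin N) (Fin N) ℂ}
    (hU : Uᴴ * U = 1) : zfProj (H * U) = Uᴴ * zfProj H * U := by
  rw [zfProj, gram_mul_unitary H hU, Matrix.conjTranspose_mul, zfProj]
  simp only [Matrix.mul_assoc]

lemma zfPow_mul_unitary (H : Matrix (Fin K) (Fin N) ℂ) {U : Matrix (Fin N) (Fin N) ℂ}
    (hU : Uᴴ * U = 1) : zfPow (H * U) = Uᴴ * zfPow H * U := by
  rw [zfPow, gram_mul_unitary H hU, Matrix.conjTranspose_mul, zfPow]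
  simp only [Matrix.mul_assoc]

lemma measurable_zfProj (m n : Fin N) :
    Measurable fun z : ChanIdx K N → ℝ => zfProj (chan z) m n :=
  measurable_matrix_mul (measurable_matrix_mul (fun n k => measurable_chan_conjTranspose k n)
    (measurable_matrix_inv measurable_gram)) measurable_chan m n

lemma measurable_zfPow (m n : Fin N) :
    Measurable fun z : ChanIdx K N → ℝ => zfPow (chan z) m n := by
  simp only [zfPow, pow_two]
  exact measurable_matrix_mul (measurable_matrix_mul (fun n k => measurable_chan_conjTranspose k n)
    (measurable_matrix_mul (measurable_matrix_inv measurable_gram)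
      (measurable_matrix_inv measurable_gram))) measurable_chan m n

lemma integrable_zfPow_mul_zfProj (hK : 0 < K) (hKN : K < N) (a b c d : Fin N) :
    Integrable (fun z : ChanIdx K N → ℝ => zfPow (chan z) a b * zfProj (chan z) c d)
      (chanLaw K N) := by
  refine (integrable_zfTrace_re hK hKN).mono
    ((measurable_zfPow a b).mul (measurable_zfProj c d)).aestronglyMeasurable
    (ae_of_all _ fun z => ?_)
  rw [norm_mul, Real.norm_of_nonneg (zfTrace_re_nonneg _).2]
  calc ‖zfPow (chan z) a b‖ * ‖zfProj (chan z) c d‖ ≤ (zfTrace (chan z)).re * 1 :=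
        mul_le_mul (norm_zfPow_le _ a b) (norm_zfProj_le _ c d) (norm_nonneg _)
          (zfTrace_re_nonneg _).2
    _ = _ := mul_one _

lemma integrable_zfPow (hK : 0 < K) (hKN : K < N) (a b : Fin N) :
    Integrable (fun z : ChanIdx K N → ℝ => zfPow (chan z) a b) (chanLaw K N) := by
  refine (integrable_zfTrace_re hK hKN).mono (measurable_zfPow a b).aestronglyMeasurable
    (ae_of_all _ fun z => ?_)
  rw [Real.norm_of_nonneg (zfTrace_re_nonneg _).2]
  exact norm_zfPow_le _ a b

/-- `E[q_{ab} p_{cd}]` for `q = Hᴴ (H Hᴴ)⁻² H` and `p = Hᴴ (H Hᴴ)⁻¹ H`. -/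
noncomputable def mixedMoment (K N : ℕ) (a b c d : Fin N) : ℂ :=
  ∫ z, zfPow (chan (K := K) z) a b * zfProj (chan z) c d ∂(chanLaw K N)

/-- Invariance under the diagonal unitary `U = diag v`, which multiplies entry `(a, b)` of `Uᴴ q U`
by `v̄ a * v b`. -/
lemma mixedMoment_phase (v : Fin N → ℂ) (hv : ∀ n, star (v n) * v n = 1) (a b c d : Fin N) :
    mixedMoment K N a b c d =
      star (v a) * v b * star (v c) * v d * mixedMoment K N a b c d := by
  have hU : (diagonal v)ᴴ * diagonal v = 1 := by
    rw [Matrix.diagonal_conjTranspose, Matrix.diagonal_mul_diagonal, ← Matrix.diagonal_one]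
    congr 1
    ext n
    simpa using hv n
  have h := integral_mul_unitary (K := K) hU
    (F := fun H => zfPow H a b * zfProj H c d) ((measurable_zfPow a b).mul (measurable_zfProj c d))
  simp only [zfPow_mul_unitary _ hU, zfProj_mul_unitary _ hU] at h
  rw [mixedMoment, ← integral_const_mul, ← h]
  refine integral_congr_ae (ae_of_all _ fun z => ?_)
  simp only [Matrix.diagonal_conjTranspose, Matrix.mul_diagonal, Matrix.diagonal_mul,
    Pi.star_apply]
  ring

/-- Moments with unbalanced indices vanish. -/
lemma mixedMoment_eq_zero (n : Fin N) (a b c d : Fin N)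
    (h : ((if a = n then -Complex.I else 1) * (if b = n then Complex.I else 1) *
      (if c = n then -Complex.I else 1) * (if d = n then Complex.I else 1) : ℂ) ≠ 1) :
    mixedMoment K N a b c d = 0 := by
  -- The phase is `I` rather than `-1`: a sign would not detect the pattern `(m, n, m, n)`, where
  -- `m` occurs twice conjugated and the factor is `(-I)² = -1`.
  have h1 := mixedMoment_phase (K := K) (fun k => if k = n then Complex.I else 1)
    (fun k => by by_cases hk : k = n <;> simp [hk]) a b c d
  have e : ∀ k : Fin N, star (if k = n then Complex.I else 1 : ℂ) =
      if k = n then -Complex.I else 1 := fun k => by by_cases hk : k = n <;> simp [hk]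
  simp only [e] at h1
  have h2 : (1 - (if a = n then -Complex.I else 1) * (if b = n then Complex.I else 1) *
      (if c = n then -Complex.I else 1) * (if d = n then Complex.I else 1) : ℂ) *
      mixedMoment K N a b c d = 0 := by linear_combination h1
  rcases mul_eq_zero.1 h2 with h3 | h3
  · exact absurd (sub_eq_zero.1 h3).symm h
  · exact h3

lemma I_ne_one : Complex.I ≠ 1 := fun h => by simpa using congrArg Complex.re h

lemma neg_I_ne_one : -Complex.I ≠ 1 := fun h => by simpa using congrArg Complex.re h

/-- Reduces the mean of `mixedTrace` to its diagonal, and removes the terms coupling two different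
antennas from the expected expansion of the trace. -/
lemma mixedMoment_same_eq_zero {m n : Fin N} (h : m ≠ n) : mixedMoment K N m n m n = 0 := by
  refine mixedMoment_eq_zero m _ _ _ _ ?_
  simp [h.symm]
  norm_num

/-- The reflection `1 - w wᵀ`, for `w` with entries `1/5` at `n` and `7/5` at `m`. -/
noncomputable def reflection (n m : Fin N) : Matrix (Fin N) (Fin N) ℂ :=
  1 - Matrix.vecMulVec (Pi.single n (1 / 5 : ℂ) + Pi.single m (7 / 5 : ℂ))
    (Pi.single n (1 / 5 : ℂ) + Pi.single m (7 / 5 : ℂ))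

/-- Since `|w|² = 1/25 + 49/25 = 2`, this is a Householder reflection. Its entries in the `(n, m)`
plane are `± 24/25` and `-7/25`, rational because `7² + 24² = 25²`. -/
lemma reflection_conjTranspose_mul {n m : Fin N} (h : n ≠ m) :
    (reflection n m)ᴴ * reflection n m = 1 := by
  set w : Fin N → ℂ := Pi.single n (1 / 5 : ℂ) + Pi.single m (7 / 5 : ℂ) with hw
  have hs : star w = w := by
    ext k
    simp only [hw, Pi.star_apply, Pi.add_apply, Pi.single_apply]
    split_ifs <;> simp
  have hww : w ⬝ᵥ w = 2 := by
    simp [hw, dotProduct_add, h, h.symm]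
    norm_num
  have e : (reflection n m)ᴴ = reflection n m := by
    change (1 - vecMulVec w w)ᴴ = 1 - vecMulVec w w
    rw [Matrix.conjTranspose_sub, Matrix.conjTranspose_one, Matrix.conjTranspose_vecMulVec, hs]
  rw [e]
  change (1 - vecMulVec w w) * (1 - vecMulVec w w) = 1
  rw [Matrix.mul_sub, Matrix.sub_mul, Matrix.sub_mul, Matrix.vecMulVec_mul_vecMulVec, hww]
  ext i j
  simp [Matrix.vecMulVec_apply]
  ring

lemma reflection_diag_apply {n m : Fin N} (h : n ≠ m) (X : Matrix (Fin N) (Fin N) ℂ) :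
    ((reflection n m)ᴴ * X * reflection n m) n n =
      (24 / 25) ^ 2 * X n n + (7 / 25) ^ 2 * X m m - (24 / 25) * (7 / 25) * (X n m + X m n) := by
  have c1 : reflection n m n n = 24 / 25 := by
    simp [reflection, Matrix.vecMulVec_apply, h]; norm_num
  have c2 : reflection n m m n = -(7 / 25) := by
    simp [reflection, Matrix.vecMulVec_apply, h, h.symm]; norm_num
  have c0 : ∀ a, a ≠ n ∧ a ≠ m → reflection n m a n = 0 := by
    rintro a ⟨h1, h2⟩
    simp [reflection, Matrix.vecMulVec_apply, h1, h2]
  have hs : ∀ f : Fin N → ℂ, (∀ a, a ≠ n ∧ a ≠ m → f a = 0) → ∑ a, f a = f n + f m :=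
    fun f hf => Finset.sum_eq_add n m h (fun c _ hc => hf c hc) (by simp) (by simp)
  rw [Matrix.mul_apply, hs _ fun a ha => by rw [c0 a ha, mul_zero], Matrix.mul_apply,
    Matrix.mul_apply, hs _ fun a ha => by simp [c0 a ha], hs _ fun a ha => by simp [c0 a ha]]
  simp only [Matrix.conjTranspose_apply, c1, c2]
  simp
  ring

/-- Invariance of `E[q_nn p_nn]` under the reflection. The product expands into 16 moments on the
indices `n`, `m`; the phase argument kills the eight with three equal indices as well as `(n, m, n,
m)` and `(m, n, m, n)`, leaving six. -/
lemma mixedMoment_reflection (hK : 0 < K) (hKN : K < N) {n m : Fin N} (h : n ≠ m) :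
    mixedMoment K N n n n n = (24 / 25) ^ 4 * mixedMoment K N n n n n +
      (7 / 25) ^ 4 * mixedMoment K N m m m m + (24 / 25) ^ 2 * (7 / 25) ^ 2 *
      (mixedMoment K N n n m m + mixedMoment K N m m n n + mixedMoment K N n m m n +
        mixedMoment K N m n n m) := by
  have hU := reflection_conjTranspose_mul h
  have h1 := integral_mul_unitary (K := K) hU
    (F := fun H => zfPow H n n * zfProj H n n) ((measurable_zfPow n n).mul (measurable_zfProj n n))
  simp only [zfPow_mul_unitary _ hU, zfProj_mul_unitary _ hU, reflection_diag_apply h] at h1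
  have hi := integrable_zfPow_mul_zfProj hK hKN
  -- The nonzero entries of column `n` of the reflection and the antennas they belong to, so that
  -- the 16 terms become one sum over four indices in `Fin 2`.
  set u : Fin 2 → ℂ := ![24 / 25, -(7 / 25)] with hu
  set s : Fin 2 → Fin N := ![n, m] with hs
  have h2 : mixedMoment K N n n n n = ∑ a, ∑ b, ∑ c, ∑ d,
      u a * u b * u c * u d * mixedMoment K N (s a) (s b) (s c) (s d) := by
    have e : ∀ z : ChanIdx K N → ℝ, ∑ a, ∑ b, ∑ c, ∑ d, u a * u b * u c * u d *
        (zfPow (chan z) (s a) (s b) * zfProj (chan z) (s c) (s d)) = ((24 / 25) ^ 2 *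
          zfPow (chan z) n n + (7 / 25) ^ 2 * zfPow (chan z) m m -
          24 / 25 * (7 / 25) * (zfPow (chan z) n m + zfPow (chan z) m n)) *
        ((24 / 25) ^ 2 * zfProj (chan z) n n + (7 / 25) ^ 2 * zfProj (chan z) m m -
          24 / 25 * (7 / 25) * (zfProj (chan z) n m + zfProj (chan z) m n)) := by
      intro z
      simp only [Fin.sum_univ_two, hu, hs, Matrix.cons_val_zero, Matrix.cons_val_one]
      ring
    rw [mixedMoment, ← h1]
    simp only [← e]
    have hi' : ∀ a b c d : Fin 2, Integrable (fun z : ChanIdx K N → ℝ => u a * u b * u c * u d *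
        (zfPow (chan z) (s a) (s b) * zfProj (chan z) (s c) (s d))) (chanLaw K N) :=
      fun a b c d => (hi _ _ _ _).const_mul _
    rw [integral_finsetSum _ fun a _ => integrable_finsetSum _ fun b _ =>
      integrable_finsetSum _ fun c _ => integrable_finsetSum _ fun d _ => hi' a b c d]
    refine Finset.sum_congr rfl fun a _ => ?_
    rw [integral_finsetSum _ fun b _ =>
      integrable_finsetSum _ fun c _ => integrable_finsetSum _ fun d _ => hi' a b c d]
    refine Finset.sum_congr rfl fun b _ => ?_
    rw [integral_finsetSum _ fun c _ => integrable_finsetSum _ fun d _ => hi' a b c d]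
    refine Finset.sum_congr rfl fun c _ => ?_
    rw [integral_finsetSum _ fun d _ => hi' a b c d]
    refine Finset.sum_congr rfl fun d _ => ?_
    rw [integral_const_mul]
    rfl
  have h' := h.symm
  simp only [Fin.sum_univ_two, hu, hs, Matrix.cons_val_zero, Matrix.cons_val_one] at h2
  rw [mixedMoment_same_eq_zero h, mixedMoment_same_eq_zero h',
    mixedMoment_eq_zero (K := K) m n n n m (by simp [h, I_ne_one]),
    mixedMoment_eq_zero (K := K) m n n m n (by simp [h, neg_I_ne_one]),
    mixedMoment_eq_zero (K := K) m n m n n (by simp [h, I_ne_one]),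
    mixedMoment_eq_zero (K := K) m m n n n (by simp [h, neg_I_ne_one]),
    mixedMoment_eq_zero (K := K) n m m m n (by simp [h', I_ne_one]),
    mixedMoment_eq_zero (K := K) n m m n m (by simp [h', neg_I_ne_one]),
    mixedMoment_eq_zero (K := K) n m n m m (by simp [h', I_ne_one]),
    mixedMoment_eq_zero (K := K) n n m m m (by simp [h', neg_I_ne_one])] at h2
  linear_combination h2

lemma mixedMoment_diag (hK : 0 < K) (hKN : K < N) (n m : Fin N) :
    mixedMoment K N m m m m = mixedMoment K N n n n n := by
  by_cases h : n = m
  · rw [h]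
  have h1 := mixedMoment_reflection hK hKN h
  have h2 := mixedMoment_reflection hK hKN (Ne.symm h)
  -- The mixed terms are symmetric in `n`, `m` and cancel in the difference; what remains has
  -- coefficient `1 - (24/25)⁴ + (7/25)⁴ = 98/625`.
  linear_combination (625 / 98 : ℂ) * (h2 - h1)

/-- With `u = 24/25` and `v = 7/25`, the relation `u² + v² = 1` gives `1 - u⁴ - v⁴ = 2 u² v²`,
whence the factor two. For `n = m` the left side is four times the moment; the extra term makes the
identity valid for all pairs, ready to be summed. -/
lemma mixedMoment_sum_pair (hK : 0 < K) (hKN : K < N) (n m : Fin N) :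
    mixedMoment K N n n m m + mixedMoment K N m m n n + mixedMoment K N n m m n +
        mixedMoment K N m n n m =
      2 * mixedMoment K N n n n n + if n = m then 2 * mixedMoment K N n n n n else 0 := by
  by_cases h : n = m
  · subst h
    rw [if_pos rfl]; ring
  have h1 := mixedMoment_reflection hK hKN h
  rw [mixedMoment_diag hK hKN n m] at h1
  rw [if_neg h]
  linear_combination (-(390625 / 28224) : ℂ) * h1

lemma integral_zfTrace (hK : 0 < K) (hKN : K < N) :
    ∫ z, zfTrace (chan (K := K) (N := N) z) ∂(chanLaw K N) = (K : ℂ) / (N - K) := by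
  have h : ∀ z : ChanIdx K N → ℝ, zfTrace (chan z) = (((zfTrace (chan z)).re : ℝ) : ℂ) :=
    fun z => (zfTrace_re_nonneg _).1
  rw [integral_congr_ae (ae_of_all _ h), integral_complex_ofReal, integral_zfTrace_re hK hKN]
  push_cast
  rfl

/-- Sum `mixedMoment_sum_pair` over all `n`, `m`. Since `Tr p = K` and `q p = q`, the left side is
`2 (K + 1) E Tr q`, and the right side is `2 (N + 1)` times the sum sought. -/
lemma sum_mixedMoment_diag (hK : 0 < K) (hKN : K < N) :
    ∑ n, mixedMoment K N n n n n = ((K : ℂ) ^ 2 + K) / (((N : ℂ) - K) * ((N : ℂ) + 1)) := by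
  have hN : 0 < N := by omega
  have hi := integrable_zfPow_mul_zfProj hK hKN
  have hae : ∀ᵐ z ∂(chanLaw K N), IsUnit (chan (K := K) (N := N) z * (chan z)ᴴ).det := by
    filter_upwards [ae_chanBound_ne_top hK hKN] with z hz
    exact isUnit_det_gram hN hz
  have hA : ∑ n, ∑ m, mixedMoment K N n n m m = K * (K / (N - K)) := by
    simp only [mixedMoment]
    rw [← integral_zfTrace hK hKN, ← integral_const_mul]
    simp_rw [← integral_finsetSum Finset.univ fun m _ => hi _ _ m m]
    rw [← integral_finsetSum _ fun n _ => integrable_finsetSum _ fun m _ => hi n n m m]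
    refine integral_congr_ae ?_
    filter_upwards [hae] with z hz
    simp only [← Finset.mul_sum, ← Finset.sum_mul]
    rw [← trace_zfPow, ← trace_zfProj hz, mul_comm]
    rfl
  have hB : ∑ n, ∑ m, mixedMoment K N n m m n = K / (N - K) := by
    simp only [mixedMoment]
    rw [← integral_zfTrace hK hKN]
    simp_rw [← integral_finsetSum Finset.univ fun m _ => hi _ m m _]
    rw [← integral_finsetSum _ fun n _ => integrable_finsetSum _ fun m _ => hi n m m n]
    refine integral_congr_ae (ae_of_all _ fun z => ?_)
    simp only [← Matrix.mul_apply, zfPow_mul_zfProj]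
    rw [← trace_zfPow]
    rfl
  have hS := Finset.sum_congr rfl fun n (_ : n ∈ (Finset.univ : Finset (Fin N))) =>
    Finset.sum_congr rfl fun m (_ : m ∈ (Finset.univ : Finset (Fin N))) =>
      mixedMoment_sum_pair hK hKN n m
  simp only [Finset.sum_add_distrib, Finset.sum_ite_eq, Finset.mem_univ, if_true,
    Finset.sum_const, Finset.card_univ, Fintype.card_fin, nsmul_eq_mul, ← Finset.mul_sum] at hS
  rw [Finset.sum_comm (f := fun n m => mixedMoment K N m m n n),
    Finset.sum_comm (f := fun n m => mixedMoment K N m n n m), hA, hB] at hS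
  have h1 : (N : ℂ) - K ≠ 0 := by
    rw [sub_ne_zero]; exact_mod_cast hKN.ne'
  have h2 : (N : ℂ) + 1 ≠ 0 := by exact_mod_cast N.succ_ne_zero
  rw [eq_div_iff (mul_ne_zero h1 h2)]
  field_simp at hS
  linear_combination (-(1 / 2) : ℂ) * hS

lemma mixedTrace_eq (H : Matrix (Fin K) (Fin N) ℂ) :
    mixedTrace H = ∑ n, ∑ m, zfPow H n m * zfProj H n m := by
  change (zfPow H * (zfProj H).map (starRingEnd ℂ)).trace = _
  rw [Matrix.trace]
  refine Finset.sum_congr rfl fun n _ => ?_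
  rw [Matrix.diag_apply, Matrix.mul_apply]
  refine Finset.sum_congr rfl fun m _ => ?_
  conv_rhs => rw [← zfProj_conjTranspose]
  rfl

lemma integrable_mixedTrace (hK : 0 < K) (hKN : K < N) :
    Integrable (fun z : ChanIdx K N → ℝ => mixedTrace (chan z)) (chanLaw K N) := by
  simp only [mixedTrace_eq]
  exact integrable_finsetSum _ fun n _ => integrable_finsetSum _ fun m _ =>
    integrable_zfPow_mul_zfProj hK hKN n m n m

lemma integral_mixedTrace (hK : 0 < K) (hKN : K < N) :
    ∫ z, mixedTrace (chan (K := K) (N := N) z) ∂(chanLaw K N) =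
      ((K : ℂ) ^ 2 + K) / (((N : ℂ) - K) * ((N : ℂ) + 1)) := by
  have hi := integrable_zfPow_mul_zfProj hK hKN
  simp only [mixedTrace_eq]
  rw [← sum_mixedMoment_diag hK hKN,
    integral_finsetSum _ fun n _ => integrable_finsetSum _ fun m _ => hi n m n m]
  refine Finset.sum_congr rfl fun n _ => ?_
  rw [integral_finsetSum _ fun m _ => hi n m n m, Finset.sum_eq_single n]
  · rfl
  · exact fun m _ hm => mixedMoment_same_eq_zero (Ne.symm hm)
  · simp

end MixedMoment
end WLZF

namespace WLZF
open Matrix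
open scoped ENNReal NNReal ComplexOrder

/-! ### Sum rates, multiplexing gains and power offsets -/

section Rates

lemma sinr_smul_one {ι 𝕜 : Type*} [Fintype ι] [DecidableEq ι] [RCLike 𝕜] (c : 𝕜) (p ν : ℝ)
    (i : ι) : sinr (c • (1 : Matrix ι ι 𝕜)) p ν i = p * ‖c‖ ^ 2 / ν := by
  have h : ∑ j ∈ Finset.univ.erase i, p * ‖(c • (1 : Matrix ι ι 𝕜)) i j‖ ^ 2 = 0 := by
    refine Finset.sum_eq_zero fun j hj => ?_
    simp [(Finset.ne_of_mem_erase hj).symm]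
  rw [sinr, h]
  simp

/-- A sum rate `K log₂ (1 + a P)` has multiplexing gain `K` and power offset `- log₂ a`. -/
lemma gain_and_offset_of_eventuallyEq {C : ℝ → ℝ} {k a : ℝ} (hk : 0 < k) (ha : 0 < a)
    (hC : ∀ PT, 0 < PT → C PT = k * Real.logb 2 (1 + a * PT)) :
    HasMultiplexingGain C k ∧ HasPowerOffset C k (-Real.logb 2 a) := by
  have hlim : Tendsto (fun PT : ℝ => Real.logb 2 (a + PT⁻¹)) atTop (𝓝 (Real.logb 2 a)) := by
    have h1 : Tendsto (fun PT : ℝ => a + PT⁻¹) atTop (𝓝 a) := by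
      simpa using tendsto_inv_atTop_zero.const_add a
    exact ((Real.continuousAt_logb ha.ne').tendsto).comp h1
  have hlog : Tendsto (Real.logb 2) atTop atTop := Real.tendsto_logb_atTop one_lt_two
  have e : ∀ PT : ℝ, 0 < PT →
      C PT = k * (Real.logb 2 PT + Real.logb 2 (a + PT⁻¹)) := by
    intro PT hPT
    have h2 : 0 < PT⁻¹ := inv_pos.2 hPT
    rw [hC PT hPT, ← Real.logb_mul hPT.ne' (by positivity)]
    congr 2
    field_simp
    ring
  constructor
  · have h3 : Tendsto (fun PT : ℝ => k * (1 + Real.logb 2 (a + PT⁻¹) / Real.logb 2 PT)) atTop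
        (𝓝 (k * (1 + 0))) := ((hlim.div_atTop hlog).const_add 1).const_mul k
    rw [add_zero, mul_one] at h3
    refine h3.congr' ?_
    filter_upwards [eventually_gt_atTop 1] with PT hPT
    have h4 : 0 < Real.logb 2 PT := Real.logb_pos one_lt_two hPT
    rw [e PT (by linarith)]
    field_simp
  · refine hlim.neg.congr' ?_
    filter_upwards [eventually_gt_atTop 0] with PT hPT
    rw [e PT hPT]
    field_simp
    ring

variable {Ω : Type u} [MeasurableSpace Ω] {P : Measure Ω} {K N : ℕ}
  {H : Ω → Matrix (Fin K) (Fin N) ℂ}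

lemma IsRayleigh.isProbabilityMeasure (hH : IsRayleigh P H) : IsProbabilityMeasure P :=
  hH.indep.isProbabilityMeasure

lemma IsRayleigh.integral_comp {E : Type*} [NormedAddCommGroup E] [NormedSpace ℝ E]
    (hH : IsRayleigh P H) {F : Matrix (Fin K) (Fin N) ℂ → E}
    (hF : AEStronglyMeasurable (fun z => F (chan z)) (chanLaw K N)) :
    ∫ ω, F (H ω) ∂P = ∫ z, F (chan z) ∂(chanLaw K N) := by
  have h := hH.hasLaw.integral_comp hF
  simpa [Function.comp_def] using h

lemma IsRayleigh.integrable_comp {E : Type*} [NormedAddCommGroup E]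
    (hH : IsRayleigh P H) {F : Matrix (Fin K) (Fin N) ℂ → E}
    (hF : Integrable (fun z => F (chan z)) (chanLaw K N)) : Integrable (fun ω => F (H ω)) P := by
  rw [← hH.hasLaw.map_eq] at hF
  have h := hF.comp_aemeasurable hH.hasLaw.aemeasurable
  simpa [Function.comp_def] using h

lemma IsRayleigh.lintegral_comp (hH : IsRayleigh P H) {F : Matrix (Fin K) (Fin N) ℂ → ℝ≥0∞}
    (hF : Measurable (fun z => F (chan z))) :
    ∫⁻ ω, F (H ω) ∂P = ∫⁻ z, F (chan z) ∂(chanLaw K N) := by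
  have h := hH.hasLaw.lintegral_comp hF.aemeasurable
  simpa [Function.comp_def] using h

lemma IsRayleigh.ae (hH : IsRayleigh P H) {p : Matrix (Fin K) (Fin N) ℂ → Prop}
    (hp : ∀ᵐ z ∂(chanLaw K N), p (chan z)) : ∀ᵐ ω ∂P, p (H ω) := by
  rw [← hH.hasLaw.map_eq] at hp
  have h := ae_of_ae_map hH.hasLaw.aemeasurable hp
  simpa using h

lemma IsRayleigh.ae_chanBound_ne_top (hH : IsRayleigh P H) (hK : 0 < K) (hKN : K < N) :
    ∀ᵐ ω ∂P, chanBound (H ω) ≠ ∞ :=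
  hH.ae (p := fun X => chanBound X ≠ ∞) (WLZF.ae_chanBound_ne_top hK hKN)

lemma IsRayleigh.ae_isUnit_det (hH : IsRayleigh P H) (hK : 0 < K) (hKN : K < N) :
    ∀ᵐ ω ∂P, IsUnit (H ω * (H ω)ᴴ).det := by
  filter_upwards [hH.ae_chanBound_ne_top hK hKN] with ω hω
  exact isUnit_det_gram (by omega) hω

lemma integrable_zfTrace (hK : 0 < K) (hKN : K < N) :
    Integrable (fun z : ChanIdx K N → ℝ => zfTrace (chan z)) (chanLaw K N) := by
  have h : (fun z : ChanIdx K N → ℝ => zfTrace (chan z)) =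
    fun z => (((zfTrace (chan z)).re : ℝ) : ℂ) := by
      ext z; exact (zfTrace_re_nonneg _).1
  rw [h]
  exact (integrable_zfTrace_re hK hKN).ofReal

/-- The channel times the precoder is `√λ` times the identity, so there is no interference and the
rate has exactly the form `K log₂ (1 + a P)`. For WL-ZF the `2 K` real streams with prefactor `1/2`
give the same form. -/
lemma IsRayleigh.zfRate (hH : IsRayleigh P H) (hK : 0 < K) (hKN : K < N) {σn : ℝ} (hσ : 0 < σn) :
    ∀ᵐ ω ∂P, HasMultiplexingGain (zfRate P H σn ω) K ∧ HasPowerOffset (zfRate P H σn ω) K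
      (-Real.logb 2 (1 / ((K : ℝ) / (N - K)) / σn ^ 2)) := by
  have hKN' : (0 : ℝ) < N - K := by rw [sub_pos]; exact_mod_cast hKN
  have hK' : (0 : ℝ) < K := by exact_mod_cast hK
  have ht : (∫ ω, zfTrace (H ω) ∂P).re = (K : ℝ) / (N - K) := by
    rw [hH.integral_comp (F := zfTrace) measurable_zfTrace.aestronglyMeasurable,
      integral_zfTrace hK hKN, show (K : ℂ) / (N - K) = (((K : ℝ) / (N - K) : ℝ) : ℂ) by
        push_cast; rfl, Complex.ofReal_re]
  filter_upwards [hH.ae_isUnit_det hK hKN] with ω hω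
  refine gain_and_offset_of_eventuallyEq hK' (by positivity) fun PT hPT => ?_
  have e : H ω * zfPrecoder P H PT ω = (Real.sqrt (zfLambda P H PT) : ℂ) • 1 := by
    rw [zfPrecoder, Matrix.mul_smul, ← Matrix.mul_assoc, Matrix.mul_nonsing_inv _ hω]
  have hl : 0 ≤ zfLambda P H PT := by rw [zfLambda, ht]; positivity
  simp only [WLZF.zfRate, e, sinr_smul_one, Finset.sum_const, Finset.card_univ, Fintype.card_fin,
    nsmul_eq_mul, Complex.norm_real, Real.norm_eq_abs, sq_abs, Real.sq_sqrt hl]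
  rw [zfLambda, ht]
  congr 3
  field_simp

variable {a₁ a₂ : Ω → Fin N → ℂ}

lemma wlTrace_pos (hK : 0 < K) {X : Matrix (Fin K) (Fin N) ℂ} {a₁ a₂ : Fin N → ℂ}
    (h : IsUnit (wlGram X a₁ a₂).det) : 0 < wlTrace X a₁ a₂ := by
  have : Nonempty (Fin K ⊕ Fin K) := ⟨Sum.inl ⟨0, hK⟩⟩
  exact (posDef_gram_of_isUnit h).inv.trace_pos

lemma WellDefined.integral_pos [IsProbabilityMeasure P] (hK : 0 < K)
    (hW : WellDefined P H a₁ a₂) : 0 < ∫ ω, wlTrace (H ω) (a₁ ω) (a₂ ω) ∂P := by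
  have hpos : ∀ᵐ ω ∂P, 0 < wlTrace (H ω) (a₁ ω) (a₂ ω) := by
    filter_upwards [hW.isUnit_det] with ω hω using wlTrace_pos hK hω
  rw [integral_pos_iff_support_of_nonneg_ae (hpos.mono fun ω h => h.le) hW.integrable]
  have : Function.support (fun ω => wlTrace (H ω) (a₁ ω) (a₂ ω)) =ᵐ[P] Set.univ := by
    filter_upwards [hpos] with ω hω
    exact propext ⟨fun _ => trivial, fun _ => hω.ne'⟩
  rw [measure_congr this]
  simp

lemma WellDefined.wlRate [IsProbabilityMeasure P] (hK : 0 < K) (hW : WellDefined P H a₁ a₂)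
    {σn : ℝ} (hσ : 0 < σn) :
    ∀ᵐ ω ∂P, HasMultiplexingGain (wlRate P H a₁ a₂ σn ω) K ∧
      HasPowerOffset (wlRate P H a₁ a₂ σn ω) K
      (-Real.logb 2 (2 / (∫ ω, wlTrace (H ω) (a₁ ω) (a₂ ω) ∂P) / σn ^ 2)) := by
  have hK' : (0 : ℝ) < K := by exact_mod_cast hK
  have ht := hW.integral_pos hK
  filter_upwards [hW.isUnit_det] with ω hω
  refine gain_and_offset_of_eventuallyEq hK' (by positivity) fun PT hPT => ?_
  have e : wlChannel (H ω) (a₁ ω) (a₂ ω) * wlPrecoder P H a₁ a₂ PT ω =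
      Real.sqrt (wlLambda P H a₁ a₂ PT) • 1 := by
    rw [wlPrecoder, Matrix.mul_smul, ← Matrix.mul_assoc]
    change _ • (wlGram (H ω) (a₁ ω) (a₂ ω) * _) = _
    rw [Matrix.mul_nonsing_inv _ hω]
  have hl : 0 ≤ wlLambda P H a₁ a₂ PT := by rw [wlLambda]; positivity
  simp only [WLZF.wlRate, e, sinr_smul_one, Finset.sum_const, Finset.card_univ,
    Fintype.card_sum, Fintype.card_fin, nsmul_eq_mul, Real.norm_eq_abs, sq_abs, Real.sq_sqrt hl]
  rw [wlLambda]
  push_cast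
  rw [← mul_assoc, show ((K : ℝ) + K) * (1 / 2) = K by ring]
  congr 3
  field_simp

/-- The power offset loss in terms of the expected trace. -/
lemma isOffsetLoss (hH : IsRayleigh P H) (hK : 0 < K) (hKN : K < N) (hW : WellDefined P H a₁ a₂)
    {σn : ℝ} (hσ : 0 < σn) :
    IsOffsetLoss P H a₁ a₂ σn (Real.logb 2 ((∫ ω, wlTrace (H ω) (a₁ ω) (a₂ ω) ∂P) /
      (2 * ((K : ℝ) / (N - K))))) := by
  have := hH.isProbabilityMeasure
  have hKN' : (0 : ℝ) < N - K := by rw [sub_pos]; exact_mod_cast hKN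
  have hK' : (0 : ℝ) < K := by exact_mod_cast hK
  have ht := hW.integral_pos hK
  refine ⟨_, _, hW.wlRate hK hσ, hH.zfRate hK hKN hσ, ?_⟩
  set t := ∫ ω, wlTrace (H ω) (a₁ ω) (a₂ ω) ∂P
  rw [sub_neg_eq_add, neg_add_eq_sub, ← Real.logb_div (by positivity) (by positivity)]
  congr 1
  field_simp

/-! ### Well-definedness -/

lemma trace_wlGram_le {κ : ℝ} (hκ : 0 < κ) {X : Matrix (Fin K) (Fin N) ℂ}
    {a₁ a₂ : Fin N → ℂ} (hX : IsUnit (X * Xᴴ).det)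
    (h : ∀ x, κ * gramForm (realRep X) x ≤ gramForm (wlChannel X a₁ a₂) x) :
    IsUnit (wlGram X a₁ a₂).det ∧ κ * wlTrace X a₁ a₂ ≤ 2 * (zfTrace X).re := by
  have hA : (realRep X * (realRep X)ᵀ).PosDef := by
    refine posDef_gram_of_isUnit ?_
    rw [← realRep_conjTranspose, ← realRep_mul, isUnit_det_realRep]; exact hX
  have h' : ∀ x, κ * (x ⬝ᵥ ((realRep X * (realRep X)ᵀ) *ᵥ x)) ≤
      x ⬝ᵥ (wlGram X a₁ a₂ *ᵥ x) := by
    intro x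
    have := h x
    rwa [gramForm_eq_dotProduct, gramForm_eq_dotProduct] at this
  have hB : (wlGram X a₁ a₂).PosDef := by
    refine posDef_of_le hκ hA ?_ h'
    rw [wlGram, Matrix.transpose_mul, Matrix.transpose_transpose]
  have hu : IsUnit (wlGram X a₁ a₂).det := (Matrix.isUnit_iff_isUnit_det _).1 hB.isUnit
  refine ⟨hu, ?_⟩
  have := trace_inv_antitone hκ hA hu h'
  rwa [trace_realRep_gram_inv hX] at this

/-- If the effective Gram form dominates `κ` times the ideal one, the trace is at most `(2/κ) Tr (H
Hᴴ)⁻¹`, which is integrable. -/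
lemma wellDefined_of_gramForm_le (hH : IsRayleigh P H) (hK : 0 < K) (hKN : K < N) {κ : ℝ}
    (hκ : 0 < κ) (hm : AEStronglyMeasurable (fun ω => wlTrace (H ω) (a₁ ω) (a₂ ω)) P)
    (h : ∀ᵐ ω ∂P, ∀ x, κ * gramForm (realRep (H ω)) x ≤
      gramForm (wlChannel (H ω) (a₁ ω) (a₂ ω)) x) : WellDefined P H a₁ a₂ := by
  have h2 : ∀ᵐ ω ∂P, IsUnit (wlGram (H ω) (a₁ ω) (a₂ ω)).det ∧
      κ * wlTrace (H ω) (a₁ ω) (a₂ ω) ≤ 2 * (zfTrace (H ω)).re := by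
    filter_upwards [h, hH.ae_isUnit_det hK hKN] with ω h1 h2 using trace_wlGram_le hκ h2 h1
  refine ⟨h2.mono fun _ h => h.1, ?_⟩
  have hi := (hH.integrable_comp (F := fun X => (zfTrace X).re)
    (integrable_zfTrace_re hK hKN)).const_mul (2 / κ)
  refine hi.mono hm (h2.mono fun ω hω => ?_)
  rw [Real.norm_of_nonneg (wlTrace_pos hK hω.1).le,
    Real.norm_of_nonneg (mul_nonneg (by positivity) (zfTrace_re_nonneg _).2),
    div_mul_eq_mul_div, le_div_iff₀ hκ]
  linarith [hω.2]

lemma iqMat_one_zero {n : Type*} [Fintype n] [DecidableEq n] {a₁ a₂ : n → ℂ}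
    (h₁ : diagonal a₁ = 1) (h₂ : diagonal a₂ = 0) : iqMat a₁ a₂ = 1 := by
  have : realRep (0 : Matrix n n ℂ) = 0 := by
    ext (i | i) (j | j) <;> simp [realRep]
  rw [iqMat, h₁, h₂, realRep_one, this, Matrix.zero_mul, add_zero]

lemma wlTrace_one_zero {X : Matrix (Fin K) (Fin N) ℂ} {a₁ a₂ : Fin N → ℂ}
    (h₁ : diagonal a₁ = 1) (h₂ : diagonal a₂ = 0) (hX : IsUnit (X * Xᴴ).det) :
    wlTrace X a₁ a₂ = 2 * (zfTrace X).re := by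
  rw [wlTrace, wlGram, wlChannel, iqMat_one_zero h₁ h₂, Matrix.mul_one, trace_realRep_gram_inv hX]

lemma wellDefined_one_zero (hH : IsRayleigh P H) (hK : 0 < K) (hKN : K < N)
    (h : ∀ᵐ ω ∂P, diagonal (a₁ ω) = 1 ∧ diagonal (a₂ ω) = 0) :
    WellDefined P H a₁ a₂ ∧
      ∫ ω, wlTrace (H ω) (a₁ ω) (a₂ ω) ∂P = 2 * ((K : ℝ) / (N - K)) := by
  have e : (fun ω => wlTrace (H ω) (a₁ ω) (a₂ ω)) =ᵐ[P] fun ω => 2 * (zfTrace (H ω)).re := by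
    filter_upwards [h, hH.ae_isUnit_det hK hKN] with ω h1 h2
    exact wlTrace_one_zero h1.1 h1.2 h2
  have hi := (hH.integrable_comp (F := fun X => (zfTrace X).re)
    (integrable_zfTrace_re hK hKN))
  constructor
  · refine wellDefined_of_gramForm_le hH hK hKN one_pos
      ((hi.const_mul 2).aestronglyMeasurable.congr e.symm) ?_
    filter_upwards [h] with ω h1 x
    rw [wlChannel, iqMat_one_zero h1.1 h1.2, Matrix.mul_one, one_mul]
  · rw [integral_congr_ae e, integral_const_mul, hH.integral_comp (F := fun X => (zfTrace X).re)
      (integrable_zfTrace_re hK hKN).aestronglyMeasurable, integral_zfTrace_re hK hKN]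

lemma measurable_wlTrace (σg : ℝ) :
    Measurable fun p : (ChanIdx K N → ℝ) × (Fin N → ℝ × ℝ) =>
      wlTrace (chan p.1) (fun n => iqCoeff₁ σg (p.2 n).1 (p.2 n).2)
        (fun n => iqCoeff₂ σg (p.2 n).1 (p.2 n).2) := by
  have hR : ∀ {α m n : Type} [MeasurableSpace α] {X : α → Matrix m n ℂ}
      (_ : ∀ i j, Measurable fun a => X a i j) (i : m ⊕ m) (j : n ⊕ n),
      Measurable fun a => realRep (X a) i j := by
    intro α m n _ X hX i j
    rcases i with i | i <;> rcases j with j | j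
    · exact Complex.measurable_re.comp (hX i j)
    · exact (Complex.measurable_im.comp (hX i j)).neg
    · exact Complex.measurable_im.comp (hX i j)
    · exact Complex.measurable_re.comp (hX i j)
  have hD : ∀ {α : Type} [MeasurableSpace α] {a : α → Fin N → ℂ}
      (_ : ∀ i, Measurable fun x => a x i) (i j : Fin N),
      Measurable fun x => diagonal (a x) i j := by
    intro α _ a ha i j
    by_cases h : i = j
    · subst h; simpa using ha i
    · simp [Matrix.diagonal_apply_ne _ h]
  have hp : ∀ n, Measurable fun p : (ChanIdx K N → ℝ) × (Fin N → ℝ × ℝ) => p.2 n := fun n =>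
    (measurable_pi_apply n).comp measurable_snd
  have h1 : ∀ n, Measurable fun p : (ChanIdx K N → ℝ) × (Fin N → ℝ × ℝ) =>
      iqCoeff₁ σg (p.2 n).1 (p.2 n).2 := by
    intro n
    have : Continuous fun x : ℝ × ℝ => iqCoeff₁ σg x.1 x.2 := by
      unfold iqCoeff₁; fun_prop
    exact this.measurable.comp (hp n)
  have h2 : ∀ n, Measurable fun p : (ChanIdx K N → ℝ) × (Fin N → ℝ × ℝ) =>
      iqCoeff₂ σg (p.2 n).1 (p.2 n).2 := by
    intro n
    have : Continuous fun x : ℝ × ℝ => iqCoeff₂ σg x.1 x.2 := by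
      unfold iqCoeff₂; fun_prop
    exact this.measurable.comp (hp n)
  have hC : ∀ (i : Fin K ⊕ Fin K) (j : Fin N ⊕ Fin N),
      Measurable fun p : (ChanIdx K N → ℝ) × (Fin N → ℝ × ℝ) =>
      wlChannel (chan p.1) (fun n => iqCoeff₁ σg (p.2 n).1 (p.2 n).2)
        (fun n => iqCoeff₂ σg (p.2 n).1 (p.2 n).2) i j := by
    refine measurable_matrix_mul (hR fun k n => (measurable_chan k n).comp measurable_fst) ?_
    intro i j
    simp only [iqMat, Matrix.add_apply]
    exact (hR (hD h1) i j).add (measurable_matrix_mul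
      (B := fun _ => conjMat (Fin N)) (hR (hD h2)) (fun _ _ => measurable_const) i j)
  exact measurable_matrix_trace (measurable_matrix_inv (measurable_matrix_mul hC
    (fun i j => hC j i)))

lemma aestronglyMeasurable_wlTrace (hH : IsRayleigh P H) (σg : ℝ) {g θ : Fin N → Ω → ℝ}
    (hg : ∀ n, AEMeasurable (g n) P) (hθ : ∀ n, AEMeasurable (θ n) P) :
    AEStronglyMeasurable (fun ω => wlTrace (H ω) (diag₁ σg g θ ω) (diag₂ σg g θ ω)) P := by
  have h1 : AEMeasurable (fun ω => (coords (H ω), fun n => (g n ω, θ n ω))) P :=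
    hH.hasLaw.aemeasurable.prodMk (aemeasurable_pi_lambda _ fun n => (hg n).prodMk (hθ n))
  have h2 := ((measurable_wlTrace (K := K) (N := N) σg).comp_aemeasurable h1).aestronglyMeasurable
  simp only [Function.comp_def, chan_coords] at h2
  exact h2

lemma wellDefined_of_bounded_away (hH : IsRayleigh P H) (hK : 0 < K) (hKN : K < N) (σg : ℝ)
    {c : ℝ} {g θ : Fin N → Ω → ℝ} (hc : 0 < c) (hg : ∀ n, AEMeasurable (g n) P)
    (hθ : ∀ n, AEMeasurable (θ n) P)
    (h : ∀ᵐ ω ∂P, ∀ n, c ≤ |(|g n ω| - 1)| ∧ c ≤ |Real.cos (θ n ω)|) :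
    WellDefined P H (diag₁ σg g θ) (diag₂ σg g θ) := by
  -- The factor `c²` comes from `(1 ± g)² ≥ (|g| - 1)² ≥ c²`; the factor `c²/2` comes from `|sin θ|
  -- ≤ 1 - c²/2`, as `sin² θ ≤ 1 - c² ≤ (1 - c²/2)²`.
  refine wellDefined_of_gramForm_le hH hK hKN (κ := c ^ 2 / 2 / (1 + σg ^ 2) * c ^ 2)
    (by positivity) (aestronglyMeasurable_wlTrace hH σg hg hθ) ?_
  filter_upwards [h] with ω hω x
  refine le_trans ?_ (gramForm_wlChannel_lower (H ω) σg (fun n => g n ω) (fun n => θ n ω)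
    (c := c ^ 2 / 2) (fun n => ?_) x)
  · rw [mul_assoc, gramForm, Finset.mul_sum]
    refine mul_le_mul_of_nonneg_left (Finset.sum_le_sum fun j _ => ?_) (by positivity)
    refine mul_le_mul_of_nonneg_right ?_ (sq_nonneg _)
    have key : ∀ n, c ^ 2 ≤ (|g n ω| - 1) ^ 2 := fun n => by
      rw [← sq_abs (|g n ω| - 1)]
      exact pow_le_pow_left₀ hc.le (hω n).1 2
    rcases j with n | n
    · change c ^ 2 ≤ (1 + g n ω) ^ 2
      have := key n
      nlinarith [neg_abs_le (g n ω), sq_abs (g n ω)]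
    · change c ^ 2 ≤ (1 - g n ω) ^ 2
      have := key n
      nlinarith [le_abs_self (g n ω), sq_abs (g n ω)]
  · have h1 : c ^ 2 ≤ Real.cos (θ n ω) ^ 2 := by
      rw [← sq_abs (Real.cos _)]
      exact pow_le_pow_left₀ hc.le (hω n).2 2
    have h2 := Real.sin_sq_add_cos_sq (θ n ω)
    refine abs_le_of_sq_le_sq ?_ ?_
    · nlinarith [sq_nonneg (c ^ 2)]
    · nlinarith [Real.cos_sq_le_one (θ n ω)]

end Rates
end WLZF

namespace WLZF
open Matrix
open scoped ENNReal NNReal ComplexOrder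

/-! ### Second-order expansion of the trace -/

section Expansion

variable {K N : ℕ}

/-- The matrix `D` for which `Ã Ãᵀ = (1 + σg ^ 2)⁻¹ (1 + D)`. -/
noncomputable def iqPert (g θ : Fin N → ℝ) : Matrix (Fin N ⊕ Fin N) (Fin N ⊕ Fin N) ℝ :=
  fromBlocks (diagonal fun n => 2 * g n + g n ^ 2)
    (diagonal fun n => -((1 - g n ^ 2) * Real.sin (θ n)))
    (diagonal fun n => -((1 - g n ^ 2) * Real.sin (θ n)))
    (diagonal fun n => -(2 * g n) + g n ^ 2)

lemma iqMat_eq_fromBlocks (a₁ a₂ : Fin N → ℂ) : iqMat a₁ a₂ = fromBlocks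
    (diagonal fun n => (a₁ n).re + (a₂ n).re) (diagonal fun n => -(a₁ n).im + (a₂ n).im)
    (diagonal fun n => (a₁ n).im + (a₂ n).im) (diagonal fun n => (a₁ n).re - (a₂ n).re) := by
  rw [iqMat, conjMat, realRep, realRep, fromBlocks_multiply, fromBlocks_add]
  congr 1 <;> ext i j <;> by_cases h : i = j <;> simp [h, sub_eq_add_neg]

lemma iqMat_mul_transpose (σg : ℝ) (g θ : Fin N → ℝ) :
    iqMat (fun n => iqCoeff₁ σg (g n) (θ n)) (fun n => iqCoeff₂ σg (g n) (θ n)) *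
      (iqMat (fun n => iqCoeff₁ σg (g n) (θ n)) (fun n => iqCoeff₂ σg (g n) (θ n)))ᵀ =
    (1 + σg ^ 2)⁻¹ • (1 + iqPert g θ) := by
  obtain ⟨s, hs⟩ : ∃ s : ℝ, s = 1 / Real.sqrt (1 + σg ^ 2) := ⟨_, rfl⟩
  have hs2 : (1 + σg ^ 2)⁻¹ = s ^ 2 := by
    rw [hs, div_pow, Real.sq_sqrt (by positivity)]; simp
  have r1 : ∀ n, (iqCoeff₁ σg (g n) (θ n)).re = s * Real.cos (θ n / 2) := fun n => by
    rw [iqCoeff₁, ← hs, Complex.re_ofReal_mul]; simp [-Complex.ofReal_cos, -Complex.ofReal_sin]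
  have i1 : ∀ n, (iqCoeff₁ σg (g n) (θ n)).im = s * (g n * Real.sin (θ n / 2)) := fun n => by
    rw [iqCoeff₁, ← hs, Complex.im_ofReal_mul]; simp [-Complex.ofReal_cos, -Complex.ofReal_sin]
  have r2 : ∀ n, (iqCoeff₂ σg (g n) (θ n)).re = s * (g n * Real.cos (θ n / 2)) := fun n => by
    rw [iqCoeff₂, ← hs, Complex.re_ofReal_mul]; simp [-Complex.ofReal_cos, -Complex.ofReal_sin]
  have i2 : ∀ n, (iqCoeff₂ σg (g n) (θ n)).im = s * -Real.sin (θ n / 2) := fun n => by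
    rw [iqCoeff₂, ← hs, Complex.im_ofReal_mul]; simp [-Complex.ofReal_cos, -Complex.ofReal_sin]
  have hsin : ∀ n, Real.sin (θ n) = 2 * Real.sin (θ n / 2) * Real.cos (θ n / 2) := fun n => by
    rw [← Real.sin_two_mul]; congr 1; ring
  have hcs := fun n => Real.sin_sq_add_cos_sq (θ n / 2)
  rw [iqMat_eq_fromBlocks, fromBlocks_transpose, fromBlocks_multiply, iqPert, ← fromBlocks_one,
    fromBlocks_add, fromBlocks_smul, hs2]
  simp only [diagonal_transpose, diagonal_mul_diagonal, diagonal_add, r1, r2, i1, i2]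
  congr 1 <;> ext i j <;> by_cases h : i = j <;> simp [h]
  · linear_combination s ^ 2 * (1 + g j) ^ 2 * hcs j
  · linear_combination s ^ 2 * (1 - g j ^ 2) * hsin j
  · linear_combination s ^ 2 * (1 - g j ^ 2) * hsin j
  · linear_combination s ^ 2 * (1 - g j) ^ 2 * hcs j

lemma wlGram_eq (X : Matrix (Fin K) (Fin N) ℂ) (σg : ℝ) (g θ : Fin N → ℝ) :
    wlGram X (fun n => iqCoeff₁ σg (g n) (θ n)) (fun n => iqCoeff₂ σg (g n) (θ n)) =
      (1 + σg ^ 2)⁻¹ • (realRep X * (realRep X)ᵀ + realRep X * iqPert g θ * (realRep X)ᵀ) := by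
  rw [wlGram, wlChannel, Matrix.transpose_mul, Matrix.mul_assoc, ← Matrix.mul_assoc (iqMat _ _),
    iqMat_mul_transpose, Matrix.smul_mul, Matrix.mul_smul, Matrix.add_mul, Matrix.one_mul,
    Matrix.mul_add, Matrix.mul_assoc]

/-- Second-order expansion of an inverse. -/
lemma inv_add_eq {ι : Type*} [Fintype ι] [DecidableEq ι] {A B : Matrix ι ι ℝ}
    (hA : IsUnit A.det) (hAB : IsUnit (A + B).det) :
    (A + B)⁻¹ = A⁻¹ - A⁻¹ * B * A⁻¹ + A⁻¹ * B * (A + B)⁻¹ * B * A⁻¹ := by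
  have h1 : (A + B)⁻¹ = A⁻¹ - A⁻¹ * B * (A + B)⁻¹ := by
    have : A⁻¹ * (A + B) * (A + B)⁻¹ = A⁻¹ := by
      rw [Matrix.mul_assoc, Matrix.mul_nonsing_inv _ hAB, Matrix.mul_one]
    rw [Matrix.mul_add, Matrix.nonsing_inv_mul _ hA, Matrix.add_mul, Matrix.one_mul] at this
    exact eq_sub_of_add_eq this
  have h2 : (A + B)⁻¹ = A⁻¹ - (A + B)⁻¹ * B * A⁻¹ := by
    have : (A + B)⁻¹ * (A + B) * A⁻¹ = A⁻¹ := by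
      rw [Matrix.nonsing_inv_mul _ hAB, Matrix.one_mul]
    rw [Matrix.mul_add, Matrix.add_mul, Matrix.mul_assoc, Matrix.mul_nonsing_inv _ hA,
      Matrix.mul_one] at this
    exact eq_sub_of_add_eq this
  -- The second expansion is inserted inside the first, so that the exact inverse ends up in the
  -- middle of the remainder, where it can be compared with `A⁻¹` as a quadratic form.
  conv_lhs => rw [h1]
  conv_lhs => rw [h2]
  simp only [Matrix.mul_sub, Matrix.mul_assoc]
  abel

/-- The sum of the absolute values of the entries. -/
def entrySum {ι κ : Type*} [Fintype ι] [Fintype κ] (A : Matrix ι κ ℝ) : ℝ := ∑ i, ∑ j, |A i j|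

lemma abs_trace_mul_four_le {ι : Type*} [Fintype ι] (X P Y Q : Matrix ι ι ℝ) {p q : ℝ}
    (hP : ∀ i j, |P i j| ≤ p) (hQ : ∀ i j, |Q i j| ≤ q) :
    |(X * P * Y * Q).trace| ≤ entrySum X * entrySum Y * (p * q) := by
  have e : (X * P * Y * Q).trace = ∑ i, ∑ j, ∑ k, ∑ l, X i j * P j k * Y k l * Q l i := by
    simp only [Matrix.trace, Matrix.diag_apply, Matrix.mul_apply, Finset.sum_mul]
    refine Finset.sum_congr rfl fun i _ => ?_
    rw [Finset.sum_comm]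
    rw [Finset.sum_congr rfl fun k _ => Finset.sum_comm]
    rw [Finset.sum_comm]
  have e2 : entrySum X * entrySum Y * (p * q) =
      ∑ i, ∑ j, ∑ k, ∑ l, |X i j| * |Y k l| * (p * q) := by
    rw [entrySum, entrySum, Finset.sum_mul_sum, Finset.sum_mul]
    refine Finset.sum_congr rfl fun i _ => ?_
    simp only [Finset.sum_mul]
    rw [Finset.sum_comm]
    simp only [Finset.mul_sum, Finset.sum_mul]
  rw [e, e2]
  refine (Finset.abs_sum_le_sum_abs _ _).trans (Finset.sum_le_sum fun i _ => ?_)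
  refine (Finset.abs_sum_le_sum_abs _ _).trans (Finset.sum_le_sum fun j _ => ?_)
  refine (Finset.abs_sum_le_sum_abs _ _).trans (Finset.sum_le_sum fun k _ => ?_)
  refine (Finset.abs_sum_le_sum_abs _ _).trans (Finset.sum_le_sum fun l _ => ?_)
  rw [abs_mul, abs_mul, abs_mul]
  have h1 := mul_le_mul (hP j k) (hQ l i) (abs_nonneg _) ((abs_nonneg _).trans (hP j k))
  calc |X i j| * |P j k| * |Y k l| * |Q l i| = |X i j| * |Y k l| * (|P j k| * |Q l i|) := by ring
    _ ≤ _ := mul_le_mul_of_nonneg_left h1 (by positivity)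

lemma abs_realRep_le {m n : Type*} {X : Matrix m n ℂ} {c : ℝ} (h : ∀ i j, ‖X i j‖ ≤ c)
    (i : m ⊕ m) (j : n ⊕ n) : |realRep X i j| ≤ c := by
  rcases i with i | i <;> rcases j with j | j <;> simp only [realRep, fromBlocks_apply₁₁,
    fromBlocks_apply₁₂, fromBlocks_apply₂₁, fromBlocks_apply₂₂, Matrix.map_apply,
    Matrix.neg_apply, abs_neg]
  · exact (Complex.abs_re_le_norm _).trans (h i j)
  · exact (Complex.abs_im_le_norm _).trans (h i j)
  · exact (Complex.abs_im_le_norm _).trans (h i j)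
  · exact (Complex.abs_re_le_norm _).trans (h i j)

/-- The complex mismatch `2 g - j θ` of an antenna. -/
noncomputable def mismatch (g θ : ℝ) : ℂ := 2 * g - Complex.I * θ

/-- The linear part of `iqPert`. -/
noncomputable def iqLin (g θ : Fin N → ℝ) : Matrix (Fin N ⊕ Fin N) (Fin N ⊕ Fin N) ℝ :=
  realRep (diagonal fun n => mismatch (g n) (θ n)) * conjMat (Fin N)

lemma iqLin_eq (g θ : Fin N → ℝ) : iqLin g θ = fromBlocks (diagonal fun n => 2 * g n)
    (diagonal fun n => -θ n) (diagonal fun n => -θ n) (diagonal fun n => -(2 * g n)) := by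
  rw [iqLin, conjMat, realRep, fromBlocks_multiply]
  congr 1 <;> ext i j <;> by_cases h : i = j <;> simp [h, mismatch]

lemma conjMat_mul_realRep {n : Type*} [Fintype n] [DecidableEq n] (X : Matrix n n ℂ) :
    conjMat n * realRep X = realRep (X.map (starRingEnd ℂ)) * conjMat n := by
  rw [conjMat, realRep, realRep, fromBlocks_multiply, fromBlocks_multiply]
  congr 1 <;> ext i j <;> simp

lemma conjMat_mul_self {n : Type*} [Fintype n] [DecidableEq n] : conjMat n * conjMat n = 1 := by
  rw [conjMat, fromBlocks_multiply]; simp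

/-- The linear part of the perturbation is the antilinear map `x ↦ c x̄`. Moving the two
conjugations together replaces the matrices between them by their conjugates, and the trace becomes
that of `c p̄ c̄ q`. -/
lemma trace_iqLin_mul (g θ : Fin N → ℝ) (X : Matrix (Fin K) (Fin N) ℂ) :
    (iqLin g θ * realRep (zfProj X) * iqLin g θ * realRep (zfPow X)).trace =
      2 * (∑ n, ∑ m, mismatch (g n) (θ n) * starRingEnd ℂ (mismatch (g m) (θ m)) *
        (zfPow X m n * zfProj X m n)).re := by
  set c := diagonal fun n => mismatch (g n) (θ n) with hc
  have e : iqLin g θ * realRep (zfProj X) * iqLin g θ * realRep (zfPow X) =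
      realRep (c * (zfProj X).map (starRingEnd ℂ) * c.map (starRingEnd ℂ) * zfPow X) := by
    calc iqLin g θ * realRep (zfProj X) * iqLin g θ * realRep (zfPow X) =
        realRep c * (conjMat (Fin N) * realRep (zfProj X)) * realRep c * conjMat (Fin N) *
          realRep (zfPow X) := by simp only [iqLin, Matrix.mul_assoc, hc]
      _ = realRep c * realRep ((zfProj X).map (starRingEnd ℂ)) * (conjMat (Fin N) * realRep c) *
          conjMat (Fin N) * realRep (zfPow X) := by
        rw [conjMat_mul_realRep (zfProj X)]; simp only [Matrix.mul_assoc]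
      _ = realRep c * realRep ((zfProj X).map (starRingEnd ℂ)) *
          realRep (c.map (starRingEnd ℂ)) * (conjMat (Fin N) * conjMat (Fin N)) *
          realRep (zfPow X) := by
        rw [conjMat_mul_realRep c]; simp only [Matrix.mul_assoc]
      _ = _ := by
        rw [conjMat_mul_self, Matrix.mul_one, ← realRep_mul, ← realRep_mul, ← realRep_mul]
  rw [e, trace_realRep]
  congr 2
  have hcm : c.map (starRingEnd ℂ) =
      diagonal fun n => starRingEnd ℂ (mismatch (g n) (θ n)) := by
    rw [hc, Matrix.diagonal_map (by simp)]
  rw [hcm, hc, Matrix.trace]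
  refine Finset.sum_congr rfl fun n _ => ?_
  rw [Matrix.diag_apply, Matrix.mul_apply]
  refine Finset.sum_congr rfl fun m _ => ?_
  have hp : starRingEnd ℂ (zfProj X n m) = zfProj X m n := by
    conv_rhs => rw [← zfProj_conjTranspose]
    rfl
  rw [Matrix.mul_diagonal, Matrix.diagonal_mul, Matrix.map_apply, hp]
  ring

/-- The terms `± 2 g` of the two diagonal blocks meet the same real part and cancel; the equal
off-diagonal blocks meet opposite imaginary parts. So the first-order term of the expansion is
itself quadratic in the mismatches. -/
lemma trace_iqPert_mul_realRep (g θ : Fin N → ℝ) (X : Matrix (Fin N) (Fin N) ℂ) :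
    (iqPert g θ * realRep X).trace = 2 * ∑ n, g n ^ 2 * (X n n).re := by
  rw [iqPert, realRep, fromBlocks_multiply, Finset.mul_sum]
  simp only [Matrix.trace, Fintype.sum_sum_type, fromBlocks_apply₁₁, fromBlocks_apply₂₂, Matrix.diag_apply, Matrix.add_apply, Matrix.diagonal_mul,
    Matrix.map_apply, Matrix.neg_apply, ← Finset.sum_add_distrib]
  exact Finset.sum_congr rfl fun n _ => by ring

lemma entrySum_fromBlocks_diagonal (a b c d : Fin N → ℝ) :
    entrySum (fromBlocks (diagonal a) (diagonal b) (diagonal c) (diagonal d)) =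
      ∑ n, (|a n| + |b n| + |c n| + |d n|) := by
  have h : ∀ (v : Fin N → ℝ) (i : Fin N), ∑ j, |diagonal v i j| = |v i| := by
    intro v i
    rw [Finset.sum_eq_single i]
    · simp
    · intro j _ hj
      simp [Matrix.diagonal_apply_ne _ hj.symm]
    · simp
  simp only [entrySum, Fintype.sum_sum_type, fromBlocks_apply₁₁,
    fromBlocks_apply₁₂, fromBlocks_apply₂₁, fromBlocks_apply₂₂, h, Finset.sum_add_distrib]
  ring

lemma abs_sin_sub_le {x : ℝ} (hx : |x| ≤ 1) : |Real.sin x - x| ≤ x ^ 2 := by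
  have h := Real.sin_bound hx
  have h0 := abs_nonneg x
  have h3 : |x ^ 3 / 6| ≤ x ^ 2 / 6 := by
    rw [abs_div, abs_pow, abs_of_pos (by norm_num : (0 : ℝ) < 6), ← sq_abs x]
    have : |x| ^ 3 ≤ |x| ^ 2 := pow_le_pow_of_le_one h0 hx (by norm_num)
    linarith
  have h4 : |x| ^ 4 ≤ x ^ 2 := by
    rw [← sq_abs x]; exact pow_le_pow_of_le_one h0 hx (by norm_num)
  have h5 : Real.sin x - x = (Real.sin x - (x - x ^ 3 / 6)) - x ^ 3 / 6 := by ring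
  rw [h5]
  refine (abs_sub _ _).trans ?_
  nlinarith [sq_nonneg x]

variable {δ : ℝ} {g θ : Fin N → ℝ}

lemma entrySum_iqLin_le (g θ : Fin N → ℝ) :
    entrySum (iqLin g θ) ≤ 6 * ∑ n, (|g n| + |θ n|) := by
  rw [iqLin_eq, entrySum_fromBlocks_diagonal, Finset.mul_sum]
  refine Finset.sum_le_sum fun n _ => ?_
  simp only [abs_neg, abs_mul, abs_two]
  linarith [abs_nonneg (g n), abs_nonneg (θ n)]

lemma entrySum_iqPert_le (hδ : δ ≤ 1) (hg : ∀ n, |g n| ≤ δ) :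
    entrySum (iqPert g θ) ≤ 6 * ∑ n, (|g n| + |θ n|) := by
  rw [iqPert, entrySum_fromBlocks_diagonal, Finset.mul_sum]
  refine Finset.sum_le_sum fun n _ => ?_
  have h0 := abs_nonneg (g n)
  have h1 := (hg n).trans hδ
  have h2 : |g n ^ 2| ≤ |g n| := by rw [abs_pow]; nlinarith
  have h3 : |1 - g n ^ 2| ≤ 1 := by
    rw [abs_le]; rw [abs_of_nonneg (sq_nonneg _)] at h2
    constructor <;> nlinarith [sq_nonneg (g n)]
  have h4 : |(1 - g n ^ 2) * Real.sin (θ n)| ≤ |θ n| := by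
    rw [abs_mul]
    have := Real.abs_sin_le_abs (x := θ n)
    nlinarith [abs_nonneg (Real.sin (θ n)), abs_nonneg (1 - g n ^ 2)]
  have h5 := abs_add_le (2 * g n) (g n ^ 2)
  have h6 := abs_add_le (-(2 * g n)) (g n ^ 2)
  rw [abs_neg] at h6
  rw [abs_mul, abs_two] at h5 h6
  rw [abs_neg]
  linarith [abs_nonneg (θ n)]

lemma entrySum_iqPert_sub_le (hδ : δ ≤ 1) (hg : ∀ n, |g n| ≤ δ)
    (hθ : ∀ n, |θ n| ≤ δ) :
    entrySum (iqPert g θ - iqLin g θ) ≤ 4 * δ * ∑ n, (|g n| + |θ n|) := by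
  have e : iqPert g θ - iqLin g θ = fromBlocks (diagonal fun n => g n ^ 2)
      (diagonal fun n => θ n - (1 - g n ^ 2) * Real.sin (θ n))
      (diagonal fun n => θ n - (1 - g n ^ 2) * Real.sin (θ n))
      (diagonal fun n => g n ^ 2) := by
    rw [iqPert, iqLin_eq]
    ext (i | i) (j | j) <;> by_cases h : i = j <;> simp [h] <;> ring
  rw [e, entrySum_fromBlocks_diagonal, Finset.mul_sum]
  refine Finset.sum_le_sum fun n _ => ?_
  have h0 := abs_nonneg (g n)
  have h0' := abs_nonneg (θ n)
  have h2 : |g n ^ 2| ≤ δ * |g n| := by rw [abs_pow]; nlinarith [hg n]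
  have h3 := abs_sin_sub_le ((hθ n).trans hδ)
  have h4 : |g n ^ 2 * Real.sin (θ n)| ≤ δ * |θ n| := by
    rw [abs_mul]
    have := Real.abs_sin_le_abs (x := θ n)
    have h5 : |g n ^ 2| ≤ δ := h2.trans (by nlinarith [hg n])
    exact mul_le_mul h5 this (abs_nonneg _) (h0.trans (hg n))
  have h6 : θ n ^ 2 ≤ δ * |θ n| := by rw [← sq_abs]; nlinarith [hθ n]
  have h7 : θ n - (1 - g n ^ 2) * Real.sin (θ n) =
      -(Real.sin (θ n) - θ n) + g n ^ 2 * Real.sin (θ n) := by ring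
  have h8 : |θ n - (1 - g n ^ 2) * Real.sin (θ n)| ≤ 2 * (δ * |θ n|) := by
    rw [h7]
    refine (abs_add_le _ _).trans ?_
    rw [abs_neg]
    linarith
  have h9 : 0 ≤ δ * |g n| := mul_nonneg (h0.trans (hg n)) h0
  linarith

lemma sq_sum_abs_le (g θ : Fin N → ℝ) :
    (∑ n, (|g n| + |θ n|)) ^ 2 ≤ 2 * N * ∑ n, (g n ^ 2 + θ n ^ 2) := by
  have h := sq_sum_le_card_mul_sum_sq (s := Finset.univ) (f := fun n => |g n| + |θ n|)
  rw [Finset.card_univ, Fintype.card_fin] at h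
  refine h.trans ?_
  rw [mul_comm 2 (N : ℝ), mul_assoc]
  refine mul_le_mul_of_nonneg_left ?_ N.cast_nonneg
  rw [Finset.mul_sum]
  refine Finset.sum_le_sum fun n _ => ?_
  nlinarith [sq_nonneg (|g n| - |θ n|), sq_abs (g n), sq_abs (θ n)]

/-- The diagonal entries are at most `2δ + δ² ≤ 3δ` and the off-diagonal ones at most `δ`. -/
lemma abs_dotProduct_iqPert_le (hδ : δ ≤ 1) (hg : ∀ n, |g n| ≤ δ)
    (hθ : ∀ n, |θ n| ≤ δ) (y : Fin N ⊕ Fin N → ℝ) :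
    |y ⬝ᵥ (iqPert g θ *ᵥ y)| ≤ 4 * δ * (y ⬝ᵥ y) := by
  have e : y ⬝ᵥ (iqPert g θ *ᵥ y) = ∑ n, ((2 * g n + g n ^ 2) * y (Sum.inl n) ^ 2 +
      (-(2 * g n) + g n ^ 2) * y (Sum.inr n) ^ 2 -
      2 * ((1 - g n ^ 2) * Real.sin (θ n)) * (y (Sum.inl n) * y (Sum.inr n))) := by
    rw [iqPert, fromBlocks_mulVec, dotProduct, Fintype.sum_sum_type, ← Finset.sum_add_distrib]
    refine Finset.sum_congr rfl fun n _ => ?_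
    simp only [Sum.elim_inl, Sum.elim_inr, Pi.add_apply, mulVec_diagonal, Function.comp_apply]
    ring
  rw [e, dotProduct, Fintype.sum_sum_type, ← Finset.sum_add_distrib, Finset.mul_sum]
  refine (Finset.abs_sum_le_sum_abs _ _).trans (Finset.sum_le_sum fun n _ => ?_)
  set a := y (Sum.inl n)
  set b := y (Sum.inr n)
  have h0 := abs_nonneg (g n)
  have hg' := hg n
  have hδ0 := h0.trans hg'
  have h1 := hg'.trans hδ
  have hs : |Real.sin (θ n)| ≤ δ := (Real.abs_sin_le_abs (x := θ n)).trans (hθ n)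
  have h2 : g n ^ 2 ≤ δ := by rw [← sq_abs]; nlinarith
  have h3 : |(1 - g n ^ 2) * Real.sin (θ n)| ≤ δ := by
    rw [abs_mul]
    have : |1 - g n ^ 2| ≤ 1 := by rw [abs_le]; constructor <;> nlinarith [sq_nonneg (g n)]
    nlinarith [abs_nonneg (Real.sin (θ n)), abs_nonneg (1 - g n ^ 2)]
  have h4 := abs_le.1 h3
  have h5 := abs_le.1 hg'
  set u := (1 - g n ^ 2) * Real.sin (θ n)
  have h6 : |2 * u * (a * b)| ≤ δ * (a ^ 2 + b ^ 2) := by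
    rw [abs_mul, abs_mul, abs_two]
    have h7 : 2 * |a * b| ≤ a ^ 2 + b ^ 2 := by
      rw [abs_mul]; nlinarith [sq_nonneg (|a| - |b|), sq_abs a, sq_abs b]
    nlinarith [abs_nonneg (a * b), abs_nonneg u]
  have h7 := abs_le.1 h6
  rw [abs_le]
  constructor <;> nlinarith [sq_nonneg a, sq_nonneg b, sq_nonneg (g n),
    mul_nonneg (sq_nonneg a) (sub_nonneg.2 h5.2), mul_nonneg (sq_nonneg b) (sub_nonneg.2 h5.2),
    mul_nonneg (sq_nonneg a) (sub_nonneg.2 h5.1), mul_nonneg (sq_nonneg b) (sub_nonneg.2 h5.1),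
    mul_nonneg (sq_nonneg a) (sub_nonneg.2 h2), mul_nonneg (sq_nonneg b) (sub_nonneg.2 h2),
    mul_nonneg (sq_nonneg a) (sq_nonneg (g n)), mul_nonneg (sq_nonneg b) (sq_nonneg (g n))]

end Expansion
end WLZF

namespace WLZF
open Matrix
open scoped ENNReal NNReal ComplexOrder

/-! ### Trace of the inverse Gram matrix for small mismatches, with relative error control -/

section TraceExpansion

variable {K N : ℕ} {δ : ℝ} {g θ : Fin N → ℝ}

lemma trace_transpose_mul_mul {ι : Type*} [Fintype ι] (C S : Matrix ι ι ℝ) :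
    (Cᵀ * S * C).trace = ∑ i, C.col i ⬝ᵥ (S *ᵥ C.col i) := by
  rw [Matrix.trace]
  refine Finset.sum_congr rfl fun i _ => ?_
  rw [Matrix.diag_apply, Matrix.mul_assoc, Matrix.mul_apply]
  rfl

lemma realRep_zfProj {X : Matrix (Fin K) (Fin N) ℂ} (hX : IsUnit (X * Xᴴ).det) :
    (realRep X)ᵀ * (realRep X * (realRep X)ᵀ)⁻¹ * realRep X = realRep (zfProj X) := by
  rw [realRep_gram_inv hX, ← realRep_conjTranspose, ← realRep_mul, ← realRep_mul, zfProj]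

lemma realRep_zfPow {X : Matrix (Fin K) (Fin N) ℂ} (hX : IsUnit (X * Xᴴ).det) :
    (realRep X)ᵀ * ((realRep X * (realRep X)ᵀ)⁻¹ * (realRep X * (realRep X)ᵀ)⁻¹) * realRep X =
      realRep (zfPow X) := by
  rw [realRep_gram_inv hX, ← realRep_conjTranspose, ← realRep_mul, ← realRep_mul, ← realRep_mul,
    zfPow, pow_two]

/-- The perturbation of the Gram matrix caused by the mismatches. -/
noncomputable def gramPert (X : Matrix (Fin K) (Fin N) ℂ) (g θ : Fin N → ℝ) :
    Matrix (Fin K ⊕ Fin K) (Fin K ⊕ Fin K) ℝ := realRep X * iqPert g θ * (realRep X)ᵀ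

lemma iqPert_transpose (g θ : Fin N → ℝ) : (iqPert g θ)ᵀ = iqPert g θ := by
  rw [iqPert, fromBlocks_transpose]; simp only [diagonal_transpose]

lemma gramPert_transpose (X : Matrix (Fin K) (Fin N) ℂ) (g θ : Fin N → ℝ) :
    (gramPert X g θ)ᵀ = gramPert X g θ := by
  rw [gramPert, Matrix.transpose_mul, Matrix.transpose_mul, Matrix.transpose_transpose,
    iqPert_transpose, Matrix.mul_assoc]

/-- Because `B = H̃ D H̃ᵀ`, the bound on `D` becomes a bound relative to the unperturbed Gram
matrix, whatever its conditioning. Hence the perturbed inverse lies between `(1 + 4δ)⁻¹` and `(1 -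
4δ)⁻¹` times the unperturbed one. -/
lemma abs_dotProduct_gramPert_le (hδ : δ ≤ 1) (hg : ∀ n, |g n| ≤ δ) (hθ : ∀ n, |θ n| ≤ δ)
    (X : Matrix (Fin K) (Fin N) ℂ) (y : Fin K ⊕ Fin K → ℝ) :
    |y ⬝ᵥ (gramPert X g θ *ᵥ y)| ≤ 4 * δ * (y ⬝ᵥ ((realRep X * (realRep X)ᵀ) *ᵥ y)) := by
  have h := abs_dotProduct_iqPert_le hδ hg hθ ((realRep X)ᵀ *ᵥ y)
  have e1 : y ⬝ᵥ (gramPert X g θ *ᵥ y) =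
      ((realRep X)ᵀ *ᵥ y) ⬝ᵥ (iqPert g θ *ᵥ ((realRep X)ᵀ *ᵥ y)) := by
    rw [gramPert, ← Matrix.mulVec_mulVec, ← Matrix.mulVec_mulVec, Matrix.dotProduct_mulVec,
      Matrix.mulVec_transpose]
  have e2 : y ⬝ᵥ ((realRep X * (realRep X)ᵀ) *ᵥ y) =
      ((realRep X)ᵀ *ᵥ y) ⬝ᵥ ((realRep X)ᵀ *ᵥ y) := by
    rw [← Matrix.mulVec_mulVec, Matrix.dotProduct_mulVec, Matrix.mulVec_transpose]
  rwa [e1, e2]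

lemma posDef_realRep_gram {X : Matrix (Fin K) (Fin N) ℂ} (hX : IsUnit (X * Xᴴ).det) :
    (realRep X * (realRep X)ᵀ).PosDef := by
  refine posDef_gram_of_isUnit ?_
  rw [← realRep_conjTranspose, ← realRep_mul, isUnit_det_realRep]; exact hX

lemma posDef_gram_add_pert (hδ : δ ≤ 1 / 8) (hg : ∀ n, |g n| ≤ δ) (hθ : ∀ n, |θ n| ≤ δ)
    {X : Matrix (Fin K) (Fin N) ℂ} (hX : IsUnit (X * Xᴴ).det) :
    (realRep X * (realRep X)ᵀ + gramPert X g θ).PosDef := by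
  refine posDef_of_le (c := 1 - 4 * δ) (by linarith) (posDef_realRep_gram hX) ?_ fun y => ?_
  · rw [Matrix.transpose_add, gramPert_transpose, Matrix.transpose_mul,
      Matrix.transpose_transpose]
  · rw [Matrix.add_mulVec, dotProduct_add]
    linarith [(abs_le.1 (abs_dotProduct_gramPert_le (by linarith) hg hθ X y)).1]

lemma dotProduct_inv_gram_add_pert_le (hδ : δ ≤ 1 / 8) (hg : ∀ n, |g n| ≤ δ)
    (hθ : ∀ n, |θ n| ≤ δ) {X : Matrix (Fin K) (Fin N) ℂ} (hX : IsUnit (X * Xᴴ).det)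
    (x : Fin K ⊕ Fin K → ℝ) :
    (1 - 4 * δ) * (x ⬝ᵥ ((realRep X * (realRep X)ᵀ + gramPert X g θ)⁻¹ *ᵥ x)) ≤
      x ⬝ᵥ ((realRep X * (realRep X)ᵀ)⁻¹ *ᵥ x) := by
  refine dotProduct_inv_antitone (by linarith) (posDef_realRep_gram hX)
    ((Matrix.isUnit_iff_isUnit_det _).1 (posDef_gram_add_pert hδ hg hθ hX).isUnit)
    (fun y => ?_) x
  rw [Matrix.add_mulVec, dotProduct_add]
  linarith [(abs_le.1 (abs_dotProduct_gramPert_le (by linarith) hg hθ X y)).1]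

lemma le_dotProduct_inv_gram_add_pert (hδ0 : 0 ≤ δ) (hδ : δ ≤ 1 / 8) (hg : ∀ n, |g n| ≤ δ)
    (hθ : ∀ n, |θ n| ≤ δ) {X : Matrix (Fin K) (Fin N) ℂ} (hX : IsUnit (X * Xᴴ).det)
    (x : Fin K ⊕ Fin K → ℝ) :
    (1 + 4 * δ)⁻¹ * (x ⬝ᵥ ((realRep X * (realRep X)ᵀ)⁻¹ *ᵥ x)) ≤
      x ⬝ᵥ ((realRep X * (realRep X)ᵀ + gramPert X g θ)⁻¹ *ᵥ x) := by
  refine dotProduct_inv_antitone (by positivity) (posDef_gram_add_pert hδ hg hθ hX)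
    ((Matrix.isUnit_iff_isUnit_det _).1 (posDef_realRep_gram hX).isUnit) (fun y => ?_) x
  rw [inv_mul_le_iff₀ (by positivity), Matrix.add_mulVec, dotProduct_add]
  linarith [(abs_le.1 (abs_dotProduct_gramPert_le (by linarith) hg hθ X y)).2]

lemma wlTrace_eq (hδ : δ ≤ 1 / 8) (hg : ∀ n, |g n| ≤ δ) (hθ : ∀ n, |θ n| ≤ δ)
    {X : Matrix (Fin K) (Fin N) ℂ} (hX : IsUnit (X * Xᴴ).det) (σg : ℝ) :
    wlTrace X (fun n => iqCoeff₁ σg (g n) (θ n)) (fun n => iqCoeff₂ σg (g n) (θ n)) =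
      (1 + σg ^ 2) * ((realRep X * (realRep X)ᵀ + gramPert X g θ)⁻¹).trace := by
  have hu := (Matrix.isUnit_iff_isUnit_det _).1 (posDef_gram_add_pert hδ hg hθ hX).isUnit
  have hs : (1 + σg ^ 2) ≠ 0 := by positivity
  rw [wlTrace, wlGram_eq, ← gramPert]
  rw [Matrix.inv_eq_right_inv (B := (1 + σg ^ 2) •
    (realRep X * (realRep X)ᵀ + gramPert X g θ)⁻¹), Matrix.trace_smul, smul_eq_mul]
  rw [Matrix.smul_mul, Matrix.mul_smul, smul_smul, inv_mul_cancel₀ hs, one_smul,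
    Matrix.mul_nonsing_inv _ hu]

lemma trace_inv_gram_add_pert_le (hδ : δ ≤ 1 / 8) (hg : ∀ n, |g n| ≤ δ)
    (hθ : ∀ n, |θ n| ≤ δ) {X : Matrix (Fin K) (Fin N) ℂ} (hX : IsUnit (X * Xᴴ).det) :
    ((realRep X * (realRep X)ᵀ + gramPert X g θ)⁻¹).trace ≤ 4 * (zfTrace X).re := by
  have hp := (posDef_gram_add_pert hδ hg hθ hX)
  have h : (1 - 4 * δ) * ((realRep X * (realRep X)ᵀ + gramPert X g θ)⁻¹).trace ≤
      ((realRep X * (realRep X)ᵀ)⁻¹).trace := by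
    rw [trace_eq_sum_dotProduct, trace_eq_sum_dotProduct, Finset.mul_sum]
    exact Finset.sum_le_sum fun i _ => dotProduct_inv_gram_add_pert_le hδ hg hθ hX _
  rw [trace_realRep_gram_inv hX] at h
  have h0 : 0 ≤ ((realRep X * (realRep X)ᵀ + gramPert X g θ)⁻¹).trace :=
    hp.inv.posSemidef.trace_nonneg
  nlinarith

/-- Second-order expansion of the trace of the inverse Gram matrix for small mismatches. -/
lemma abs_trace_inv_sub_le (hδ0 : 0 ≤ δ) (hδ : δ ≤ 1 / 8) (hg : ∀ n, |g n| ≤ δ)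
    (hθ : ∀ n, |θ n| ≤ δ) {X : Matrix (Fin K) (Fin N) ℂ} (hX : IsUnit (X * Xᴴ).det) :
    |((realRep X * (realRep X)ᵀ + gramPert X g θ)⁻¹).trace -
      (2 * (zfTrace X).re - 2 * ∑ n, g n ^ 2 * (zfPow X n n).re +
        2 * (∑ n, ∑ m, mismatch (g n) (θ n) * starRingEnd ℂ (mismatch (g m) (θ m)) *
          (zfPow X m n * zfProj X m n)).re)| ≤
      672 * N * δ * (∑ n, (g n ^ 2 + θ n ^ 2)) * (zfTrace X).re := by
  have hp := posDef_gram_add_pert hδ hg hθ hX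
  have hW := posDef_realRep_gram hX
  have hlow := le_dotProduct_inv_gram_add_pert hδ0 hδ hg hθ hX
  have hupp := dotProduct_inv_gram_add_pert_le hδ hg hθ hX
  have hexp := inv_add_eq ((Matrix.isUnit_iff_isUnit_det _).1 hW.isUnit)
    ((Matrix.isUnit_iff_isUnit_det _).1 hp.isUnit)
  have hVt : ((realRep X * (realRep X)ᵀ)⁻¹)ᵀ = (realRep X * (realRep X)ᵀ)⁻¹ := by
    rw [Matrix.transpose_nonsing_inv, Matrix.transpose_mul, Matrix.transpose_transpose]
  have hBt := gramPert_transpose X g θ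
  have hVtr := trace_realRep_gram_inv hX
  have hProj := realRep_zfProj hX
  have hPow := realRep_zfPow hX
  have hBdef : gramPert X g θ = realRep X * iqPert g θ * (realRep X)ᵀ := rfl
  set V := (realRep X * (realRep X)ᵀ)⁻¹
  set S := (realRep X * (realRep X)ᵀ + gramPert X g θ)⁻¹
  set B := gramPert X g θ
  set z := (zfTrace X).re with hz
  have hz0 : 0 ≤ z := (zfTrace_re_nonneg X).2
  set ρ := ∑ n, (g n ^ 2 + θ n ^ 2) with hρ
  set L := ∑ n, (|g n| + |θ n|) with hL
  have hL0 : 0 ≤ L := Finset.sum_nonneg fun n _ => by positivity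
  have hLρ : L ^ 2 ≤ 2 * N * ρ := sq_sum_abs_le g θ
  have h1 : (V * B * V).trace = 2 * ∑ n, g n ^ 2 * (zfPow X n n).re := by
    rw [← trace_iqPert_mul_realRep g θ, ← hPow, hBdef]
    rw [show V * (realRep X * iqPert g θ * (realRep X)ᵀ) * V =
      (V * realRep X) * (iqPert g θ * ((realRep X)ᵀ * V)) by simp only [Matrix.mul_assoc],
      Matrix.trace_mul_comm]
    simp only [Matrix.mul_assoc]
  have h2 : ((B * V)ᵀ * V * (B * V)).trace =
      (iqPert g θ * realRep (zfProj X) * iqPert g θ * realRep (zfPow X)).trace := by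
    rw [← hProj, ← hPow, Matrix.transpose_mul, hBt, hVt, hBdef]
    rw [show V * (realRep X * iqPert g θ * (realRep X)ᵀ) * V *
        ((realRep X * iqPert g θ * (realRep X)ᵀ) * V) =
      (V * realRep X) * (iqPert g θ * ((realRep X)ᵀ * V * realRep X) * iqPert g θ *
        ((realRep X)ᵀ * V)) by simp only [Matrix.mul_assoc], Matrix.trace_mul_comm]
    simp only [Matrix.mul_assoc]
  -- This is exact: with `V` the unperturbed and `S` the perturbed inverse, `S = V - V B V + (B V)ᵀ
  -- S (B V)`, by symmetry of `B` and `V`.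
  have h3 : S.trace = 2 * z - 2 * ∑ n, g n ^ 2 * (zfPow X n n).re +
      ((B * V)ᵀ * S * (B * V)).trace := by
    rw [Matrix.transpose_mul, hBt, hVt, ← h1, ← hVtr, ← Matrix.trace_sub, ← Matrix.trace_add]
    congr 1
    conv_lhs => rw [hexp]
    simp only [Matrix.mul_assoc]
  have hp' : ∀ i j, |realRep (zfProj X) i j| ≤ 1 := abs_realRep_le (norm_zfProj_le X)
  have hq' : ∀ i j, |realRep (zfPow X) i j| ≤ z := abs_realRep_le (norm_zfPow_le X)
  have es : ∀ A : Matrix (Fin N ⊕ Fin N) (Fin N ⊕ Fin N) ℝ, 0 ≤ entrySum A := fun A =>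
    Finset.sum_nonneg fun i _ => Finset.sum_nonneg fun j _ => abs_nonneg _
  have e1 : entrySum (iqPert g θ) ≤ 6 * L := entrySum_iqPert_le (by linarith) hg
  have e2 : entrySum (iqLin g θ) ≤ 6 * L := entrySum_iqLin_le g θ
  have e3 : entrySum (iqPert g θ - iqLin g θ) ≤ 4 * δ * L :=
    entrySum_iqPert_sub_le (by linarith) hg hθ
  set Q := ((B * V)ᵀ * V * (B * V)).trace with hQ
  -- `72 = 6 * 6 * 2`: both factors `D` have entry sum at most `6 L`, and `L² ≤ 2 N ρ`.
  have hQb : Q ≤ 72 * N * ρ * z := by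
    refine (le_abs_self _).trans ?_
    rw [h2]
    refine (abs_trace_mul_four_le _ _ _ _ hp' hq').trans ?_
    calc entrySum (iqPert g θ) * entrySum (iqPert g θ) * (1 * z) ≤ 6 * L * (6 * L) * (1 * z) := by
          gcongr
          exact es _
      _ = 36 * L ^ 2 * z := by ring
      _ ≤ 36 * (2 * N * ρ) * z := by gcongr
      _ = _ := by ring
  have hQlin : |Q - 2 * (∑ n, ∑ m, mismatch (g n) (θ n) * starRingEnd ℂ (mismatch (g m) (θ m)) *
          (zfPow X m n * zfProj X m n)).re| ≤ 96 * N * δ * ρ * z := by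
    rw [← trace_iqLin_mul, h2, ← Matrix.trace_sub]
    have : iqPert g θ * realRep (zfProj X) * iqPert g θ * realRep (zfPow X) -
        iqLin g θ * realRep (zfProj X) * iqLin g θ * realRep (zfPow X) =
        (iqPert g θ - iqLin g θ) * realRep (zfProj X) * iqPert g θ * realRep (zfPow X) +
        iqLin g θ * realRep (zfProj X) * (iqPert g θ - iqLin g θ) * realRep (zfPow X) := by
      simp only [Matrix.sub_mul, Matrix.mul_sub]
      abel
    rw [this, Matrix.trace_add]
    refine (abs_add_le _ _).trans ((add_le_add (abs_trace_mul_four_le _ _ _ _ hp' hq')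
      (abs_trace_mul_four_le _ _ _ _ hp' hq')).trans ?_)
    calc entrySum (iqPert g θ - iqLin g θ) * entrySum (iqPert g θ) * (1 * z) +
          entrySum (iqLin g θ) * entrySum (iqPert g θ - iqLin g θ) * (1 * z) ≤
          4 * δ * L * (6 * L) * (1 * z) + 6 * L * (4 * δ * L) * (1 * z) := by
          gcongr
          · exact es _
          · exact es _
      _ = 48 * δ * L ^ 2 * z := by ring
      _ ≤ 48 * δ * (2 * N * ρ) * z := by gcongr
      _ = _ := by ring
  have hQ0 : 0 ≤ Q := by
    rw [hQ, trace_transpose_mul_mul]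
    exact Finset.sum_nonneg fun i _ => by
      have := hW.inv.posSemidef.dotProduct_mulVec_nonneg ((B * V).col i)
      simpa using this
  have hR1 : (1 - 4 * δ) * ((B * V)ᵀ * S * (B * V)).trace ≤ Q := by
    rw [hQ, trace_transpose_mul_mul, trace_transpose_mul_mul, Finset.mul_sum]
    exact Finset.sum_le_sum fun i _ => hupp _
  have hR2 : (1 + 4 * δ)⁻¹ * Q ≤ ((B * V)ᵀ * S * (B * V)).trace := by
    rw [hQ, trace_transpose_mul_mul, trace_transpose_mul_mul, Finset.mul_sum]
    exact Finset.sum_le_sum fun i _ => hlow _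
  -- Replacing `S` by `V` in the middle: `R` lies between `Q / (1 + 4δ)` and `Q / (1 - 4δ)`, and `4δ
  -- ≤ 1/2` gives `R ≤ 2 Q`.
  have hR3 : |((B * V)ᵀ * S * (B * V)).trace - Q| ≤ 8 * δ * Q := by
    rw [inv_mul_le_iff₀ (by positivity)] at hR2
    set R := ((B * V)ᵀ * S * (B * V)).trace
    have hR0 : 0 ≤ R := by nlinarith
    have hR4 : R ≤ 2 * Q := by nlinarith
    rw [abs_le]
    constructor <;> nlinarith
  have hR5 : 8 * δ * Q ≤ 576 * N * δ * ρ * z := by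
    calc 8 * δ * Q ≤ 8 * δ * (72 * N * ρ * z) := by gcongr
      _ = _ := by ring
  rw [h3]
  set Y := 2 * (∑ n, ∑ m, mismatch (g n) (θ n) * starRingEnd ℂ (mismatch (g m) (θ m)) *
          (zfPow X m n * zfProj X m n)).re
  set R := ((B * V)ᵀ * S * (B * V)).trace
  rw [show 2 * z - 2 * ∑ n, g n ^ 2 * (zfPow X n n).re + R -
    (2 * z - 2 * ∑ n, g n ^ 2 * (zfPow X n n).re + Y) = (R - Q) + (Q - Y) by ring]
  -- `672 = 576 + 96`: the cost of replacing `S` by `V`, plus that of replacing `D` by its linear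
  -- part.
  refine (abs_add_le _ _).trans ?_
  linarith

end TraceExpansion
end WLZF

namespace WLZF
open Matrix
open scoped ENNReal NNReal ComplexOrder

/-! ### Expectations in the random model -/

section Model

variable {Ω : Type u} [MeasurableSpace Ω] {P : Measure Ω} {K N : ℕ}
  {H : Ω → Matrix (Fin K) (Fin N) ℂ} {g θ : Fin N → Ω → ℝ} {σg σθ : ℝ}

lemma IsIIDCentered.integral_sq {X : Fin N → Ω → ℝ} {σ : ℝ} (h : IsIIDCentered P X σ) (n : Fin N) :
    Integrable (fun ω => X n ω ^ 2) P ∧ ∫ ω, X n ω ^ 2 ∂P = σ ^ 2 := by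
  refine ⟨(h.memLp n).integrable_sq, ?_⟩
  rw [← h.var n, variance_of_integral_eq_zero (h.memLp n).aestronglyMeasurable.aemeasurable
    (h.mean n)]

/-- The mismatches of all antennas. -/
def mismatches (g θ : Fin N → Ω → ℝ) (ω : Ω) : Fin N → ℝ × ℝ := fun n => (g n ω, θ n ω)

lemma IsModel.aemeasurable_mismatches (hM : IsModel P H g θ σg σθ) :
    AEMeasurable (mismatches g θ) P :=
  aemeasurable_pi_lambda _ fun n => (hM.gain.memLp n).aestronglyMeasurable.aemeasurable.prodMk
    (hM.phase.memLp n).aestronglyMeasurable.aemeasurable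

lemma IsModel.indepFun {β γ : Type*} [MeasurableSpace β] [MeasurableSpace γ]
    (hM : IsModel P H g θ σg σθ) {F : Matrix (Fin K) (Fin N) ℂ → β} {G : (Fin N → ℝ × ℝ) → γ}
    (hF : Measurable fun z => F (chan z)) (hG : Measurable G) :
    IndepFun (fun ω => F (H ω)) (fun ω => G (mismatches g θ ω)) P := by
  have h := hM.indep.comp (φ := fun X => F (chan (coords X))) (ψ := G)
    (hF.comp measurable_coords) hG
  simp only [Function.comp_def, chan_coords] at h
  exact h

lemma IsModel.integral_mul {𝕜 : Type*} [RCLike 𝕜] (hM : IsModel P H g θ σg σθ)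
    {F : Matrix (Fin K) (Fin N) ℂ → 𝕜} {G : (Fin N → ℝ × ℝ) → 𝕜}
    (hF : Measurable fun z => F (chan z)) (hFi : Integrable (fun z => F (chan z)) (chanLaw K N))
    (hG : Measurable G) (hGi : Integrable (fun ω => G (mismatches g θ ω)) P) :
    Integrable (fun ω => F (H ω) * G (mismatches g θ ω)) P ∧
      ∫ ω, F (H ω) * G (mismatches g θ ω) ∂P =
        (∫ z, F (chan z) ∂(chanLaw K N)) * ∫ ω, G (mismatches g θ ω) ∂P := by
  have hi := hM.indepFun hF hG
  have hFi' := hM.channel.integrable_comp hFi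
  refine ⟨hi.integrable_mul hFi' hGi, ?_⟩
  rw [hi.integral_fun_mul_eq_mul_integral hFi'.aestronglyMeasurable hGi.aestronglyMeasurable,
    hM.channel.integral_comp hFi.aestronglyMeasurable]

/-- The indicator of all mismatches being at most `δ`. -/
noncomputable def smallInd (δ : ℝ) (m : Fin N → ℝ × ℝ) : ℝ :=
  Set.indicator {m : Fin N → ℝ × ℝ | ∀ n, |(m n).1| ≤ δ ∧ |(m n).2| ≤ δ} (fun _ => 1) m

lemma measurableSet_small (δ : ℝ) :
    MeasurableSet {m : Fin N → ℝ × ℝ | ∀ n, |(m n).1| ≤ δ ∧ |(m n).2| ≤ δ} := by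
  have e : {m : Fin N → ℝ × ℝ | ∀ n, |(m n).1| ≤ δ ∧ |(m n).2| ≤ δ} =
      ⋂ n, {m : Fin N → ℝ × ℝ | |(m n).1| ≤ δ ∧ |(m n).2| ≤ δ} := by ext; simp
  rw [e]
  refine MeasurableSet.iInter fun n => MeasurableSet.inter ?_ ?_
  · exact measurableSet_le (f := fun m : Fin N → ℝ × ℝ => |(m n).1|) (by fun_prop)
      measurable_const
  · exact measurableSet_le (f := fun m : Fin N → ℝ × ℝ => |(m n).2|) (by fun_prop)
      measurable_const

lemma measurable_smallInd (δ : ℝ) : Measurable (smallInd (N := N) δ) :=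
  measurable_const.indicator (measurableSet_small δ)

lemma smallInd_mem (δ : ℝ) (m : Fin N → ℝ × ℝ) : 0 ≤ smallInd δ m ∧ smallInd δ m ≤ 1 := by
  unfold smallInd Set.indicator
  split_ifs <;> norm_num

/-- The cutoff becomes a multiplicative function of the mismatches alone, so independence from the
channel remains available. The mismatches are only a.e. measurable, hence the null-measurable
version of the indicator formula. -/
lemma setIntegral_large (hM : IsModel P H g θ σg σθ) (δ : ℝ) (f : Ω → ℝ) :
    ∫ ω in {ω | ∃ n, δ < max |g n ω| |θ n ω|}, f ω ∂P =
      ∫ ω, (1 - smallInd δ (mismatches g θ ω)) * f ω ∂P := by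
  obtain ⟨S, hS⟩ : ∃ S : Set (Fin N → ℝ × ℝ), S = {m | ∀ n, |(m n).1| ≤ δ ∧ |(m n).2| ≤ δ} :=
    ⟨_, rfl⟩
  have e : {ω | ∃ n, δ < max |g n ω| |θ n ω|} = mismatches g θ ⁻¹' Sᶜ := by
    ext ω
    simp only [hS, Set.mem_ofPred_eq, Set.preimage_compl, Set.mem_compl_iff, Set.mem_preimage,
      mismatches, not_forall, not_and_or, not_le, lt_max_iff]
  rw [e, ← integral_indicator₀ (hM.aemeasurable_mismatches.nullMeasurableSet_preimage
    (hS ▸ measurableSet_small δ).compl)]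
  refine integral_congr_ae (ae_of_all _ fun ω => ?_)
  simp only [smallInd, ← hS]
  by_cases h : mismatches g θ ω ∈ S
  · rw [Set.indicator_of_mem h, Set.indicator_of_notMem (show ω ∉ mismatches g θ ⁻¹' Sᶜ from
      fun h2 => h2 h)]
    simp
  · rw [Set.indicator_of_notMem h,
      Set.indicator_of_mem (show ω ∈ mismatches g θ ⁻¹' Sᶜ from h)]
    simp

/-- The sum of the squared mismatches. -/
def mismatchSq (m : Fin N → ℝ × ℝ) : ℝ := ∑ n, ((m n).1 ^ 2 + (m n).2 ^ 2)

lemma measurable_mismatchSq : Measurable (mismatchSq (N := N)) := by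
  unfold mismatchSq; fun_prop

lemma mismatchSq_nonneg (m : Fin N → ℝ × ℝ) : 0 ≤ mismatchSq m :=
  Finset.sum_nonneg fun n _ => by positivity

lemma IsModel.integral_mismatchSq (hM : IsModel P H g θ σg σθ) :
    Integrable (fun ω => mismatchSq (mismatches g θ ω)) P ∧
      ∫ ω, mismatchSq (mismatches g θ ω) ∂P = N * (σθ ^ 2 + σg ^ 2) := by
  have h : ∀ n, Integrable (fun ω => g n ω ^ 2 + θ n ω ^ 2) P := fun n =>
    (hM.gain.integral_sq n).1.add (hM.phase.integral_sq n).1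
  refine ⟨integrable_finsetSum _ fun n _ => h n, ?_⟩
  simp only [mismatchSq, mismatches]
  rw [integral_finsetSum _ fun n _ => h n]
  simp only [integral_add (hM.gain.integral_sq _).1 (hM.phase.integral_sq _).1,
    (hM.gain.integral_sq _).2, (hM.phase.integral_sq _).2]
  simp
  ring

lemma IsModel.integrable_smallInd_mul {E : Type*} [NormedAddCommGroup E] [NormedSpace ℝ E]
    (hM : IsModel P H g θ σg σθ) (δ : ℝ) {f : Ω → E} (hf : Integrable f P) :
    Integrable (fun ω => smallInd δ (mismatches g θ ω) • f ω) P := by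
  refine hf.bdd_smul 1 ((measurable_smallInd δ).comp_aemeasurable
    hM.aemeasurable_mismatches).aestronglyMeasurable (ae_of_all _ fun ω => ?_)
  rw [Real.norm_of_nonneg (smallInd_mem _ _).1]
  exact (smallInd_mem _ _).2

/-- The expansion of the trace, with all mismatches truncated at `δ`. -/
noncomputable def truncExpansion (δ : ℝ) (X : Matrix (Fin K) (Fin N) ℂ)
    (m : Fin N → ℝ × ℝ) : ℝ :=
  smallInd δ m * (2 * (zfTrace X).re - 2 * ∑ n, (m n).1 ^ 2 * (zfPow X n n).re +
        2 * (∑ n, ∑ k, mismatch (m n).1 (m n).2 * starRingEnd ℂ (mismatch (m k).1 (m k).2) *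
          (zfPow X k n * zfProj X k n)).re)

lemma mismatch_mul_conj (a b : ℝ) :
    mismatch a b * starRingEnd ℂ (mismatch a b) = ((4 * a ^ 2 + b ^ 2 : ℝ) : ℂ) := by
  rw [Complex.mul_conj]
  congr 1
  simp [mismatch, Complex.normSq_apply]
  ring

lemma norm_mismatch_sq (a b : ℝ) : ‖mismatch a b‖ ^ 2 = 4 * a ^ 2 + b ^ 2 := by
  rw [Complex.sq_norm]
  simp [mismatch, Complex.normSq_apply]
  ring

lemma measurable_mismatch (n : Fin N) :
    Measurable fun m : Fin N → ℝ × ℝ => mismatch (m n).1 (m n).2 := by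
  have h : Continuous fun x : ℝ × ℝ => mismatch x.1 x.2 := by unfold mismatch; fun_prop
  exact h.measurable.comp (measurable_pi_apply n)

lemma norm_mismatch_mul_le (m : Fin N → ℝ × ℝ) (n k : Fin N) :
    ‖mismatch (m n).1 (m n).2 * starRingEnd ℂ (mismatch (m k).1 (m k).2)‖ ≤
      4 * mismatchSq m := by
  rw [norm_mul, RCLike.norm_conj]
  have h : ∀ n, ‖mismatch (m n).1 (m n).2‖ ^ 2 ≤ 4 * mismatchSq m := by
    intro n
    rw [norm_mismatch_sq]
    have := Finset.single_le_sum (f := fun n => (m n).1 ^ 2 + (m n).2 ^ 2)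
      (fun j _ => by positivity) (Finset.mem_univ n)
    change _ ≤ mismatchSq m at this
    nlinarith [sq_nonneg (m n).1, sq_nonneg (m n).2]
  nlinarith [h n, h k, sq_nonneg (‖mismatch (m n).1 (m n).2‖ - ‖mismatch (m k).1 (m k).2‖)]

/-- By independence each term factors into a channel moment and a truncated moment of the
mismatches. The terms coupling antennas `n ≠ k` carry `E[q_kn p_kn] = 0`, so only the squared moduli
`4 g² + θ²` remain. -/
lemma IsModel.integral_truncExpansion (hM : IsModel P H g θ σg σθ) (hK : 0 < K) (hKN : K < N)
    (δ : ℝ) :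
    Integrable (fun ω => truncExpansion δ (H ω) (mismatches g θ ω)) P ∧
    ∫ ω, truncExpansion δ (H ω) (mismatches g θ ω) ∂P =
      2 * ((K : ℝ) / (N - K)) * ∫ ω, smallInd δ (mismatches g θ ω) ∂P -
      2 * ∑ n, (∫ z, zfPow (chan (K := K) z) n n ∂(chanLaw K N)).re *
        ∫ ω, smallInd δ (mismatches g θ ω) * g n ω ^ 2 ∂P +
      2 * ∑ n, (mixedMoment K N n n n n).re *
        ∫ ω, smallInd δ (mismatches g θ ω) * (4 * g n ω ^ 2 + θ n ω ^ 2) ∂P := by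
  have := hM.channel.isProbabilityMeasure
  have hs : ∀ f : Ω → ℝ, Integrable f P →
      Integrable (fun ω => smallInd δ (mismatches g θ ω) * f ω) P := fun f hf =>
    hM.integrable_smallInd_mul δ hf
  have hs1 : Integrable (fun ω => smallInd δ (mismatches g θ ω)) P := by
    simpa using hs (fun _ => 1) (integrable_const _)
  have p1 := hM.integral_mul (F := fun X => (zfTrace X).re) (G := smallInd δ)
    (Complex.measurable_re.comp measurable_zfTrace) (integrable_zfTrace_re hK hKN)
    (measurable_smallInd δ) hs1
  have p2 : ∀ n, Integrable (fun ω => (zfPow (H ω) n n).re *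
      (smallInd δ (mismatches g θ ω) * g n ω ^ 2)) P ∧ ∫ ω, (zfPow (H ω) n n).re *
      (smallInd δ (mismatches g θ ω) * g n ω ^ 2) ∂P =
      (∫ z, zfPow (chan (K := K) z) n n ∂(chanLaw K N)).re *
        ∫ ω, smallInd δ (mismatches g θ ω) * g n ω ^ 2 ∂P := by
    intro n
    have h := hM.integral_mul (F := fun X => (zfPow X n n).re)
      (G := fun m => smallInd δ m * (m n).1 ^ 2)
      (Complex.measurable_re.comp (measurable_zfPow n n)) (integrable_zfPow hK hKN n n).re
      ((measurable_smallInd δ).mul (by fun_prop)) (hs _ (hM.gain.integral_sq n).1)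
    have e : ∫ z, (zfPow (chan (K := K) z) n n).re ∂(chanLaw K N) =
        (∫ z, zfPow (chan (K := K) z) n n ∂(chanLaw K N)).re :=
      integral_re (integrable_zfPow hK hKN n n)
    rw [e] at h
    exact h
  have hc : ∀ n k, Integrable (fun ω => (smallInd δ (mismatches g θ ω) : ℂ) *
      (mismatch (g n ω) (θ n ω) * starRingEnd ℂ (mismatch (g k ω) (θ k ω)))) P := by
    intro n k
    have hm := ((Complex.measurable_ofReal.comp (measurable_smallInd (N := N) δ)).mul
      ((measurable_mismatch n).mul (Complex.continuous_conj.measurable.comp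
        (measurable_mismatch k)))).comp_aemeasurable hM.aemeasurable_mismatches
    refine (hM.integral_mismatchSq.1.const_mul 4).mono hm.aestronglyMeasurable
      (ae_of_all _ fun ω => ?_)
    rw [norm_mul, Complex.norm_real, Real.norm_of_nonneg (smallInd_mem _ _).1,
      Real.norm_of_nonneg (mul_nonneg (by norm_num) (mismatchSq_nonneg _))]
    have h1 := norm_mismatch_mul_le (mismatches g θ ω) n k
    calc _ ≤ 1 * ‖mismatch (g n ω) (θ n ω) * starRingEnd ℂ (mismatch (g k ω) (θ k ω))‖ :=
          mul_le_mul_of_nonneg_right (smallInd_mem _ _).2 (norm_nonneg _)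
      _ ≤ _ := by rw [one_mul]; exact h1
  have p3 : ∀ n k, Integrable (fun ω => (zfPow (H ω) k n * zfProj (H ω) k n) *
      ((smallInd δ (mismatches g θ ω) : ℂ) *
      (mismatch (g n ω) (θ n ω) * starRingEnd ℂ (mismatch (g k ω) (θ k ω))))) P ∧
      ∫ ω, (zfPow (H ω) k n * zfProj (H ω) k n) * ((smallInd δ (mismatches g θ ω) : ℂ) *
      (mismatch (g n ω) (θ n ω) * starRingEnd ℂ (mismatch (g k ω) (θ k ω)))) ∂P =
      mixedMoment K N k n k n * ∫ ω, (smallInd δ (mismatches g θ ω) : ℂ) *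
      (mismatch (g n ω) (θ n ω) * starRingEnd ℂ (mismatch (g k ω) (θ k ω))) ∂P := by
    intro n k
    exact hM.integral_mul (F := fun X => zfPow X k n * zfProj X k n)
      (G := fun m => (smallInd δ m : ℂ) *
        (mismatch (m n).1 (m n).2 * starRingEnd ℂ (mismatch (m k).1 (m k).2)))
      ((measurable_zfPow k n).mul (measurable_zfProj k n))
      (integrable_zfPow_mul_zfProj hK hKN k n k n)
      ((Complex.measurable_ofReal.comp (measurable_smallInd (N := N) δ)).mul
      ((measurable_mismatch n).mul (Complex.continuous_conj.measurable.comp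
        (measurable_mismatch k)))) (hc n k)
  have e : ∀ ω, truncExpansion δ (H ω) (mismatches g θ ω) =
      2 * ((zfTrace (H ω)).re * smallInd δ (mismatches g θ ω)) -
      2 * ∑ n, (zfPow (H ω) n n).re * (smallInd δ (mismatches g θ ω) * g n ω ^ 2) +
      2 * (∑ n, ∑ k, (zfPow (H ω) k n * zfProj (H ω) k n) *
        ((smallInd δ (mismatches g θ ω) : ℂ) *
        (mismatch (g n ω) (θ n ω) * starRingEnd ℂ (mismatch (g k ω) (θ k ω))))).re := by
    intro ω
    have e1 : (∑ n, ∑ k, (zfPow (H ω) k n * zfProj (H ω) k n) *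
        ((smallInd δ (mismatches g θ ω) : ℂ) *
        (mismatch (g n ω) (θ n ω) * starRingEnd ℂ (mismatch (g k ω) (θ k ω))))).re =
        smallInd δ (mismatches g θ ω) * (∑ n, ∑ k, mismatch (g n ω) (θ n ω) *
          starRingEnd ℂ (mismatch (g k ω) (θ k ω)) *
          (zfPow (H ω) k n * zfProj (H ω) k n)).re := by
      rw [← Complex.re_ofReal_mul, Finset.mul_sum]
      congr 1
      refine Finset.sum_congr rfl fun n _ => ?_
      rw [Finset.mul_sum]
      exact Finset.sum_congr rfl fun k _ => by ring
    have e2 : ∑ n, (zfPow (H ω) n n).re * (smallInd δ (mismatches g θ ω) * g n ω ^ 2) =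
        smallInd δ (mismatches g θ ω) * ∑ n, g n ω ^ 2 * (zfPow (H ω) n n).re := by
      rw [Finset.mul_sum]
      exact Finset.sum_congr rfl fun n _ => by ring
    rw [e1, e2, truncExpansion]
    simp only [mismatches]
    ring
  have i1 := p1.1.const_mul 2
  have i2 := (integrable_finsetSum Finset.univ fun n _ => (p2 n).1).const_mul 2
  have i3' := integrable_finsetSum Finset.univ fun n _ =>
    integrable_finsetSum Finset.univ fun k _ => (p3 n k).1
  have i3 : Integrable (fun ω => 2 * (∑ n, ∑ k, (zfPow (H ω) k n * zfProj (H ω) k n) *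
        ((smallInd δ (mismatches g θ ω) : ℂ) *
        (mismatch (g n ω) (θ n ω) * starRingEnd ℂ (mismatch (g k ω) (θ k ω))))).re) P :=
    i3'.re.const_mul 2
  have hre : ∫ ω, (∑ n, ∑ k, (zfPow (H ω) k n * zfProj (H ω) k n) *
        ((smallInd δ (mismatches g θ ω) : ℂ) *
        (mismatch (g n ω) (θ n ω) * starRingEnd ℂ (mismatch (g k ω) (θ k ω))))).re ∂P =
      (∫ ω, ∑ n, ∑ k, (zfPow (H ω) k n * zfProj (H ω) k n) *
        ((smallInd δ (mismatches g θ ω) : ℂ) *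
        (mismatch (g n ω) (θ n ω) * starRingEnd ℂ (mismatch (g k ω) (θ k ω)))) ∂P).re :=
    integral_re i3'
  simp only [e]
  have i12 : Integrable (fun ω => 2 * ((zfTrace (H ω)).re * smallInd δ (mismatches g θ ω)) -
      2 * ∑ n, (zfPow (H ω) n n).re * (smallInd δ (mismatches g θ ω) * g n ω ^ 2)) P := i1.sub i2
  refine ⟨i12.add i3, ?_⟩
  rw [integral_add i12 i3, integral_sub i1 i2, integral_const_mul, integral_const_mul,
    integral_const_mul, hre, p1.2, integral_finsetSum _ fun n _ => (p2 n).1,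
    integral_finsetSum _ fun n _ => integrable_finsetSum Finset.univ fun k _ => (p3 n k).1,
    integral_zfTrace_re hK hKN, mul_assoc]
  simp only [(p2 _).2]
  congr 2
  rw [Complex.re_sum]
  refine Finset.sum_congr rfl fun n _ => ?_
  rw [integral_finsetSum _ fun k _ => (p3 n k).1, Finset.sum_eq_single n]
  · rw [(p3 n n).2]
    simp only [mismatch_mul_conj, ← Complex.ofReal_mul]
    rw [integral_complex_ofReal, Complex.re_mul_ofReal]
  · intro k _ hk
    rw [(p3 n k).2, mixedMoment_same_eq_zero hk, zero_mul]
  · simp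

end Model
end WLZF

namespace WLZF
open Matrix
open scoped ENNReal NNReal ComplexOrder

/-! ### The expected trace in the random model -/

section ExpectedTrace

variable {Ω : Type u} [MeasurableSpace Ω] {P : Measure Ω} {K N : ℕ}
  {H : Ω → Matrix (Fin K) (Fin N) ℂ} {g θ : Fin N → Ω → ℝ} {σg σθ δ : ℝ}

lemma sum_re_integral_zfPow (hK : 0 < K) (hKN : K < N) :
    ∑ n, (∫ z, zfPow (chan (K := K) (N := N) z) n n ∂(chanLaw K N)).re = (K : ℝ) / (N - K) := by
  rw [← Complex.re_sum, ← integral_finsetSum _ fun n _ => integrable_zfPow hK hKN n n]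
  have e : ∀ z : ChanIdx K N → ℝ, ∑ n, zfPow (chan z) n n = zfTrace (chan z) := fun z => by
    rw [← trace_zfPow]; rfl
  simp only [e]
  rw [integral_zfTrace hK hKN, show (K : ℂ) / (N - K) = (((K : ℝ) / (N - K) : ℝ) : ℂ) by
        push_cast; rfl, Complex.ofReal_re]

lemma abs_re_integral_zfPow_le (hK : 0 < K) (hKN : K < N) (n : Fin N) :
    |(∫ z, zfPow (chan (K := K) (N := N) z) n n ∂(chanLaw K N)).re| ≤ (K : ℝ) / (N - K) := by
  rw [← integral_zfTrace_re hK hKN]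
  exact (Complex.abs_re_le_norm _).trans (norm_integral_le_of_norm_le
    (integrable_zfTrace_re hK hKN) (ae_of_all _ fun z => norm_zfPow_le _ n n))

lemma abs_re_mixedMoment_le (hK : 0 < K) (hKN : K < N) (n : Fin N) :
    |(mixedMoment K N n n n n).re| ≤ (K : ℝ) / (N - K) := by
  rw [← integral_zfTrace_re hK hKN]
  refine (Complex.abs_re_le_norm _).trans (norm_integral_le_of_norm_le
    (integrable_zfTrace_re hK hKN) (ae_of_all _ fun z => ?_))
  rw [norm_mul]
  exact (mul_le_mul (norm_zfPow_le _ n n) (norm_zfProj_le _ n n) (norm_nonneg _)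
    (zfTrace_re_nonneg _).2).trans_eq (mul_one _)

lemma sum_re_mixedMoment (hK : 0 < K) (hKN : K < N) :
    ∑ n, (mixedMoment K N n n n n).re =
      (K : ℝ) / (N - K) * (((K : ℝ) + 1) / ((N : ℝ) + 1)) := by
  rw [← Complex.re_sum, sum_mixedMoment_diag hK hKN]
  have : ((K : ℂ) ^ 2 + K) / (((N : ℂ) - K) * ((N : ℂ) + 1)) =
      (((K : ℝ) / (N - K) * (((K : ℝ) + 1) / ((N : ℝ) + 1)) : ℝ) : ℂ) := by
    push_cast
    rw [div_mul_div_comm]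
    ring
  rw [this, Complex.ofReal_re]

lemma IsModel.integral_large_mul (hM : IsModel P H g θ σg σθ) (δ : ℝ) {f : Ω → ℝ}
    (hf : Integrable f P) :
    Integrable (fun ω => smallInd δ (mismatches g θ ω) * f ω) P ∧
    Integrable (fun ω => (1 - smallInd δ (mismatches g θ ω)) * f ω) P ∧
      ∫ ω, (1 - smallInd δ (mismatches g θ ω)) * f ω ∂P =
      ∫ ω, f ω ∂P - ∫ ω, smallInd δ (mismatches g θ ω) * f ω ∂P := by
  have h1 : Integrable (fun ω => smallInd δ (mismatches g θ ω) * f ω) P :=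
    hM.integrable_smallInd_mul δ hf
  simp only [sub_mul, one_mul]
  exact ⟨h1, hf.sub h1, integral_sub hf h1⟩

/-- The expected truncated expansion, up to the contribution of large mismatches. -/
lemma IsModel.abs_integral_truncExpansion_sub_le (hM : IsModel P H g θ σg σθ) (hK : 0 < K)
    (hKN : K < N) (δ : ℝ) :
    |∫ ω, truncExpansion δ (H ω) (mismatches g θ ω) ∂P - 2 * ((K : ℝ) / (N - K)) *
      (1 - σg ^ 2 + (σθ ^ 2 + 4 * σg ^ 2) * (((K : ℝ) + 1) / ((N : ℝ) + 1)))| ≤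
    10 * ((K : ℝ) / (N - K)) * ∫ ω, (1 - smallInd δ (mismatches g θ ω)) *
      (1 + mismatchSq (mismatches g θ ω)) ∂P := by
  have := hM.channel.isProbabilityMeasure
  have hKN' : (0 : ℝ) < N - K := by rw [sub_pos]; exact_mod_cast hKN
  have ht : 0 ≤ (K : ℝ) / (N - K) := by positivity
  set t := (K : ℝ) / (N - K) with ht_def
  set r := ((K : ℝ) + 1) / ((N : ℝ) + 1) with hr
  have hg2 := fun n => hM.gain.integral_sq n
  have hc2 : ∀ n, Integrable (fun ω => 4 * g n ω ^ 2 + θ n ω ^ 2) P ∧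
      ∫ ω, (4 * g n ω ^ 2 + θ n ω ^ 2) ∂P = 4 * σg ^ 2 + σθ ^ 2 := fun n => by
    refine ⟨((hg2 n).1.const_mul 4).add (hM.phase.integral_sq n).1, ?_⟩
    rw [integral_add ((hg2 n).1.const_mul 4) (hM.phase.integral_sq n).1, integral_const_mul,
      (hg2 n).2, (hM.phase.integral_sq n).2]
  have l0 := hM.integral_large_mul δ (integrable_const (μ := P) (1 : ℝ))
  have l1 := fun n => hM.integral_large_mul δ (hg2 n).1
  have l2 := fun n => hM.integral_large_mul δ (hc2 n).1
  have l3 := hM.integral_large_mul δ hM.integral_mismatchSq.1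
  have hb : ∀ ω, 0 ≤ 1 - smallInd δ (mismatches g θ ω) := fun ω =>
    sub_nonneg.2 (smallInd_mem _ _).2
  set b := ∫ ω, (1 - smallInd δ (mismatches g θ ω)) * 1 ∂P with hb_def
  set e := fun n => ∫ ω, (1 - smallInd δ (mismatches g θ ω)) * g n ω ^ 2 ∂P with he
  set f := fun n => ∫ ω, (1 - smallInd δ (mismatches g θ ω)) * (4 * g n ω ^ 2 + θ n ω ^ 2) ∂P
    with hf
  set B := ∫ ω, (1 - smallInd δ (mismatches g θ ω)) * mismatchSq (mismatches g θ ω) ∂P with hB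
  have hbB : ∫ ω, (1 - smallInd δ (mismatches g θ ω)) *
      (1 + mismatchSq (mismatches g θ ω)) ∂P = b + B := by
    rw [hb_def, hB, ← integral_add l0.2.1 l3.2.1]
    simp only [mul_add]
  have hb0 : 0 ≤ b := integral_nonneg fun ω => by simpa using hb ω
  have he0 : ∀ n, 0 ≤ e n := fun n => integral_nonneg fun ω => mul_nonneg (hb ω) (sq_nonneg _)
  have hf0 : ∀ n, 0 ≤ f n := fun n => integral_nonneg fun ω => mul_nonneg (hb ω) (by positivity)
  have hesum : ∑ n, e n ≤ B := by
    rw [he, hB, ← integral_finsetSum _ fun n _ => (l1 n).2.1]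
    refine integral_mono (integrable_finsetSum _ fun n _ => (l1 n).2.1) l3.2.1 fun ω => ?_
    simp only [← Finset.mul_sum]
    refine mul_le_mul_of_nonneg_left (Finset.sum_le_sum fun n _ => ?_) (hb ω)
    simp only [mismatches]
    linarith [sq_nonneg (θ n ω)]
  have hfsum : ∑ n, f n ≤ 4 * B := by
    rw [hf, hB, ← integral_finsetSum _ fun n _ => (l2 n).2.1, ← integral_const_mul]
    refine integral_mono (integrable_finsetSum _ fun n _ => (l2 n).2.1) (l3.2.1.const_mul 4)
      fun ω => ?_
    rw [mul_left_comm, mismatchSq, Finset.mul_sum, Finset.mul_sum]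
    refine Finset.sum_le_sum fun n _ => mul_le_mul_of_nonneg_left ?_ (hb ω)
    simp only [mismatches]
    linarith [sq_nonneg (θ n ω)]
  have k0 : ∫ ω, smallInd δ (mismatches g θ ω) ∂P = 1 - b := by
    have h := l0.2.2
    simp only [mul_one, integral_const, probReal_univ, one_smul] at h
    linarith
  have k1 : ∀ n, ∫ ω, smallInd δ (mismatches g θ ω) * g n ω ^ 2 ∂P = σg ^ 2 - e n := fun n => by
    have h := (l1 n).2.2
    rw [(hg2 n).2] at h
    change e n = _ at h
    linarith
  have k2 : ∀ n, ∫ ω, smallInd δ (mismatches g θ ω) * (4 * g n ω ^ 2 + θ n ω ^ 2) ∂P =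
      4 * σg ^ 2 + σθ ^ 2 - f n := fun n => by
    have h := (l2 n).2.2
    rw [(hc2 n).2] at h
    change f n = _ at h
    linarith
  rw [(hM.integral_truncExpansion hK hKN δ).2, k0, hbB]
  simp only [k1, k2, mul_sub, Finset.sum_sub_distrib, ← Finset.sum_mul]
  rw [sum_re_integral_zfPow hK hKN, sum_re_mixedMoment hK hKN]
  -- The constant ten: with prefactor `2 t`, the tail is charged `b` from the constant term, `B`
  -- from the gains and `4 B` from `4 g² + θ²`.
  have hq : |∑ n, (∫ z, zfPow (chan (K := K) z) n n ∂(chanLaw K N)).re * e n| ≤ t * B := by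
    refine (Finset.abs_sum_le_sum_abs _ _).trans (le_trans (Finset.sum_le_sum fun n _ => ?_)
      ((Finset.mul_sum _ _ _).symm.trans_le (mul_le_mul_of_nonneg_left hesum ht)))
    rw [abs_mul, abs_of_nonneg (he0 n)]
    exact mul_le_mul_of_nonneg_right (abs_re_integral_zfPow_le hK hKN n) (he0 n)
  have hm : |∑ n, (mixedMoment K N n n n n).re * f n| ≤ t * (4 * B) := by
    refine (Finset.abs_sum_le_sum_abs _ _).trans (le_trans (Finset.sum_le_sum fun n _ => ?_)
      ((Finset.mul_sum _ _ _).symm.trans_le (mul_le_mul_of_nonneg_left hfsum ht)))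
    rw [abs_mul, abs_of_nonneg (hf0 n)]
    exact mul_le_mul_of_nonneg_right (abs_re_mixedMoment_le hK hKN n) (hf0 n)
  have hq' := abs_le.1 hq
  have hm' := abs_le.1 hm
  have htb : 0 ≤ t * b := mul_nonneg ht hb0
  rw [abs_le]
  constructor <;> nlinarith

/-- The trace, on the event that all mismatches are small, against its truncated expansion. -/
lemma abs_smallInd_mul_wlTrace_sub_le (hδ0 : 0 ≤ δ) (hδ : δ ≤ 1 / 8)
    {X : Matrix (Fin K) (Fin N) ℂ} (hX : IsUnit (X * Xᴴ).det) (σg : ℝ) (g θ : Fin N → ℝ) :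
    |smallInd δ (fun n => (g n, θ n)) * wlTrace X (fun n => iqCoeff₁ σg (g n) (θ n))
        (fun n => iqCoeff₂ σg (g n) (θ n)) -
      (1 + σg ^ 2) * truncExpansion δ X (fun n => (g n, θ n))| ≤
      (1 + σg ^ 2) * (672 * N * δ * (mismatchSq (fun n => (g n, θ n)) * (zfTrace X).re)) ∧
    smallInd δ (fun n => (g n, θ n)) * wlTrace X (fun n => iqCoeff₁ σg (g n) (θ n))
        (fun n => iqCoeff₂ σg (g n) (θ n)) ≤ (1 + σg ^ 2) * (4 * (zfTrace X).re) := by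
  have hz := (zfTrace_re_nonneg X).2
  have hρ := mismatchSq_nonneg (fun n => (g n, θ n))
  have hs : 0 ≤ 1 + σg ^ 2 := by positivity
  by_cases h : (fun n => (g n, θ n)) ∈
      {m : Fin N → ℝ × ℝ | ∀ n, |(m n).1| ≤ δ ∧ |(m n).2| ≤ δ}
  · have hi : smallInd δ (fun n => (g n, θ n)) = 1 := Set.indicator_of_mem h _
    have hg : ∀ n, |g n| ≤ δ := fun n => (h n).1
    have hθ : ∀ n, |θ n| ≤ δ := fun n => (h n).2
    rw [truncExpansion, hi, wlTrace_eq hδ hg hθ hX, one_mul, one_mul, ← mul_sub, abs_mul,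
      abs_of_nonneg hs]
    refine ⟨mul_le_mul_of_nonneg_left ?_ hs, mul_le_mul_of_nonneg_left
      (trace_inv_gram_add_pert_le hδ hg hθ hX) hs⟩
    refine (abs_trace_inv_sub_le hδ0 hδ hg hθ hX).trans_eq ?_
    simp only [mismatchSq]
    ring
  · have hi : smallInd δ (fun n => (g n, θ n)) = 0 := Set.indicator_of_notMem h _
    rw [truncExpansion, hi, zero_mul, zero_mul, mul_zero, sub_zero, abs_zero]
    constructor <;> positivity

/-- An upper bound of the Gram matrix gives a lower bound of the trace. -/
lemma le_wlTrace {X : Matrix (Fin K) (Fin N) ℂ} (hX : IsUnit (X * Xᴴ).det) (σg : ℝ)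
    (g θ : Fin N → ℝ)
    (hu : IsUnit (wlGram X (fun n => iqCoeff₁ σg (g n) (θ n))
      (fun n => iqCoeff₂ σg (g n) (θ n))).det) :
    2 * (zfTrace X).re ≤ 4 / (1 + σg ^ 2) * (1 + ∑ n, g n ^ 2) *
      wlTrace X (fun n => iqCoeff₁ σg (g n) (θ n)) (fun n => iqCoeff₂ σg (g n) (θ n)) := by
  have hS : 0 ≤ ∑ n, g n ^ 2 := Finset.sum_nonneg fun n _ => sq_nonneg _
  obtain ⟨l, hl⟩ : ∃ l, l = 4 / (1 + σg ^ 2) * (1 + ∑ n, g n ^ 2) := ⟨_, rfl⟩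
  have hl0 : 0 < l := by rw [hl]; positivity
  have hp := posDef_gram_of_isUnit hu
  have h := trace_inv_antitone (inv_pos.2 hl0) hp
    ((Matrix.isUnit_iff_isUnit_det _).1 (posDef_realRep_gram hX).isUnit) fun y => ?_
  · rw [trace_realRep_gram_inv hX, inv_mul_le_iff₀ hl0] at h
    rw [← hl]
    exact h
  · rw [inv_mul_le_iff₀ hl0, ← gramForm_eq_dotProduct, ← gramForm_eq_dotProduct]
    refine (gramForm_wlChannel_upper X σg g θ y).trans ?_
    rw [gramForm, hl, show 4 / (1 + σg ^ 2) * (1 + ∑ n, g n ^ 2) =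
      2 / (1 + σg ^ 2) * (2 * (1 + ∑ n, g n ^ 2)) by ring, mul_assoc (2 / (1 + σg ^ 2))]
    refine mul_le_mul_of_nonneg_left ?_ (by positivity)
    rw [Finset.mul_sum]
    refine Finset.sum_le_sum fun j _ => mul_le_mul_of_nonneg_right ?_ (sq_nonneg _)
    have hsq : ∀ n, g n ^ 2 ≤ ∑ n, g n ^ 2 := fun n =>
      Finset.single_le_sum (f := fun n => g n ^ 2) (fun k _ => sq_nonneg _) (Finset.mem_univ n)
    rcases j with n | n
    · change (1 + g n) ^ 2 ≤ _
      nlinarith [hsq n, sq_nonneg (1 - g n)]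
    · change (1 - g n) ^ 2 ≤ _
      nlinarith [hsq n, sq_nonneg (1 + g n)]

/-- Pointwise `T ≥ 2 Tr (H Hᴴ)⁻¹ / l` with `l = 4 (1 + ∑ g²)/(1 + σg²)`, whose mean is at most `a =
4 N`. The tangent bound `1/l ≥ 2/a - l/a²` is linear in `l`, so independence and second moments
suffice. The result does not depend on the law of the mismatches, as required for the logarithm. -/
lemma IsModel.le_integral_wlTrace (hM : IsModel P H g θ σg σθ) (hK : 0 < K) (hKN : K < N)
    (hW : WellDefined P H (diag₁ σg g θ) (diag₂ σg g θ)) :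
    2 * ((K : ℝ) / (N - K)) / (4 * N) ≤
      ∫ ω, wlTrace (H ω) (diag₁ σg g θ ω) (diag₂ σg g θ ω) ∂P := by
  have := hM.channel.isProbabilityMeasure
  have hN : (1 : ℝ) ≤ N := by exact_mod_cast (by omega : 1 ≤ N)
  have hKN' : (0 : ℝ) < N - K := by rw [sub_pos]; exact_mod_cast hKN
  have ht : 0 ≤ (K : ℝ) / (N - K) := by positivity
  have hg2 := fun n => hM.gain.integral_sq n
  have hGi : Integrable (fun ω => 1 + ∑ n, g n ω ^ 2) P :=
    (integrable_const _).add (integrable_finsetSum _ fun n _ => (hg2 n).1)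
  have hGv : ∫ ω, (1 + ∑ n, g n ω ^ 2) ∂P = 1 + N * σg ^ 2 := by
    rw [integral_add (integrable_const _) (integrable_finsetSum _ fun n _ => (hg2 n).1),
      integral_finsetSum _ fun n _ => (hg2 n).1]
    simp [(hg2 _).2]
  set a : ℝ := 4 * N with ha
  have ha0 : 0 < a := by positivity
  have p := hM.integral_mul (F := fun X => 2 * (zfTrace X).re)
    (G := fun m => 2 / a - 4 / (1 + σg ^ 2) * (1 + ∑ n, (m n).1 ^ 2) / a ^ 2)
    ((Complex.measurable_re.comp measurable_zfTrace).const_mul 2)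
    ((integrable_zfTrace_re hK hKN).const_mul 2) (by fun_prop)
    ((integrable_const _).sub ((hGi.const_mul _).div_const _))
  have hv : ∫ ω, (2 / a - 4 / (1 + σg ^ 2) * (1 + ∑ n, (mismatches g θ ω n).1 ^ 2) / a ^ 2) ∂P =
      2 / a - 4 / (1 + σg ^ 2) * (1 + N * σg ^ 2) / a ^ 2 := by
    simp only [mismatches]
    rw [integral_sub (integrable_const _) ((hGi.const_mul _).div_const _), integral_div,
      integral_div, integral_const_mul, ← hGv]
    simp
  rw [hv, integral_const_mul, integral_zfTrace_re hK hKN] at p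
  have h1 : 4 / (1 + σg ^ 2) * (1 + N * σg ^ 2) ≤ a := by
    rw [div_mul_eq_mul_div, div_le_iff₀ (by positivity), ha]
    nlinarith [sq_nonneg σg]
  have h2 : 1 / a ≤ 2 / a - 4 / (1 + σg ^ 2) * (1 + N * σg ^ 2) / a ^ 2 := by
    have : 4 / (1 + σg ^ 2) * (1 + N * σg ^ 2) / a ^ 2 ≤ a / a ^ 2 := by gcongr
    have e : a / a ^ 2 = 1 / a := by field_simp
    rw [e] at this
    have e2 : 2 / a = 1 / a + 1 / a := by ring
    linarith
  calc 2 * ((K : ℝ) / (N - K)) / a = 2 * ((K : ℝ) / (N - K)) * (1 / a) := by ring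
    _ ≤ 2 * ((K : ℝ) / (N - K)) * (2 / a - 4 / (1 + σg ^ 2) * (1 + N * σg ^ 2) / a ^ 2) := by
      gcongr
    _ = _ := p.2.symm
    _ ≤ _ := by
      refine integral_mono_ae p.1 hW.integrable ?_
      filter_upwards [hW.isUnit_det, hM.channel.ae_isUnit_det hK hKN] with ω hu hω
      have h3 := le_wlTrace hω σg (fun n => g n ω) (fun n => θ n ω) hu
      have hT : 0 < wlTrace (H ω) (diag₁ σg g θ ω) (diag₂ σg g θ ω) := wlTrace_pos hK hu
      have hS : 0 ≤ ∑ n, g n ω ^ 2 := Finset.sum_nonneg fun n _ => sq_nonneg _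
      change 2 * (zfTrace (H ω)).re ≤ _ * wlTrace (H ω) (diag₁ σg g θ ω) (diag₂ σg g θ ω) at h3
      change 2 * (zfTrace (H ω)).re * (2 / a - 4 / (1 + σg ^ 2) * (1 + ∑ n, g n ω ^ 2) / a ^ 2) ≤ _
      set T := wlTrace (H ω) (diag₁ σg g θ ω) (diag₂ σg g θ ω)
      obtain ⟨l, hl⟩ : ∃ l, l = 4 / (1 + σg ^ 2) * (1 + ∑ n, g n ω ^ 2) := ⟨_, rfl⟩
      have hl0 : 0 < l := by rw [hl]; positivity
      rw [← hl] at h3 ⊢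
      have hz := (zfTrace_re_nonneg (H ω)).2
      have h4 : 2 / a - l / a ^ 2 ≤ 1 / l := by
        rw [div_sub_div _ _ ha0.ne' (by positivity), div_le_div_iff₀ (by positivity) hl0]
        nlinarith [mul_nonneg ha0.le (sq_nonneg (a - l))]
      calc 2 * (zfTrace (H ω)).re * (2 / a - l / a ^ 2) ≤ 2 * (zfTrace (H ω)).re * (1 / l) := by
            gcongr
        _ ≤ l * T * (1 / l) := by gcongr
        _ = T := by field_simp

end ExpectedTrace
end WLZF

namespace WLZF
open Matrix
open scoped ENNReal NNReal ComplexOrder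

/-! ### The power offset loss for general mismatch distributions -/

section OffsetLoss

variable {Ω : Type u} [MeasurableSpace Ω] {P : Measure Ω} {K N : ℕ}
  {H : Ω → Matrix (Fin K) (Fin N) ℂ} {g θ : Fin N → Ω → ℝ} {σg σθ δ : ℝ}

lemma abs_log_sub_log_le {a b m : ℝ} (hm : 0 < m) (ha : m ≤ a) (hb : m ≤ b) :
    |Real.log a - Real.log b| ≤ |a - b| / m := by
  have key : ∀ a b : ℝ, m ≤ a → m ≤ b → Real.log a - Real.log b ≤ |a - b| / m := by
    intro a b ha hb
    have ha0 := hm.trans_le ha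
    have hb0 := hm.trans_le hb
    rw [← Real.log_div ha0.ne' hb0.ne']
    calc Real.log (a / b) ≤ a / b - 1 := Real.log_le_sub_one_of_pos (by positivity)
      _ = (a - b) / b := by field_simp
      _ ≤ |a - b| / b := by gcongr; exact le_abs_self _
      _ ≤ |a - b| / m := by gcongr
  rw [abs_le]
  have h1 := key a b ha hb
  have h2 := key b a hb ha
  rw [abs_sub_comm] at h2
  constructor <;> linarith

/-- The regime of large variance: here `s`, `x` and even the constant `1` are bounded by multiples
of the tail `τ` or of `w = τ / δ²`, so a crude bound on `Y` suffices. -/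
lemma abs_sub_le_of_large {Y t s x τ w : ℝ} (ht : 0 ≤ t) (hs : 0 ≤ s) (hx : 0 ≤ x)
    (hsτ : s ≤ 2 * τ) (hxτ : x ≤ 8 * τ) (hw : 2 ≤ w) (hY0 : 0 ≤ Y)
    (hY : Y ≤ τ + (1 + s) * (4 * t)) :
    |Y - 2 * t * (1 + x)| ≤ τ + 3 * t * w + 24 * t * τ := by
  have h5 : t * s ≤ t * (2 * τ) := by gcongr
  have h6 : t * x ≤ t * (8 * τ) := by gcongr
  have h7 : t * 2 ≤ t * w := by gcongr
  have h8 : 0 ≤ t * x := by positivity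
  have h9 : 0 ≤ t * s := by positivity
  have h10 : 0 ≤ τ := by linarith
  have h11 : 0 ≤ t * τ := by positivity
  rw [abs_le]
  constructor <;> linarith

/-- The regime of small variance. The identity `(1 + s)(1 - s + x) = 1 + x + s (x - s)` shows the
normalization cancelling `-s`; the product `s (x - s)` is at most `2 δ v`. -/
lemma abs_sub_le_of_small {A B b E τ t s x v δ M : ℝ} (ht : 0 ≤ t) (hs : 0 ≤ s) (hsv : s ≤ v)
    (hx : 0 ≤ x) (hxv : x ≤ 4 * v) (hδ0 : 0 ≤ δ) (hδ : δ ≤ 1 / 8) (hv : v ≤ 4 * δ ^ 2)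
    (hB : 0 ≤ B) (hb : 0 ≤ b) (hτ : b + B ≤ τ) (hE : |E - 2 * t * (1 - s + x)| ≤ 10 * t * b)
    (hA : |A - (1 + s) * E| ≤ (1 + s) * M) :
    |A + B - 2 * t * (1 + x)| ≤ τ + 24 * t * τ + 2 * M + 4 * δ * v * t := by
  have hδ2 : δ ^ 2 ≤ δ / 8 := by nlinarith
  have hs1 : s ≤ 1 := by linarith
  have hM : 0 ≤ M := by
    have := (abs_nonneg _).trans hA
    exact nonneg_of_mul_nonneg_right this (by linarith)
  have h0 : A + B - 2 * t * (1 + x) = B + (A - (1 + s) * E) +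
      (1 + s) * (E - 2 * t * (1 - s + x)) + 2 * t * (s * (x - s)) := by ring
  have h1 : |(1 + s) * (E - 2 * t * (1 - s + x))| ≤ 2 * (10 * t * b) := by
    rw [abs_mul, abs_of_nonneg (by linarith : 0 ≤ 1 + s)]
    exact mul_le_mul (by linarith) hE (abs_nonneg _) (by norm_num)
  have h2 : |2 * t * (s * (x - s))| ≤ 2 * t * (2 * δ * v) := by
    rw [abs_mul, abs_of_nonneg (by positivity : 0 ≤ 2 * t)]
    refine mul_le_mul_of_nonneg_left ?_ (by positivity)
    rw [abs_mul, abs_of_nonneg hs]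
    have h3 : |x - s| ≤ 2 * δ := by
      rw [abs_le]; constructor <;> linarith
    calc s * |x - s| ≤ v * (2 * δ) := by
          refine mul_le_mul hsv h3 (abs_nonneg _) (hs.trans hsv)
      _ = _ := by ring
  have h3 : |A - (1 + s) * E| ≤ 2 * M :=
    hA.trans (mul_le_mul_of_nonneg_right (by linarith) hM)
  have h4 : t * b ≤ t * τ := by gcongr; linarith
  have h6 : 0 ≤ t * τ := mul_nonneg ht (by linarith)
  rw [h0]
  calc |B + (A - (1 + s) * E) + (1 + s) * (E - 2 * t * (1 - s + x)) + 2 * t * (s * (x - s))|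
      ≤ |B| + |A - (1 + s) * E| + |(1 + s) * (E - 2 * t * (1 - s + x))| +
        |2 * t * (s * (x - s))| := by
        refine (abs_add_le _ _).trans (add_le_add ((abs_add_le _ _).trans
          (add_le_add (abs_add_le _ _) le_rfl)) le_rfl)
    _ ≤ B + 2 * M + 2 * (10 * t * b) + 2 * t * (2 * δ * v) := by
        rw [abs_of_nonneg hB]
        gcongr
    _ ≤ _ := by linarith

lemma tailTerm_eq (hM : IsModel P H g θ σg σθ)
    (hW : WellDefined P H (diag₁ σg g θ) (diag₂ σg g θ)) (δ : ℝ) :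
    tailTerm P H g θ σg δ =
      ∫ ω, (1 - smallInd δ (mismatches g θ ω)) * (1 + mismatchSq (mismatches g θ ω)) ∂P +
      ∫ ω, (1 - smallInd δ (mismatches g θ ω)) *
        wlTrace (H ω) (diag₁ σg g θ ω) (diag₂ σg g θ ω) ∂P := by
  have := hM.channel.isProbabilityMeasure
  rw [tailTerm, setIntegral_large hM, ← integral_add
    (hM.integral_large_mul δ (f := fun ω => 1 + mismatchSq (mismatches g θ ω))
      ((integrable_const 1).add hM.integral_mismatchSq.1)).2.1
    (hM.integral_large_mul δ hW.integrable).2.1]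
  simp only [← mul_add]
  rfl

/-- The ratio is the argument of the logarithm in the offset loss. After the probabilistic estimates
are collected, the integrals are replaced by real variables and the claim is settled by the two
preceding inequalities. -/
lemma IsModel.abs_ratio_sub_le (hM : IsModel P H g θ σg σθ) (hK : 0 < K) (hKN : K < N)
    (hW : WellDefined P H (diag₁ σg g θ) (diag₂ σg g θ)) (hδ0 : 0 < δ) (hδ : δ ≤ 1 / 8) :
    0 ≤ tailTerm P H g θ σg δ ∧
    |(∫ ω, wlTrace (H ω) (diag₁ σg g θ ω) (diag₂ σg g θ ω) ∂P) / (2 * ((K : ℝ) / (N - K))) -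
      (1 + (σθ ^ 2 + 4 * σg ^ 2) * (((K : ℝ) + 1) / ((N : ℝ) + 1)))| ≤
      (1 / (2 * ((K : ℝ) / (N - K))) + 3 / (2 * δ ^ 2) + 12) * tailTerm P H g θ σg δ +
        (672 * N ^ 2 + 2) * δ * (σθ ^ 2 + σg ^ 2) := by
  have := hM.channel.isProbabilityMeasure
  have hN : (1 : ℝ) ≤ N := by exact_mod_cast (by omega : 1 ≤ N)
  have hK' : (0 : ℝ) < K := by exact_mod_cast hK
  have hKN' : (0 : ℝ) < N - K := by rw [sub_pos]; exact_mod_cast hKN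
  have hb : ∀ ω, 0 ≤ 1 - smallInd δ (mismatches g θ ω) := fun ω =>
    sub_nonneg.2 (smallInd_mem _ _).2
  have htail := tailTerm_eq hM hW δ
  have hT0 : ∀ᵐ ω ∂P, 0 ≤ wlTrace (H ω) (diag₁ σg g θ ω) (diag₂ σg g θ ω) := by
    filter_upwards [hW.isUnit_det] with ω hω using (wlTrace_pos hK hω).le
  have hB0 : 0 ≤ ∫ ω, (1 - smallInd δ (mismatches g θ ω)) *
      (1 + mismatchSq (mismatches g θ ω)) ∂P :=
    integral_nonneg fun ω => mul_nonneg (hb ω) (add_nonneg zero_le_one (mismatchSq_nonneg _))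
  have hB1 : 0 ≤ ∫ ω, (1 - smallInd δ (mismatches g θ ω)) *
        wlTrace (H ω) (diag₁ σg g θ ω) (diag₂ σg g θ ω) ∂P :=
    integral_nonneg_of_ae (hT0.mono fun ω h => mul_nonneg (hb ω) h)
  have hT := hM.integral_large_mul δ hW.integrable
  have htr := (hM.integral_truncExpansion hK hKN δ).1
  have hexp := hM.abs_integral_truncExpansion_sub_le hK hKN δ
  have hz := hM.integral_mul (F := fun X => (zfTrace X).re) (G := mismatchSq)
    (Complex.measurable_re.comp measurable_zfTrace) (integrable_zfTrace_re hK hKN)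
    measurable_mismatchSq hM.integral_mismatchSq.1
  rw [integral_zfTrace_re hK hKN, hM.integral_mismatchSq.2] at hz
  have hzi := hM.channel.integrable_comp (F := fun X => (zfTrace X).re)
    (integrable_zfTrace_re hK hKN)
  have hzv := hM.channel.integral_comp (F := fun X => (zfTrace X).re)
    (integrable_zfTrace_re hK hKN).aestronglyMeasurable
  rw [integral_zfTrace_re hK hKN] at hzv
  have hs : (0 : ℝ) ≤ 1 + σg ^ 2 := by positivity
  have hpt : ∀ᵐ ω ∂P, |smallInd δ (mismatches g θ ω) *
      wlTrace (H ω) (diag₁ σg g θ ω) (diag₂ σg g θ ω) -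
      (1 + σg ^ 2) * truncExpansion δ (H ω) (mismatches g θ ω)| ≤
      (1 + σg ^ 2) * (672 * N * δ * ((zfTrace (H ω)).re * mismatchSq (mismatches g θ ω))) ∧
      smallInd δ (mismatches g θ ω) * wlTrace (H ω) (diag₁ σg g θ ω) (diag₂ σg g θ ω) ≤
      (1 + σg ^ 2) * (4 * (zfTrace (H ω)).re) := by
    filter_upwards [hM.channel.ae_isUnit_det hK hKN] with ω hω
    have h := abs_smallInd_mul_wlTrace_sub_le hδ0.le hδ hω σg (fun n => g n ω) (fun n => θ n ω)
    rw [mul_comm (mismatchSq _)] at h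
    exact h
  have hdiff : |∫ ω, smallInd δ (mismatches g θ ω) *
      wlTrace (H ω) (diag₁ σg g θ ω) (diag₂ σg g θ ω) ∂P -
      (1 + σg ^ 2) * ∫ ω, truncExpansion δ (H ω) (mismatches g θ ω) ∂P| ≤
      (1 + σg ^ 2) * (672 * N * δ * (K / (N - K) * (N * (σθ ^ 2 + σg ^ 2)))) := by
    rw [← integral_const_mul, ← integral_sub hT.1 (htr.const_mul _), ← hz.2,
      ← integral_const_mul, ← integral_const_mul]
    rw [← Real.norm_eq_abs]
    refine norm_integral_le_of_norm_le ((hz.1.const_mul _).const_mul _) ?_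
    filter_upwards [hpt] with ω h
    rw [Real.norm_eq_abs]
    exact h.1
  have hcrude : ∫ ω, smallInd δ (mismatches g θ ω) *
      wlTrace (H ω) (diag₁ σg g θ ω) (diag₂ σg g θ ω) ∂P ≤
      (1 + σg ^ 2) * (4 * (K / (N - K))) := by
    rw [← hzv, ← integral_const_mul, ← integral_const_mul]
    exact integral_mono_ae hT.1 ((hzi.const_mul _).const_mul _) (hpt.mono fun ω h => h.2)
  -- The truncated sum of squares is at most `2 N δ²`, while the full mean is `N (σθ² + σg²)`. Once
  -- the variance exceeds `4 δ²`, at least half of it therefore sits in the tail.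
  have hlarge : 4 * δ ^ 2 < σθ ^ 2 + σg ^ 2 → (σθ ^ 2 + σg ^ 2) / 2 ≤
      ∫ ω, (1 - smallInd δ (mismatches g θ ω)) * (1 + mismatchSq (mismatches g θ ω)) ∂P := by
    intro hσ
    have h1 := hM.integral_large_mul δ hM.integral_mismatchSq.1
    have h2 : ∫ ω, smallInd δ (mismatches g θ ω) * mismatchSq (mismatches g θ ω) ∂P ≤
        ∫ _ω, (2 * N * δ ^ 2) ∂P := by
      refine integral_mono h1.1 (integrable_const _) fun ω => ?_
      by_cases h : mismatches g θ ω ∈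
          {m : Fin N → ℝ × ℝ | ∀ n, |(m n).1| ≤ δ ∧ |(m n).2| ≤ δ}
      · simp only [smallInd, Set.indicator_of_mem h, one_mul, mismatchSq]
        calc ∑ n, ((mismatches g θ ω n).1 ^ 2 + (mismatches g θ ω n).2 ^ 2) ≤
              ∑ _n : Fin N, 2 * δ ^ 2 := by
              refine Finset.sum_le_sum fun n _ => ?_
              have h3 := pow_le_pow_left₀ (abs_nonneg _) (h n).1 2
              have h4 := pow_le_pow_left₀ (abs_nonneg _) (h n).2 2
              rw [sq_abs] at h3 h4
              linarith
          _ = 2 * N * δ ^ 2 := by simp; ring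
      · simp only [smallInd, Set.indicator_of_notMem h, zero_mul]
        positivity
    have h3 : ∫ ω, (1 - smallInd δ (mismatches g θ ω)) * mismatchSq (mismatches g θ ω) ∂P ≤
        ∫ ω, (1 - smallInd δ (mismatches g θ ω)) * (1 + mismatchSq (mismatches g θ ω)) ∂P := by
      refine integral_mono h1.2.1
        (hM.integral_large_mul δ ((integrable_const 1).add hM.integral_mismatchSq.1)).2.1
        fun ω => mul_le_mul_of_nonneg_left (by simp) (hb ω)
    have h4 := h1.2.2
    rw [hM.integral_mismatchSq.2] at h4
    simp only [integral_const, probReal_univ, one_smul] at h2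
    nlinarith
  have hET : ∫ ω, wlTrace (H ω) (diag₁ σg g θ ω) (diag₂ σg g θ ω) ∂P =
      ∫ ω, smallInd δ (mismatches g θ ω) *
        wlTrace (H ω) (diag₁ σg g θ ω) (diag₂ σg g θ ω) ∂P +
      ∫ ω, (1 - smallInd δ (mismatches g θ ω)) *
        wlTrace (H ω) (diag₁ σg g θ ω) (diag₂ σg g θ ω) ∂P := by
    rw [hT.2.2]; ring
  have hA0 : 0 ≤ ∫ ω, smallInd δ (mismatches g θ ω) *
        wlTrace (H ω) (diag₁ σg g θ ω) (diag₂ σg g θ ω) ∂P :=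
    integral_nonneg_of_ae (hT0.mono fun ω h => mul_nonneg (smallInd_mem _ _).1 h)
  have hr1 : ((K : ℝ) + 1) / ((N : ℝ) + 1) ≤ 1 := by
    rw [div_le_one (by positivity)]; linarith
  have hr0 : 0 ≤ ((K : ℝ) + 1) / ((N : ℝ) + 1) := by positivity
  rw [hET]
  clear hET hpt hz hzi hzv htr hT hT0 hb
  have ht : 0 < (K : ℝ) / (N - K) := by positivity
  generalize (K : ℝ) / (N - K) = t at *
  generalize ((K : ℝ) + 1) / ((N : ℝ) + 1) = r at *
  generalize (∫ ω, smallInd δ (mismatches g θ ω) *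
    wlTrace (H ω) (diag₁ σg g θ ω) (diag₂ σg g θ ω) ∂P) = A at *
  generalize (∫ ω, (1 - smallInd δ (mismatches g θ ω)) *
        wlTrace (H ω) (diag₁ σg g θ ω) (diag₂ σg g θ ω) ∂P) = B at *
  generalize (∫ ω, (1 - smallInd δ (mismatches g θ ω)) *
    (1 + mismatchSq (mismatches g θ ω)) ∂P) = b at *
  generalize (∫ ω, truncExpansion δ (H ω) (mismatches g θ ω) ∂P) = E at *
  generalize tailTerm P H g θ σg δ = τ at *
  have hτ0 : 0 ≤ τ := by rw [htail]; positivity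
  refine ⟨hτ0, ?_⟩
  obtain ⟨x, hx⟩ : ∃ x, x = (σθ ^ 2 + 4 * σg ^ 2) * r := ⟨_, rfl⟩
  obtain ⟨v, hv⟩ : ∃ v, v = σθ ^ 2 + σg ^ 2 := ⟨_, rfl⟩
  have hv0 : 0 ≤ v := by rw [hv]; positivity
  have hx0 : 0 ≤ x := by rw [hx]; positivity
  have hgv : σg ^ 2 ≤ v := by rw [hv]; linarith [sq_nonneg σθ]
  have hxv : x ≤ 4 * v := by
    calc x ≤ (σθ ^ 2 + 4 * σg ^ 2) * 1 := by rw [hx]; gcongr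
      _ ≤ 4 * v := by rw [hv]; linarith [sq_nonneg σθ]
  rw [← hx] at hexp ⊢
  rw [← hv] at hdiff hlarge ⊢
  have hg0 := sq_nonneg σg
  generalize σg ^ 2 = s at *
  have e1 : (A + B) / (2 * t) - (1 + x) = (A + B - 2 * t * (1 + x)) / (2 * t) := by
    field_simp
  rw [e1, abs_div, abs_of_pos (by positivity : 0 < 2 * t), div_le_iff₀ (by positivity)]
  have e2 : ((1 / (2 * t) + 3 / (2 * δ ^ 2) + 12) * τ + (672 * N ^ 2 + 2) * δ * v) * (2 * t) =
      τ + 3 * t * (τ / δ ^ 2) + 24 * t * τ + 2 * (672 * N ^ 2 + 2) * δ * v * t := by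
    field_simp
    ring
  rw [e2]
  by_cases hσ : 4 * δ ^ 2 < v
  · have hb2 := hlarge hσ
    have h1 : v / 2 ≤ τ := by linarith
    have h2 : 2 ≤ τ / δ ^ 2 := by
      rw [le_div_iff₀ (by positivity)]; linarith
    have h4 : 0 ≤ 2 * (672 * (N : ℝ) ^ 2 + 2) * δ * v * t := by positivity
    exact (abs_sub_le_of_large ht.le hg0 hx0 (by linarith) (by linarith) h2
      (add_nonneg hA0 hB1) (by linarith)).trans (le_add_of_nonneg_right h4)
  · rw [not_lt] at hσ
    have hd : 0 ≤ 3 * t * (τ / δ ^ 2) := by positivity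
    have h := abs_sub_le_of_small ht.le hg0 hgv hx0 hxv hδ0.le hδ hσ hB1 hB0 htail.symm.le
      hexp hdiff
    refine h.trans ?_
    have h6 : 0 ≤ t * τ := by positivity
    have e3 : 672 * N * δ * (t * (N * v)) = 672 * (N : ℝ) ^ 2 * δ * v * t := by ring
    rw [e3]
    linarith

/-- The logarithm is 1-Lipschitz on `[1, ∞)`, and `(K+1)/(N+1) - K/N = (1 - K/N)/(N+1)`. -/
lemma abs_lossApprox_sub_lossLarge_le (hK : 0 < K) (hKN : K < N) (σg σθ : ℝ) :
    |lossApprox K N σg σθ - lossLarge σg ((K : ℝ) / N)| ≤ simplificationError K N σg σθ := by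
  have hN : (1 : ℝ) ≤ N := by exact_mod_cast (by omega : 1 ≤ N)
  have hKN' : (K : ℝ) ≤ N := by exact_mod_cast hKN.le
  have hl : 0 < Real.log 2 := Real.log_pos one_lt_two
  rw [lossApprox, lossLarge, simplificationError, Real.logb, Real.logb, ← sub_div, abs_div,
    abs_of_pos hl]
  refine div_le_div_of_nonneg_right ?_ hl.le
  refine (abs_log_sub_log_le one_pos ?_ ?_).trans_eq ?_
  · rw [le_add_iff_nonneg_right]; positivity
  · rw [le_add_iff_nonneg_right]; positivity
  · have e : 1 + (σθ ^ 2 + 4 * σg ^ 2) * (((K : ℝ) + 1) / (N + 1)) - (1 + 4 * σg ^ 2 * (K / N)) =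
        σθ ^ 2 * (((K : ℝ) + 1) / (N + 1)) + 4 * σg ^ 2 * ((1 - (K : ℝ) / N) / (N + 1)) := by
      field_simp
      ring
    rw [e, div_one, abs_of_nonneg]
    have : 0 ≤ 1 - (K : ℝ) / N := by
      rw [sub_nonneg, div_le_one (by linarith)]; exact hKN'
    positivity

/-- The power offset loss is given by its second-order value, up to a small relative error and the
contribution of large mismatches. -/
lemma exists_offsetLoss (hK : 0 < K) (hKN : K < N) {ε : ℝ} (hε : 0 < ε) :
    ∃ δ₀ : ℝ, 0 < δ₀ ∧ ∀ δ : ℝ, 0 < δ → δ ≤ δ₀ → ∃ C : ℝ, 0 < C ∧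
      ∀ (Ω : Type u) [MeasurableSpace Ω] (P : Measure Ω) [IsProbabilityMeasure P]
        (H : Ω → Matrix (Fin K) (Fin N) ℂ) (g θ : Fin N → Ω → ℝ) (σg σθ σn : ℝ),
        0 < σn → IsModel P H g θ σg σθ →
        WellDefined P H (diag₁ σg g θ) (diag₂ σg g θ) →
        0 ≤ tailTerm P H g θ σg δ ∧
        ∃ Δ : ℝ, IsOffsetLoss P H (diag₁ σg g θ) (diag₂ σg g θ) σn Δ ∧
          |Δ - lossApprox K N σg σθ| ≤
            ε * (σθ ^ 2 + σg ^ 2) + C * tailTerm P H g θ σg δ ∧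
          |Δ - lossLarge σg ((K : ℝ) / (N : ℝ))| ≤
            ε * (σθ ^ 2 + σg ^ 2) + C * tailTerm P H g θ σg δ +
              simplificationError K N σg σθ := by
  have hN : (1 : ℝ) ≤ N := by exact_mod_cast (by omega : 1 ≤ N)
  have hN0 : (0 : ℝ) < N := by linarith
  have hK' : (0 : ℝ) < K := by exact_mod_cast hK
  have hKN' : (0 : ℝ) < N - K := by rw [sub_pos]; exact_mod_cast hKN
  have ht : 0 < (K : ℝ) / (N - K) := by positivity
  -- The logarithm has Lipschitz constant `4 N` on `[1/(4N), ∞)`, and dividing by `log 2 ≥ 1/2`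
  -- costs a factor two. The bound on `δ` thus makes `8 N (672 N² + 2) δ ≤ ε`, and the constant
  -- below is `8 N` times the tail coefficient.
  refine ⟨min (1 / 8) (ε / (8 * N * (672 * N ^ 2 + 2))), by positivity, fun δ hδ0 hδ => ?_⟩
  refine ⟨8 * N * (1 / (2 * ((K : ℝ) / (N - K))) + 3 / (2 * δ ^ 2) + 12), by positivity, ?_⟩
  intro Ω _ P _ H g θ σg σθ σn hσn hM hW
  have hmain := hM.abs_ratio_sub_le hK hKN hW hδ0 (hδ.trans (min_le_left _ _))
  have hloss := isOffsetLoss hM.channel hK hKN hW hσn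
  have hlow := hM.le_integral_wlTrace hK hKN hW
  refine ⟨hmain.1, _, hloss, ?_⟩
  have hfirst : |Real.logb 2 ((∫ ω, wlTrace (H ω) (diag₁ σg g θ ω) (diag₂ σg g θ ω) ∂P) /
      (2 * ((K : ℝ) / (N - K)))) - lossApprox K N σg σθ| ≤ ε * (σθ ^ 2 + σg ^ 2) +
      8 * N * (1 / (2 * ((K : ℝ) / (N - K))) + 3 / (2 * δ ^ 2) + 12) *
        tailTerm P H g θ σg δ := by
    have hl : 1 / 2 ≤ Real.log 2 := by linarith [Real.log_two_gt_d9]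
    have h8 : 8 * N * ((672 * (N : ℝ) ^ 2 + 2) * δ) ≤ ε := by
      have := hδ.trans (min_le_right _ _)
      rw [le_div_iff₀ (by positivity)] at this
      linarith
    have hy : 1 / (4 * (N : ℝ)) ≤ (∫ ω, wlTrace (H ω) (diag₁ σg g θ ω) (diag₂ σg g θ ω) ∂P) /
        (2 * ((K : ℝ) / (N - K))) := by
      rw [le_div_iff₀ (by positivity)]
      refine le_trans (le_of_eq ?_) hlow
      ring
    have hx : 1 / (4 * (N : ℝ)) ≤
        1 + (σθ ^ 2 + 4 * σg ^ 2) * (((K : ℝ) + 1) / ((N : ℝ) + 1)) := by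
      have h1 : 1 / (4 * (N : ℝ)) ≤ 1 := by
        rw [div_le_one (by positivity)]; linarith
      have h2 : 0 ≤ (σθ ^ 2 + 4 * σg ^ 2) * (((K : ℝ) + 1) / ((N : ℝ) + 1)) := by positivity
      linarith
    have h := abs_log_sub_log_le (by positivity) hy hx
    have hl0 : 0 < Real.log 2 := by linarith
    rw [lossApprox, Real.logb, Real.logb, ← sub_div, abs_div, abs_of_pos hl0,
      div_le_iff₀ hl0]
    have hm := hmain.2
    generalize (∫ ω, wlTrace (H ω) (diag₁ σg g θ ω) (diag₂ σg g θ ω) ∂P) /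
      (2 * ((K : ℝ) / (N - K))) = y at *
    generalize 1 + (σθ ^ 2 + 4 * σg ^ 2) * (((K : ℝ) + 1) / ((N : ℝ) + 1)) = x at *
    have hv : 0 ≤ σθ ^ 2 + σg ^ 2 := by positivity
    generalize σθ ^ 2 + σg ^ 2 = v at *
    have hτ := hmain.1
    generalize tailTerm P H g θ σg δ = τ at *
    obtain ⟨D, hD⟩ : ∃ D, D = 1 / (2 * ((K : ℝ) / (N - K))) + 3 / (2 * δ ^ 2) + 12 := ⟨_, rfl⟩
    have hD0 : 0 ≤ D := by rw [hD]; positivity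
    rw [← hD] at hm ⊢
    have e : |y - x| / (1 / (4 * (N : ℝ))) = 4 * N * |y - x| := by field_simp
    rw [e] at h
    calc |Real.log y - Real.log x| ≤ 4 * N * |y - x| := h
      _ ≤ 4 * N * (D * τ + (672 * N ^ 2 + 2) * δ * v) := by gcongr
      _ = (8 * N * ((672 * N ^ 2 + 2) * δ) * v + 8 * N * D * τ) * (1 / 2) := by ring
      _ ≤ (ε * v + 8 * N * D * τ) * Real.log 2 := by gcongr
  refine ⟨hfirst, ?_⟩
  have h2 := abs_lossApprox_sub_lossLarge_le hK hKN σg σθ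
  refine (abs_sub_le _ (lossApprox K N σg σθ) _).trans ?_
  linarith

end OffsetLoss
end WLZF

namespace WLZF
open Matrix
open scoped ENNReal NNReal ComplexOrder

/-! ### Bounded mismatches and Gaussian gain mismatches -/

section GaussianTail

/-- Half of the exponent, at least `d²/(4σ²)`, is spent through `exp (-u) ≤ 2/u²` and yields `32
σ⁴/d⁴`. The other half dominates `x²/4`, the exponent of `N(0, 2)`. The ratio of normalizations
costs at most `2/σ`, leaving `σ³`, a power above the second. -/
lemma gaussianPDFReal_le_of_large {σ d x : ℝ} (hσ0 : 0 < σ) (hσ : σ ≤ 1) (hd : 0 < d)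
    (hx : d < |x|) : gaussianPDFReal 0 (Real.toNNReal (σ ^ 2)) x ≤
      64 * σ ^ 3 / d ^ 4 * gaussianPDFReal 0 2 x := by
  have hσ2 : σ ^ 2 ≤ 1 := pow_le_one₀ hσ0.le hσ
  have hd2 : d ^ 2 ≤ x ^ 2 := by
    rw [← sq_abs x]; exact pow_le_pow_left₀ hd.le hx.le 2
  rw [gaussianPDFReal, gaussianPDFReal, Real.coe_toNNReal _ (sq_nonneg σ), sub_zero]
  have h1 : Real.exp (-x ^ 2 / (2 * σ ^ 2)) ≤
      32 * σ ^ 4 / d ^ 4 * Real.exp (-x ^ 2 / (2 * ((2 : ℝ≥0) : ℝ))) := by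
    have hu : 0 ≤ d ^ 2 / (4 * σ ^ 2) := by positivity
    have e1 : Real.exp (-(d ^ 2 / (4 * σ ^ 2))) ≤ 32 * σ ^ 4 / d ^ 4 := by
      have h := Real.quadratic_le_exp_of_nonneg hu
      have h' : (d ^ 2 / (4 * σ ^ 2)) ^ 2 / 2 ≤ Real.exp (d ^ 2 / (4 * σ ^ 2)) := by linarith
      rw [Real.exp_neg]
      refine (inv_anti₀ (by positivity) h').trans (le_of_eq ?_)
      field_simp
      norm_num
    calc Real.exp (-x ^ 2 / (2 * σ ^ 2))
        ≤ Real.exp (-(d ^ 2 / (4 * σ ^ 2)) + -x ^ 2 / 4) := by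
          refine Real.exp_le_exp.2 ?_
          have h2 : d ^ 2 / (4 * σ ^ 2) ≤ x ^ 2 / (4 * σ ^ 2) := by gcongr
          have h3 : x ^ 2 / 4 ≤ x ^ 2 / (4 * σ ^ 2) := by
            refine div_le_div_of_nonneg_left (sq_nonneg x) (by positivity) (by linarith)
          have h4 : -x ^ 2 / (2 * σ ^ 2) = -(x ^ 2 / (4 * σ ^ 2)) - x ^ 2 / (4 * σ ^ 2) := by
            field_simp; ring
          rw [h4, neg_div]; linarith
      _ = Real.exp (-(d ^ 2 / (4 * σ ^ 2))) * Real.exp (-x ^ 2 / 4) := Real.exp_add _ _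
      _ ≤ 32 * σ ^ 4 / d ^ 4 * Real.exp (-x ^ 2 / 4) := by gcongr
      _ = _ := by norm_num
  have h2 : (√(2 * Real.pi * σ ^ 2))⁻¹ ≤ 2 / σ * (√(2 * Real.pi * ((2 : ℝ≥0) : ℝ)))⁻¹ := by
    have e : √(2 * Real.pi * ((2 : ℝ≥0) : ℝ)) = √2 * √(2 * Real.pi) := by
      rw [mul_comm, Real.sqrt_mul (by positivity)]; norm_num
    rw [Real.sqrt_mul (by positivity), Real.sqrt_sq hσ0.le, e, mul_inv, mul_inv]
    have h3 : √2 ≤ 2 := by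
      rw [Real.sqrt_le_left (by norm_num)]; norm_num
    have h4 : 1 ≤ 2 * (√2)⁻¹ := by
      rw [← div_eq_mul_inv, le_div_iff₀ (by positivity)]; linarith
    calc (√(2 * Real.pi))⁻¹ * σ⁻¹ = σ⁻¹ * (√(2 * Real.pi))⁻¹ * 1 := by ring
      _ ≤ σ⁻¹ * (√(2 * Real.pi))⁻¹ * (2 * (√2)⁻¹) := by gcongr
      _ = _ := by ring
  calc _ ≤ 2 / σ * (√(2 * Real.pi * ((2 : ℝ≥0) : ℝ)))⁻¹ *
        (32 * σ ^ 4 / d ^ 4 * Real.exp (-x ^ 2 / (2 * ((2 : ℝ≥0) : ℝ)))) := by gcongr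
    _ = _ := by field_simp; ring

lemma setLIntegral_gaussianReal_large_le {σ d : ℝ} (hσ0 : 0 ≤ σ) (hσ : σ ≤ 1) (hd : 0 < d)
    {f : ℝ → ℝ≥0∞} (hf : Measurable f) :
    ∫⁻ x in {x | d < |x|}, f x ∂(gaussianReal 0 (Real.toNNReal (σ ^ 2))) ≤
      ENNReal.ofReal (64 * σ ^ 3 / d ^ 4) * ∫⁻ x, f x ∂(gaussianReal 0 2) := by
  have hS : MeasurableSet {x : ℝ | d < |x|} := measurableSet_lt measurable_const (by fun_prop)
  rcases hσ0.eq_or_lt with rfl | hσ0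
  · rw [setLIntegral_measure_zero]
    · exact zero_le
    · simp [gaussianReal_zero_var, hd.le]
  · have hv : Real.toNNReal (σ ^ 2) ≠ 0 := by
      rw [Ne, Real.toNNReal_eq_zero, not_le]; positivity
    rw [gaussianReal_of_var_ne_zero _ hv, gaussianReal_of_var_ne_zero _ two_ne_zero,
      setLIntegral_withDensity_eq_setLIntegral_mul _ (measurable_gaussianPDF _ _) hf hS,
      lintegral_withDensity_eq_lintegral_mul _ (measurable_gaussianPDF _ _) hf,
      ← lintegral_const_mul _ ((measurable_gaussianPDF _ _).mul hf)]
    refine (setLIntegral_mono' hS fun x hx => ?_).trans (setLIntegral_le_lintegral _ _)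
    simp only [Pi.mul_apply]
    rw [← mul_assoc]
    refine mul_le_mul_left ?_ _
    rw [gaussianPDF, gaussianPDF, ← ENNReal.ofReal_mul (by positivity)]
    exact ENNReal.ofReal_le_ofReal (gaussianPDFReal_le_of_large hσ0 hσ hd hx)

/-- A majorant for the contribution of the gain mismatch of one antenna to the trace. -/
noncomputable def gainMajorant (K N : ℕ) (x : ℝ) : ℝ≥0∞ :=
  ENNReal.ofReal ((1 + |x|) ^ (2 * K)) + 3 ^ (2 * K) *
    (ENNReal.ofReal |x - 1| ^ (-((2 * (K : ℝ) + 1) / (2 * N))) +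
      ENNReal.ofReal |x + 1| ^ (-((2 * (K : ℝ) + 1) / (2 * N))))

variable {K N : ℕ}

lemma measurable_gainMajorant : Measurable (gainMajorant K N) := by
  unfold gainMajorant; fun_prop

lemma ne_one_of_gainMajorant_ne_top (hN : 0 < N) {x : ℝ} (h : gainMajorant K N x ≠ ∞) :
    x ≠ 1 ∧ x ≠ -1 := by
  have hα : -((2 * (K : ℝ) + 1) / (2 * N)) < 0 := by
    have : (0 : ℝ) < N := by exact_mod_cast hN
    rw [neg_lt_zero]; positivity
  constructor
  · rintro rfl
    refine h ?_
    simp [gainMajorant, ENNReal.zero_rpow_of_neg hα, ENNReal.mul_top]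
  · rintro rfl
    refine h ?_
    simp [gainMajorant, ENNReal.zero_rpow_of_neg hα, ENNReal.mul_top]

/-- For `|x| ≥ 2` the negative power is at most one. For `|x| < 2`, at least one of `|x - 1|`, `|x +
1|` is at least one, so the product of their negative powers is bounded by the sum. -/
lemma le_gainMajorant {x : ℝ} (h1 : x ≠ 1) (h2 : x ≠ -1) :
    ENNReal.ofReal ((1 + |x|) ^ (2 * K) * |1 - x ^ 2| ^ (-((2 * (K : ℝ) + 1) / (2 * N)))) ≤
      gainMajorant K N x := by
  have hα : -((2 * (K : ℝ) + 1) / (2 * N)) ≤ 0 := by rw [neg_nonpos]; positivity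
  have ha : 0 < |x - 1| := abs_pos.2 (sub_ne_zero.2 h1)
  have hb : 0 < |x + 1| := abs_pos.2 fun h => h2 (eq_neg_of_add_eq_zero_left h)
  rw [gainMajorant, ENNReal.ofReal_rpow_of_pos ha, ENNReal.ofReal_rpow_of_pos hb]
  generalize -((2 * (K : ℝ) + 1) / (2 * N)) = r at *
  by_cases hx : 2 ≤ |x|
  · refine le_trans (ENNReal.ofReal_le_ofReal ?_) le_self_add
    refine mul_le_of_le_one_right (by positivity) (Real.rpow_le_one_of_one_le_of_nonpos ?_ hα)
    rw [abs_sub_comm]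
    refine le_trans ?_ (le_abs_self _)
    rw [← sq_abs]; nlinarith
  · rw [not_le] at hx
    refine le_trans ?_ le_add_self
    rw [← ENNReal.ofReal_add (by positivity) (by positivity),
      (by norm_num : (3 : ℝ≥0∞) = ENNReal.ofReal 3), ← ENNReal.ofReal_pow (by norm_num),
      ← ENNReal.ofReal_mul (by positivity)]
    refine ENNReal.ofReal_le_ofReal ?_
    refine mul_le_mul (pow_le_pow_left₀ (by positivity) (by linarith) _) ?_ (by positivity)
      (by positivity)
    have e : |1 - x ^ 2| = |x - 1| * |x + 1| := by
      rw [← abs_mul, abs_sub_comm]; congr 1; ring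
    rw [e, Real.mul_rpow ha.le hb.le]
    have h3 : 1 ≤ |x - 1| ∨ 1 ≤ |x + 1| := by
      by_contra h
      rw [not_or, not_le, not_le, abs_lt, abs_lt] at h
      linarith [h.1.1, h.1.2, h.2.1, h.2.2]
    have ha' := Real.rpow_nonneg ha.le r
    have hb' := Real.rpow_nonneg hb.le r
    rcases h3 with h3 | h3
    · have := mul_le_of_le_one_left hb' (Real.rpow_le_one_of_one_le_of_nonpos h3 hα)
      linarith
    · have := mul_le_of_le_one_right ha' (Real.rpow_le_one_of_one_le_of_nonpos h3 hα)
      linarith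

/-- At a gain `± 1` an antenna loses one of its two real dimensions. The resulting singularity has
exponent `(2K+1)/(2N) < 1` and is integrable against a bounded density. -/
lemma lintegral_gainMajorant_lt_top (hKN : K < N) :
    ∫⁻ x, gainMajorant K N x ∂(gaussianReal 0 2) < ∞ := by
  have hα0 : 0 ≤ (2 * (K : ℝ) + 1) / (2 * N) := by positivity
  have hα : (2 * (K : ℝ) + 1) / (2 * N) < 1 := by
    have : (K : ℝ) + 1 ≤ N := by exact_mod_cast hKN
    rw [div_lt_one (by linarith [(Nat.cast_nonneg K : (0 : ℝ) ≤ K)])]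
    linarith
  have hs : ∀ a : ℝ, ∫⁻ x, ENNReal.ofReal |x - a| ^ (-((2 * (K : ℝ) + 1) / (2 * N)))
      ∂(gaussianReal 0 2) < ∞ := by
    intro a
    refine (lintegral_abs_sub_rpow_neg_le (D := 1) (ν := gaussianReal 0 2) ?_ hα0 a).trans_lt ?_
    · rw [one_smul]
      exact gaussianReal_le_smul_volume (le_trans (by norm_num) one_le_two)
    · rw [one_mul, measure_univ]
      exact ENNReal.add_lt_top.2 ⟨lintegral_abs_rpow_neg_lt_top hα, ENNReal.one_lt_top⟩
  have hm : MemLp (fun x : ℝ => 1 + |x|) ((2 * K : ℕ) : ℝ≥0∞) (gaussianReal 0 2) := by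
    have h := memLp_id_gaussianReal (μ := 0) (v := 2) ((2 * K : ℕ) : ℝ≥0)
    rw [ENNReal.coe_natCast] at h
    have h2 := (memLp_const (μ := gaussianReal 0 2) (1 : ℝ)).add h.norm
    exact h2
  have hp : ∫⁻ x, ENNReal.ofReal ((1 + |x|) ^ (2 * K)) ∂(gaussianReal 0 2) < ∞ := by
    have h := hm.integrable_norm_pow'
    refine lt_of_le_of_lt (lintegral_mono fun x => ?_) h.2
    rw [← ofReal_norm]
    refine ENNReal.ofReal_le_ofReal ?_
    rw [norm_pow, norm_norm, Real.norm_of_nonneg (by positivity)]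
  unfold gainMajorant
  rw [lintegral_add_left (by fun_prop), lintegral_const_mul _ (by fun_prop),
    lintegral_add_left (by fun_prop)]
  have h1 := hs (-1)
  simp only [sub_neg_eq_add] at h1
  exact ENNReal.add_lt_top.2 ⟨hp, ENNReal.mul_lt_top (by simp)
    (ENNReal.add_lt_top.2 ⟨hs 1, h1⟩)⟩

lemma gainMajorant_le_of_small (hKN : K < N) {x : ℝ} (hx : |x| ≤ 1 / 2) :
    gainMajorant K N x ≤ 2 ^ (2 * K) + 3 ^ (2 * K) * 4 := by
  have hα0 : 0 ≤ (2 * (K : ℝ) + 1) / (2 * N) := by positivity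
  have hα : (2 * (K : ℝ) + 1) / (2 * N) ≤ 1 := by
    have : (K : ℝ) + 1 ≤ N := by exact_mod_cast hKN
    rw [div_le_one (by linarith [(Nat.cast_nonneg K : (0 : ℝ) ≤ K)])]
    linarith
  have h : ∀ y : ℝ, 1 / 2 ≤ |y| →
      ENNReal.ofReal |y| ^ (-((2 * (K : ℝ) + 1) / (2 * N))) ≤ 2 := by
    intro y hy
    rw [ENNReal.rpow_neg, ← ENNReal.inv_rpow]
    have h1 : (ENNReal.ofReal |y|)⁻¹ ≤ 2 := by
      rw [ENNReal.inv_le_iff_inv_le, (by norm_num : (2 : ℝ≥0∞) = ENNReal.ofReal 2),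
        ← ENNReal.ofReal_inv_of_pos two_pos]
      exact ENNReal.ofReal_le_ofReal (by linarith)
    calc _ ≤ (2 : ℝ≥0∞) ^ ((2 * (K : ℝ) + 1) / (2 * N)) := ENNReal.rpow_le_rpow h1 hα0
      _ ≤ 2 ^ (1 : ℝ) := ENNReal.rpow_le_rpow_of_exponent_le one_le_two hα
      _ = 2 := ENNReal.rpow_one _
  obtain ⟨h1, h2⟩ := abs_le.1 hx
  rw [gainMajorant]
  refine add_le_add ?_ (mul_le_mul_right ?_ _)
  · rw [ENNReal.ofReal_pow (by positivity)]
    refine pow_le_pow_left₀ zero_le ?_ _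
    rw [(by norm_num : (2 : ℝ≥0∞) = ENNReal.ofReal 2)]
    exact ENNReal.ofReal_le_ofReal (by linarith)
  · refine (add_le_add (h (x - 1) ?_) (h (x + 1) ?_)).trans (by norm_num)
    · rw [le_abs]; right; linarith
    · rw [le_abs]; left; linarith

/-- A bound for the expectation of `gainMajorant`, uniformly in the standard deviation. -/
noncomputable def gainMean (K N : ℕ) (d : ℝ) : ℝ≥0∞ :=
  2 ^ (2 * K) + 3 ^ (2 * K) * 4 +
    ENNReal.ofReal (64 / d ^ 4) * ∫⁻ x, gainMajorant K N x ∂(gaussianReal 0 2)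

lemma gainMean_ne_top (hKN : K < N) (d : ℝ) : gainMean K N d ≠ ∞ :=
  ENNReal.add_ne_top.2 ⟨ENNReal.add_ne_top.2 ⟨by simp, ENNReal.mul_ne_top (by simp) (by simp)⟩,
    ENNReal.mul_ne_top ENNReal.ofReal_ne_top (lintegral_gainMajorant_lt_top hKN).ne⟩

lemma setLIntegral_gainMajorant_large_le {σ d : ℝ} (hσ0 : 0 ≤ σ) (hσ : σ ≤ 1) (hd : 0 < d) :
    ∫⁻ x in {x | d < |x|}, gainMajorant K N x ∂(gaussianReal 0 (Real.toNNReal (σ ^ 2))) ≤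
      ENNReal.ofReal (σ ^ 3) * gainMean K N d := by
  refine (setLIntegral_gaussianReal_large_le hσ0 hσ hd measurable_gainMajorant).trans ?_
  rw [show 64 * σ ^ 3 / d ^ 4 = σ ^ 3 * (64 / d ^ 4) by ring, ENNReal.ofReal_mul (by positivity),
    mul_assoc]
  exact mul_le_mul_right le_add_self _

lemma lintegral_gainMajorant_le (hKN : K < N) {σ d : ℝ} (hσ0 : 0 ≤ σ) (hσ : σ ≤ 1) (hd : 0 < d)
    (hd' : d ≤ 1 / 2) :
    ∫⁻ x, gainMajorant K N x ∂(gaussianReal 0 (Real.toNNReal (σ ^ 2))) ≤ gainMean K N d := by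
  have hS : MeasurableSet {x : ℝ | d < |x|} := measurableSet_lt measurable_const (by fun_prop)
  rw [← lintegral_add_compl _ hS, add_comm, gainMean]
  refine add_le_add ?_ ?_
  · refine (setLIntegral_mono' hS.compl fun x hx =>
      gainMajorant_le_of_small hKN ((not_lt.1 (Set.notMem_ofPred_iff.1 hx)).trans hd')).trans ?_
    rw [setLIntegral_const]
    exact mul_le_of_le_one_right zero_le prob_le_one
  · refine (setLIntegral_gaussianReal_large_le hσ0 hσ hd measurable_gainMajorant).trans ?_
    refine mul_le_mul_left (ENNReal.ofReal_le_ofReal ?_) _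
    have := pow_le_one₀ (n := 3) hσ0 hσ
    gcongr
    linarith

end GaussianTail
end WLZF

namespace WLZF
open Matrix
open scoped ENNReal NNReal ComplexOrder

/-! ### Gaussian gains: product bound for the trace, well-definedness, size of the tail -/

section SmallMismatches

variable {Ω : Type u} [MeasurableSpace Ω] {P : Measure Ω} {K N : ℕ}
  {H : Ω → Matrix (Fin K) (Fin N) ℂ} {g θ : Fin N → Ω → ℝ} {σg σθ : ℝ}

/-- The constant in the bound of the trace by gain majorants. -/
noncomputable def traceConst (K : ℕ) : ℝ :=
  2 * K * chartConst (2 * K) * 2 ^ K * (1 / 4 : ℝ) ^ (-((2 * (K : ℝ) + 1) / 2))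

lemma one_le_prod_one_add_abs (g : Fin N → ℝ) : 1 ≤ ∏ n, (1 + |g n|) :=
  calc (1 : ℝ) = ∏ _n : Fin N, 1 := by simp
    _ ≤ _ := Finset.prod_le_prod (fun _ _ => zero_le_one)
      fun n _ => le_add_of_nonneg_right (abs_nonneg _)

lemma one_add_abs_le_prod (g : Fin N → ℝ) (n : Fin N) : 1 + |g n| ≤ ∏ n, (1 + |g n|) := by
  rw [← Finset.mul_prod_erase _ _ (Finset.mem_univ n)]
  refine le_mul_of_one_le_right (by positivity) ?_
  calc (1 : ℝ) = ∏ _i ∈ Finset.univ.erase n, 1 := by simp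
    _ ≤ _ := Finset.prod_le_prod (fun _ _ => zero_le_one)
      fun i _ => le_add_of_nonneg_right (abs_nonneg _)

lemma prod_gainWeight (g : Fin N → ℝ) : ∏ j, gainWeight g j = (∏ n, |1 - g n ^ 2|) ^ 2 := by
  rw [Fintype.prod_sum_type, ← Finset.prod_mul_distrib, ← Finset.prod_pow]
  refine Finset.prod_congr rfl fun n _ => ?_
  simp only [gainWeight, Sum.elim_inl, Sum.elim_inr, sq_abs]
  ring

lemma gainWeight_pos {g : Fin N → ℝ} (hg : ∀ n, g n ≠ 1 ∧ g n ≠ -1) (j : Fin N ⊕ Fin N) :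
    0 < gainWeight g j := by
  rcases j with n | n
  · have : 1 + g n ≠ 0 := fun h => (hg n).2 (by linarith)
    exact sq_pos_of_ne_zero this
  · have : 1 - g n ≠ 0 := fun h => (hg n).1 (by linarith)
    exact sq_pos_of_ne_zero this

lemma gainWeight_le (g : Fin N → ℝ) (j : Fin N ⊕ Fin N) :
    gainWeight g j ≤ (∏ n, (1 + |g n|)) ^ 2 := by
  rcases j with n | n
  · refine le_trans ?_ (pow_le_pow_left₀ (by positivity) (one_add_abs_le_prod g n) 2)
    change (1 + g n) ^ 2 ≤ _
    nlinarith [le_abs_self (g n), sq_abs (g n)]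
  · refine le_trans ?_ (pow_le_pow_left₀ (by positivity) (one_add_abs_le_prod g n) 2)
    change (1 - g n) ^ 2 ≤ _
    nlinarith [neg_abs_le (g n), sq_abs (g n)]

/-- The Gram form lies between the weighted sum of squares times `1/4` (as `σg ≤ 1` and `|sin φ| ≤
1/2`) and `2 p²` times the ideal form, where `p = ∏ (1 + |x n|)`. Bounding the largest weight by a
product keeps the bound factored over antennas, so expectations factor too. -/
lemma wlTrace_le_prod_gainMajorant (hK : 0 < K) (hN : 0 < N) {X : Matrix (Fin K) (Fin N) ℂ}
    (hX : chanBound X ≠ ∞) (hσ0 : 0 ≤ σg) (hσ : σg ≤ 1) {x φ : Fin N → ℝ}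
    (hx : ∀ n, x n ≠ 1 ∧ x n ≠ -1) (hφ : ∀ n, |Real.sin (φ n)| ≤ 1 / 2) :
    IsUnit (wlGram X (fun n => iqCoeff₁ σg (x n) (φ n)) (fun n => iqCoeff₂ σg (x n) (φ n))).det ∧
    ENNReal.ofReal (wlTrace X (fun n => iqCoeff₁ σg (x n) (φ n))
      (fun n => iqCoeff₂ σg (x n) (φ n))) ≤
      ENNReal.ofReal (traceConst K) * (∏ n, gainMajorant K N (x n)) * chanBound X := by
  have hσ2 : σg ^ 2 ≤ 1 := pow_le_one₀ hσ0 hσ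
  have hw := gainWeight_pos hx
  have hlow : ∀ y, 1 / 4 * ∑ j, gainWeight x j * (y ᵥ* realRep X) j ^ 2 ≤
      gramForm (wlChannel X (fun n => iqCoeff₁ σg (x n) (φ n))
        (fun n => iqCoeff₂ σg (x n) (φ n))) y := by
    intro y
    refine le_trans ?_ (gramForm_wlChannel_lower X σg x φ (c := 1 / 2)
      (fun n => (hφ n).trans (by norm_num)) y)
    refine mul_le_mul_of_nonneg_right ?_
      (Finset.sum_nonneg fun j _ => mul_nonneg (hw j).le (sq_nonneg _))
    rw [le_div_iff₀ (by positivity)]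
    linarith
  obtain ⟨p, hp⟩ : ∃ p, p = ∏ n, (1 + |x n|) := ⟨_, rfl⟩
  have hp1 : 1 ≤ p := hp ▸ one_le_prod_one_add_abs x
  have hup : ∀ y, gramForm (wlChannel X (fun n => iqCoeff₁ σg (x n) (φ n))
        (fun n => iqCoeff₂ σg (x n) (φ n))) y ≤ 2 * p ^ 2 * gramForm (realRep X) y := by
    intro y
    refine (gramForm_wlChannel_upper X σg x φ y).trans ?_
    have h1 : 2 / (1 + σg ^ 2) ≤ 2 := by
      rw [div_le_iff₀ (by positivity)]; linarith [sq_nonneg σg]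
    rw [mul_assoc, gramForm, Finset.mul_sum _ _ (p ^ 2)]
    refine mul_le_mul h1 (Finset.sum_le_sum fun j _ => ?_)
      (Finset.sum_nonneg fun j _ => mul_nonneg (hw j).le (sq_nonneg _)) two_pos.le
    exact mul_le_mul_of_nonneg_right (hp ▸ gainWeight_le x j) (sq_nonneg _)
  refine ⟨isUnit_det_of_chanBound_ne_top hN _ hX (by norm_num) hw hlow, ?_⟩
  refine (trace_inv_le_chanBound hK hN _ hX (by norm_num) (by positivity) hw hlow hup).trans ?_
  have hc0 : 0 ≤ chartConst (2 * K) := (chartConst_pos _).le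
  have hT0 : 0 ≤ traceConst K := by unfold traceConst; positivity
  have hprod : ENNReal.ofReal (∏ n, ((1 + |x n|) ^ (2 * K) *
      |1 - x n ^ 2| ^ (-((2 * (K : ℝ) + 1) / (2 * N))))) ≤ ∏ n, gainMajorant K N (x n) := by
    rw [ENNReal.ofReal_prod_of_nonneg fun n _ => by positivity]
    exact Finset.prod_le_prod' fun n _ => le_gainMajorant (hx n).1 (hx n).2
  refine mul_le_mul_left ?_ _
  refine le_trans ?_ (mul_le_mul_right hprod _)
  rw [← ENNReal.ofReal_mul hT0]
  refine ENNReal.ofReal_le_ofReal ?_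
  obtain ⟨q, hq⟩ : ∃ q, q = ∏ n, |1 - x n ^ 2| := ⟨_, rfl⟩
  have hq0 : 0 ≤ q := hq ▸ Finset.prod_nonneg fun n _ => abs_nonneg _
  have hN' : (0 : ℝ) < N := by exact_mod_cast hN
  rw [prod_gainWeight, Finset.prod_mul_distrib, Finset.prod_pow,
    Real.finsetProd_rpow _ _ (fun n _ => abs_nonneg _), ← hp, ← hq,
    Real.mul_rpow (x := 1 / 4) (by norm_num) (by positivity), ← Real.rpow_natCast q 2, ← Real.rpow_mul hq0,
    ← Real.rpow_mul hq0]
  have e : ((2 : ℕ) : ℝ) * (1 / (2 * N)) * (-((2 * (K : ℝ) + 1) / 2)) =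
      -((2 * (K : ℝ) + 1) / (2 * N)) := by
    push_cast
    field_simp
  -- As `2 p² ≥ 1`, the exponent `K - 1/2` may be raised to `K`, giving the power `(1 + |x|) ^ (2 *
  -- K)` of the majorant.
  have hB : (2 * p ^ 2) ^ ((2 * (K : ℝ) - 1) / 2) ≤ 2 ^ K * p ^ (2 * K) := by
    calc (2 * p ^ 2) ^ ((2 * (K : ℝ) - 1) / 2) ≤ (2 * p ^ 2) ^ (K : ℝ) := by
          refine Real.rpow_le_rpow_of_exponent_le ?_ (by linarith)
          nlinarith
      _ = 2 ^ K * p ^ (2 * K) := by rw [Real.rpow_natCast, mul_pow, pow_mul]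
  rw [e, traceConst]
  have hq' := Real.rpow_nonneg hq0 (-((2 * (K : ℝ) + 1) / (2 * N)))
  calc _ ≤ 2 * K * chartConst (2 * K) * (2 ^ K * p ^ (2 * K)) *
        ((1 / 4) ^ (-((2 * (K : ℝ) + 1) / 2)) * q ^ (-((2 * (K : ℝ) + 1) / (2 * N)))) := by
        gcongr
    _ = _ := by ring

lemma one_add_mismatchSq_le_prod_gainMajorant (hK : 0 < K) {m : Fin N → ℝ × ℝ}
    (hm : ∀ n, |(m n).2| ≤ 1) :
    ENNReal.ofReal (1 + mismatchSq m) ≤ (1 + N) * ∏ n, gainMajorant K N (m n).1 := by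
  obtain ⟨p, hp⟩ : ∃ p, p = ∏ n, (1 + |(m n).1|) := ⟨_, rfl⟩
  have hp1 : 1 ≤ p := hp ▸ one_le_prod_one_add_abs fun n => (m n).1
  have h1 : 1 + mismatchSq m ≤ (1 + N) * p ^ (2 * K) := by
    have h2 : p ^ 2 ≤ p ^ (2 * K) := pow_le_pow_right₀ hp1 (by omega)
    have h3 : mismatchSq m ≤ ∑ _n : Fin N, p ^ 2 := by
      refine Finset.sum_le_sum fun n _ => ?_
      have h4 := hp ▸ one_add_abs_le_prod (fun n => (m n).1) n
      have h5 := pow_le_pow_left₀ (by positivity) h4 2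
      have h6 := pow_le_pow_left₀ (abs_nonneg _) (hm n) 2
      rw [sq_abs] at h6
      nlinarith [sq_abs (m n).1, abs_nonneg (m n).1]
    rw [Finset.sum_const, Finset.card_univ, Fintype.card_fin, nsmul_eq_mul] at h3
    have h7 : 1 ≤ p ^ 2 := one_le_pow₀ hp1
    calc 1 + mismatchSq m ≤ (1 + N) * p ^ 2 := by linarith
      _ ≤ _ := by gcongr
  refine (ENNReal.ofReal_le_ofReal h1).trans ?_
  rw [ENNReal.ofReal_mul (by positivity), ENNReal.ofReal_add zero_le_one (by positivity),
    ENNReal.ofReal_one, ENNReal.ofReal_natCast, hp, ← Finset.prod_pow,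
    ENNReal.ofReal_prod_of_nonneg fun n _ => by positivity]
  exact mul_le_mul_right (Finset.prod_le_prod' fun n _ => le_self_add) _

lemma IsModel.lintegral_prod_gain (hM : IsModel P H g θ σg σθ)
    (hg : ∀ n, HasLaw (g n) (gaussianReal 0 (Real.toNNReal (σg ^ 2))) P)
    {f : Fin N → ℝ → ℝ≥0∞} (hf : ∀ n, Measurable (f n)) :
    ∫⁻ ω, ∏ n, f n (g n ω) ∂P =
      ∏ n, ∫⁻ x, f n x ∂(gaussianReal 0 (Real.toNNReal (σg ^ 2))) := by
  have := hM.channel.isProbabilityMeasure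
  have hga : ∀ n, AEMeasurable (g n) P := fun n => (hg n).aemeasurable
  have h1 := (iIndepFun_iff_map_fun_eq_pi_map hga).1 hM.gain.indep
  simp only [(hg _).map_eq] at h1
  have hfm : Measurable fun x : Fin N → ℝ => ∏ n, f n (x n) :=
    Finset.measurable_prod _ fun n _ => (hf n).comp (measurable_pi_apply n)
  have h2 := lintegral_map' (μ := P) hfm.aemeasurable (aemeasurable_pi_lambda (fun ω n => g n ω) hga)
  have h3 := lintegral_prod_eq_prod_lintegral_of_indepFun
    (μ := Measure.pi fun _ : Fin N => gaussianReal 0 (Real.toNNReal (σg ^ 2)))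
    Finset.univ (fun j x => f j (x j)) (iIndepFun_pi (X := f) fun n => (hf n).aemeasurable)
    (fun j => (hf j).comp (measurable_pi_apply j))
  rw [← h2, h1, h3]
  exact Finset.prod_congr rfl fun j _ => (measurePreserving_eval
    (fun _ : Fin N => gaussianReal 0 (Real.toNNReal (σg ^ 2))) j).lintegral_comp (hf j)

/-- The channel factor in the bound of the trace. -/
noncomputable def chanFactor (X : Matrix (Fin K) (Fin N) ℂ) : ℝ≥0∞ :=
  (1 + N) + ENNReal.ofReal (traceConst K) * chanBound X

lemma measurable_chanFactor :
    Measurable fun z : ChanIdx K N → ℝ => chanFactor (chan z) :=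
  (measurable_chanBound.const_mul _).const_add _

lemma lintegral_chanFactor_ne_top (hK : 0 < K) (hKN : K < N) :
    ∫⁻ z, chanFactor (chan z) ∂(chanLaw K N) ≠ ∞ := by
  have : IsProbabilityMeasure (chanLaw K N) := by unfold chanLaw; infer_instance
  unfold chanFactor
  rw [lintegral_add_left measurable_const, lintegral_const_mul _ measurable_chanBound]
  refine ENNReal.add_ne_top.2 ⟨?_, ENNReal.mul_ne_top ENNReal.ofReal_ne_top
    (lintegral_chanBound_lt_top hK hKN).ne⟩
  simp

lemma IsModel.lintegral_prod_gain_mul_chanFactor (hM : IsModel P H g θ σg σθ)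
    (hg : ∀ n, HasLaw (g n) (gaussianReal 0 (Real.toNNReal (σg ^ 2))) P)
    {f : Fin N → ℝ → ℝ≥0∞} (hf : ∀ n, Measurable (f n)) :
    ∫⁻ ω, chanFactor (H ω) * ∏ n, f n (g n ω) ∂P =
      (∫⁻ z, chanFactor (chan z) ∂(chanLaw K N)) *
        ∏ n, ∫⁻ x, f n x ∂(gaussianReal 0 (Real.toNNReal (σg ^ 2))) := by
  have hG : Measurable fun m : Fin N → ℝ × ℝ => ∏ n, f n (m n).1 :=
    Finset.measurable_prod _ fun n _ => (hf n).comp (measurable_pi_apply n).fst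
  have hi := hM.indepFun (F := chanFactor) measurable_chanFactor hG
  have hF := (measurable_chanFactor (K := K) (N := N)).comp_aemeasurable
    hM.channel.hasLaw.aemeasurable
  simp only [Function.comp_def, chan_coords] at hF
  have h := lintegral_mul_eq_lintegral_mul_lintegral_of_indepFun'' hF
    (hG.comp_aemeasurable hM.aemeasurable_mismatches) hi
  rw [← hM.lintegral_prod_gain hg hf, ← hM.channel.lintegral_comp measurable_chanFactor]
  exact h

lemma IsModel.ae_trace_bound (hM : IsModel P H g θ σg σθ) (hK : 0 < K) (hKN : K < N)
    (hg : ∀ n, HasLaw (g n) (gaussianReal 0 (Real.toNNReal (σg ^ 2))) P) (hσ : σg ≤ 1)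
    (hθ : ∀ᵐ ω ∂P, ∀ n, |θ n ω| ≤ 1 / 2) :
    ∀ᵐ ω ∂P, IsUnit (wlGram (H ω) (diag₁ σg g θ ω) (diag₂ σg g θ ω)).det ∧
      ENNReal.ofReal (1 + mismatchSq (mismatches g θ ω) +
        wlTrace (H ω) (diag₁ σg g θ ω) (diag₂ σg g θ ω)) ≤
        chanFactor (H ω) * ∏ n, gainMajorant K N (g n ω) := by
  have hN : 0 < N := by omega
  -- Finiteness of the majorant excludes gains equal to `± 1`, where the weights degenerate.
  have hgm : ∀ᵐ ω ∂P, ∀ n, gainMajorant K N (g n ω) ≠ ∞ := by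
    refine ae_all_iff.2 fun n => ?_
    have h1 : ∀ᵐ x ∂(gaussianReal 0 (Real.toNNReal (σg ^ 2))), gainMajorant K N x < ∞ :=
      ae_lt_top measurable_gainMajorant
        (ne_top_of_le_ne_top (gainMean_ne_top hKN (1 / 2)) (lintegral_gainMajorant_le hKN
          hM.gain_nonneg hσ (by norm_num) le_rfl))
    rw [← (hg n).map_eq] at h1
    exact (ae_of_ae_map (hg n).aemeasurable h1).mono fun ω h => h.ne
  filter_upwards [hgm, hM.channel.ae_chanBound_ne_top hK hKN, hθ] with ω h1 h2 h3
  have h4 := wlTrace_le_prod_gainMajorant hK hN h2 hM.gain_nonneg hσ (x := fun n => g n ω)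
    (φ := fun n => θ n ω) (fun n => ne_one_of_gainMajorant_ne_top hN (h1 n))
    (fun n => Real.abs_sin_le_abs.trans (h3 n))
  have h5 := one_add_mismatchSq_le_prod_gainMajorant hK (m := mismatches g θ ω)
    (fun n => (h3 n).trans (by norm_num))
  refine ⟨h4.1, ?_⟩
  change ENNReal.ofReal (1 + mismatchSq (mismatches g θ ω) +
    wlTrace (H ω) (fun n => iqCoeff₁ σg (g n ω) (θ n ω)) (fun n => iqCoeff₂ σg (g n ω) (θ n ω))) ≤ _
  rw [ENNReal.ofReal_add (add_nonneg zero_le_one (mismatchSq_nonneg _)) (wlTrace_pos hK h4.1).le,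
    chanFactor, add_mul]
  refine add_le_add h5 (h4.2.trans (le_of_eq ?_))
  ring

/-- Gaussian gain mismatches: WL-ZF is well defined. -/
lemma IsModel.wellDefined_of_gaussian (hM : IsModel P H g θ σg σθ) (hK : 0 < K) (hKN : K < N)
    (hg : ∀ n, HasLaw (g n) (gaussianReal 0 (Real.toNNReal (σg ^ 2))) P) (hσ : σg ≤ 1)
    (hθ : ∀ᵐ ω ∂P, ∀ n, |θ n ω| ≤ 1 / 2) :
    WellDefined P H (diag₁ σg g θ) (diag₂ σg g θ) := by
  have h := hM.ae_trace_bound hK hKN hg hσ hθ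
  refine ⟨h.mono fun ω hω => hω.1, aestronglyMeasurable_wlTrace hM.channel σg
    (fun n => (hM.gain.memLp n).aestronglyMeasurable.aemeasurable)
    (fun n => (hM.phase.memLp n).aestronglyMeasurable.aemeasurable), ?_⟩
  rw [hasFiniteIntegral_iff_norm]
  refine (lintegral_mono_ae (g := fun ω => chanFactor (H ω) * ∏ n, gainMajorant K N (g n ω))
    (h.mono fun ω hω => ?_)).trans_lt (lt_top_iff_ne_top.2 ?_)
  · refine le_trans (ENNReal.ofReal_le_ofReal ?_) hω.2
    rw [Real.norm_of_nonneg (wlTrace_pos hK hω.1).le]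
    exact le_add_of_nonneg_left (add_nonneg zero_le_one (mismatchSq_nonneg _))
  · rw [hM.lintegral_prod_gain_mul_chanFactor hg (f := fun _ => gainMajorant K N)
      fun _ => measurable_gainMajorant]
    refine ENNReal.mul_ne_top (lintegral_chanFactor_ne_top hK hKN)
      (ENNReal.prod_ne_top fun n _ => ne_top_of_le_ne_top (gainMean_ne_top hKN (1 / 2))
        (lintegral_gainMajorant_le hKN hM.gain_nonneg hσ (by norm_num) le_rfl))

/-- A bound of the tail term for Gaussian gain mismatches, divided by the third power of the
standard deviation. -/
noncomputable def gaussianTailConst (K N : ℕ) (d : ℝ) : ℝ≥0∞ :=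
  N * ((∫⁻ z, chanFactor (chan z) ∂(chanLaw K N)) * gainMean K N d ^ N)

lemma gaussianTailConst_ne_top (hK : 0 < K) (hKN : K < N) (d : ℝ) :
    gaussianTailConst K N d ≠ ∞ :=
  ENNReal.mul_ne_top (by simp) (ENNReal.mul_ne_top (lintegral_chanFactor_ne_top hK hKN)
    (ENNReal.pow_ne_top (gainMean_ne_top hKN d)))

/-- The phases never exceed `d`, so the tail event is the union over `m` of `|g m| > d`. By
independence each summand is a product, in which the factor of antenna `m` is of order `σg³` and the
others are bounded. -/
lemma IsModel.tailTerm_le_of_gaussian (hM : IsModel P H g θ σg σθ) (hK : 0 < K) (hKN : K < N)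
    (hg : ∀ n, HasLaw (g n) (gaussianReal 0 (Real.toNNReal (σg ^ 2))) P) (hσ : σg ≤ 1)
    {d : ℝ} (hd : 0 < d) (hd' : d ≤ 1 / 2) (hθ : ∀ᵐ ω ∂P, ∀ n, |θ n ω| ≤ d) :
    tailTerm P H g θ σg d ≤ σg ^ 3 * (gaussianTailConst K N d).toReal := by
  classical
  have hσ0 := hM.gain_nonneg
  have h := hM.ae_trace_bound hK hKN hg hσ (hθ.mono fun ω h n => (h n).trans hd')
  obtain ⟨S, hS⟩ : ∃ S : Set ℝ, S = {x | d < |x|} := ⟨_, rfl⟩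
  have hSm : MeasurableSet S := hS ▸ measurableSet_lt measurable_const (by fun_prop)
  -- In the `m`-th product only the factor of antenna `m` is restricted to large gains.
  obtain ⟨f, hf⟩ : ∃ f : Fin N → Fin N → ℝ → ℝ≥0∞, f = fun m n =>
    if n = m then S.indicator (gainMajorant K N) else gainMajorant K N := ⟨_, rfl⟩
  have hfm : ∀ m n, Measurable (f m n) := by
    intro m n
    rw [hf]
    by_cases hmn : n = m
    · simp only [hmn, if_true]; exact measurable_gainMajorant.indicator hSm
    · simp only [hmn, if_false]; exact measurable_gainMajorant
  have hfi : ∀ m n, ∫⁻ x, f m n x ∂(gaussianReal 0 (Real.toNNReal (σg ^ 2))) ≤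
      (if n = m then ENNReal.ofReal (σg ^ 3) else 1) * gainMean K N d := by
    intro m n
    rw [hf]
    by_cases hmn : n = m
    · simp only [hmn, if_true]
      rw [lintegral_indicator hSm, hS]
      exact setLIntegral_gainMajorant_large_le hσ0 hσ hd
    · simp only [hmn, if_false, one_mul]
      exact lintegral_gainMajorant_le hKN hσ0 hσ hd hd'
  have hpt : ∀ᵐ ω ∂P, ‖(1 - smallInd d (mismatches g θ ω)) *
      (1 + (∑ n, ((g n ω) ^ 2 + (θ n ω) ^ 2)) +
        wlTrace (H ω) (diag₁ σg g θ ω) (diag₂ σg g θ ω))‖ₑ ≤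
      ∑ m, chanFactor (H ω) * ∏ n, f m n (g n ω) := by
    filter_upwards [h, hθ] with ω h1 h2
    by_cases hs : ∀ n, |g n ω| ≤ d
    · have : smallInd d (mismatches g θ ω) = 1 :=
        Set.indicator_of_mem (fun n => ⟨hs n, h2 n⟩) _
      simp [this]
    · rw [not_forall] at hs
      obtain ⟨m, hm⟩ := hs
      have h3 : smallInd d (mismatches g θ ω) = 0 :=
        Set.indicator_of_notMem (fun h => hm (h m).1) _
      have h4 : ∏ n, f m n (g n ω) = ∏ n, gainMajorant K N (g n ω) := by
        refine Finset.prod_congr rfl fun n _ => ?_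
        rw [hf]
        by_cases hmn : n = m
        · simp only [hmn, if_true]
          exact Set.indicator_of_mem (by rw [hS]; exact not_le.1 hm) _
        · simp only [hmn, if_false]
      refine le_trans ?_ (Finset.single_le_sum (f := fun m => chanFactor (H ω) *
        ∏ n, f m n (g n ω)) (fun _ _ => zero_le) (Finset.mem_univ m))
      rw [h3, sub_zero, one_mul, h4]
      refine le_trans (le_of_eq ?_) h1.2
      exact Real.enorm_of_nonneg (add_nonneg (add_nonneg zero_le_one
        (mismatchSq_nonneg (mismatches g θ ω))) (wlTrace_pos hK h1.1).le)
  have hcf := (measurable_chanFactor (K := K) (N := N)).comp_aemeasurable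
    hM.channel.hasLaw.aemeasurable
  simp only [Function.comp_def, chan_coords] at hcf
  have hfinal : ‖tailTerm P H g θ σg d‖ₑ ≤ ENNReal.ofReal (σg ^ 3) * gaussianTailConst K N d := by
    rw [tailTerm, setIntegral_large hM]
    refine (enorm_integral_le_lintegral_enorm _).trans ((lintegral_mono_ae hpt).trans ?_)
    have hmeas : ∀ m, AEMeasurable (fun ω => chanFactor (H ω) * ∏ n, f m n (g n ω)) P :=
      fun m => hcf.mul (Finset.aemeasurable_fun_prod _ fun n _ =>
        (hfm m n).comp_aemeasurable (hg n).aemeasurable)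
    rw [lintegral_finsetSum' _ fun m _ => hmeas m]
    simp only [hM.lintegral_prod_gain_mul_chanFactor hg (hfm _)]
    calc _ ≤ ∑ _m : Fin N, (∫⁻ z, chanFactor (chan z) ∂(chanLaw K N)) *
          (ENNReal.ofReal (σg ^ 3) * gainMean K N d ^ N) := by
          refine Finset.sum_le_sum fun m _ => mul_le_mul_right ?_ _
          refine (Finset.prod_le_prod' fun n _ => hfi m n).trans (le_of_eq ?_)
          rw [Finset.prod_mul_distrib, Finset.prod_ite_eq' Finset.univ m]
          simp
      _ = _ := by
          rw [Finset.sum_const, Finset.card_univ, Fintype.card_fin, nsmul_eq_mul,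
            gaussianTailConst]
          ring
  have h5 := ENNReal.toReal_mono (ENNReal.mul_ne_top ENNReal.ofReal_ne_top
    (gaussianTailConst_ne_top hK hKN d)) hfinal
  rw [toReal_enorm, ENNReal.toReal_mul, ENNReal.toReal_ofReal (by positivity)] at h5
  exact (Real.le_norm_self _).trans h5

end SmallMismatches

/-! ### Offset loss for bounded mismatches and for Gaussian gains -/

section Conclusions

variable {K N : ℕ}

/-- The power offset loss for bounded mismatches. -/
lemma exists_offsetLoss_of_bounded (hK : 0 < K) (hKN : K < N) {ε : ℝ} (hε : 0 < ε) :
    ∃ δ : ℝ, 0 < δ ∧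
      ∀ (Ω : Type u) [MeasurableSpace Ω] (P : Measure Ω) [IsProbabilityMeasure P]
        (H : Ω → Matrix (Fin K) (Fin N) ℂ) (g θ : Fin N → Ω → ℝ) (σg σθ σn : ℝ),
        0 < σn → IsModel P H g θ σg σθ →
        (∀ᵐ ω ∂P, ∀ n, |g n ω| ≤ δ ∧ |θ n ω| ≤ δ) →
        WellDefined P H (diag₁ σg g θ) (diag₂ σg g θ) ∧
        ∃ Δ : ℝ, IsOffsetLoss P H (diag₁ σg g θ) (diag₂ σg g θ) σn Δ ∧
          |Δ - lossApprox K N σg σθ| ≤ ε * (σθ ^ 2 + σg ^ 2) ∧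
          |Δ - lossLarge σg ((K : ℝ) / (N : ℝ))| ≤
            ε * (σθ ^ 2 + σg ^ 2) + simplificationError K N σg σθ := by
  obtain ⟨δ₀, hδ₀, h₀⟩ := exists_offsetLoss.{u} hK hKN hε
  have hδ : 0 < min δ₀ (1 / 2) := by positivity
  obtain ⟨C, -, h⟩ := h₀ (min δ₀ (1 / 2)) hδ (min_le_left _ _)
  refine ⟨min δ₀ (1 / 2), hδ, ?_⟩
  intro Ω _ P _ H g θ σg σθ σn hσn hM hb
  have hW : WellDefined P H (diag₁ σg g θ) (diag₂ σg g θ) := by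
    -- With all mismatches at most `1/2`, gains stay `1/2` away from `± 1` in absolute value, and
    -- `cos θ ≥ 1 - θ²/2 ≥ 7/8`.
    refine wellDefined_of_bounded_away hM.channel hK hKN σg (c := 1 / 2) (by norm_num)
      (fun n => (hM.gain.memLp n).aestronglyMeasurable.aemeasurable)
      (fun n => (hM.phase.memLp n).aestronglyMeasurable.aemeasurable) ?_
    filter_upwards [hb] with ω hω n
    have h1 := (hω n).1.trans (min_le_right _ _)
    have h2 := (hω n).2.trans (min_le_right _ _)
    constructor
    · rw [le_abs]; right; linarith
    · refine le_trans ?_ (le_abs_self _)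
      have h3 := Real.one_sub_sq_div_two_le_cos (x := θ n ω)
      rw [← sq_abs] at h3
      nlinarith [abs_nonneg (θ n ω)]
  have hτ : tailTerm P H g θ σg (min δ₀ (1 / 2)) = 0 := by
    refine setIntegral_measure_zero _ ?_
    refine measure_mono_null (t := {ω | ¬ ∀ n, |g n ω| ≤ min δ₀ (1 / 2) ∧
      |θ n ω| ≤ min δ₀ (1 / 2)}) ?_ (ae_iff.1 hb)
    rintro ω ⟨n, hn⟩ h2
    exact absurd (max_le (h2 n).1 (h2 n).2) (not_le.2 hn)
  obtain ⟨-, Δ, h1, h2, h3⟩ := h Ω P H g θ σg σθ σn hσn hM hW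
  rw [hτ, mul_zero, add_zero] at h2 h3
  exact ⟨hW, Δ, h1, h2, h3⟩

/-- The power offset loss for Gaussian gain mismatches. -/
lemma exists_offsetLoss_of_gaussian (hK : 0 < K) (hKN : K < N) {ε : ℝ} (hε : 0 < ε) :
    ∃ δ : ℝ, 0 < δ ∧
      ∀ (Ω : Type u) [MeasurableSpace Ω] (P : Measure Ω) [IsProbabilityMeasure P]
        (H : Ω → Matrix (Fin K) (Fin N) ℂ) (g θ : Fin N → Ω → ℝ) (σg σθ σn : ℝ),
        0 < σn → IsModel P H g θ σg σθ → σg ≤ δ →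
        (∀ n, HasLaw (g n) (gaussianReal 0 (Real.toNNReal (σg ^ 2))) P) →
        (∀ᵐ ω ∂P, ∀ n, |θ n ω| ≤ δ) →
        WellDefined P H (diag₁ σg g θ) (diag₂ σg g θ) ∧
        ∃ Δ : ℝ, IsOffsetLoss P H (diag₁ σg g θ) (diag₂ σg g θ) σn Δ ∧
          |Δ - lossApprox K N σg σθ| ≤ ε * (σθ ^ 2 + σg ^ 2) ∧
          |Δ - lossLarge σg ((K : ℝ) / (N : ℝ))| ≤
            ε * (σθ ^ 2 + σg ^ 2) + simplificationError K N σg σθ := by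
  -- The other half of `ε` is reserved for the tail.
  obtain ⟨δ₀, hδ₀, h₀⟩ := exists_offsetLoss.{u} hK hKN (half_pos hε)
  obtain ⟨d, hd⟩ : ∃ d, d = min δ₀ (1 / 2) := ⟨_, rfl⟩
  have hd0 : 0 < d := by rw [hd]; positivity
  have hd2 : d ≤ 1 / 2 := hd ▸ min_le_right _ _
  obtain ⟨C, hC, h⟩ := h₀ d hd0 (hd ▸ min_le_left _ _)
  obtain ⟨D, hD⟩ : ∃ D, D = (gaussianTailConst K N d).toReal := ⟨_, rfl⟩
  have hD0 : 0 ≤ D := hD ▸ ENNReal.toReal_nonneg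
  -- The cutoff `d`, and with it `C` and `D`, is fixed before `σg` is made small: then `C D σg³ ≤
  -- (ε/2) σg²`. The summand `1` only keeps the denominator positive.
  refine ⟨min d (ε / (2 * C * (D + 1))), by positivity, ?_⟩
  intro Ω _ P _ H g θ σg σθ σn hσn hM hσ hg hθ
  have hσd : σg ≤ d := hσ.trans (min_le_left _ _)
  have hσ1 : σg ≤ 1 := by linarith
  have hθd : ∀ᵐ ω ∂P, ∀ n, |θ n ω| ≤ d :=
    hθ.mono fun ω h n => (h n).trans (min_le_left _ _)
  have hW := hM.wellDefined_of_gaussian hK hKN hg hσ1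
    (hθd.mono fun ω h n => (h n).trans hd2)
  have hτ := hM.tailTerm_le_of_gaussian hK hKN hg hσ1 hd0 hd2 hθd
  obtain ⟨-, Δ, h1, h2, h3⟩ := h Ω P H g θ σg σθ σn hσn hM hW
  have hCτ : C * tailTerm P H g θ σg d ≤ ε / 2 * σg ^ 2 := by
    have h4 := hσ.trans (min_le_right _ _)
    rw [le_div_iff₀ (by positivity)] at h4
    have h5 : 0 ≤ σg * C := mul_nonneg hM.gain_nonneg hC.le
    rw [← hD] at hτ
    calc C * tailTerm P H g θ σg d ≤ C * (σg ^ 3 * D) := by gcongr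
      _ = (σg * C * D) * σg ^ 2 := by ring
      _ ≤ ε / 2 * σg ^ 2 := by
          refine mul_le_mul_of_nonneg_right ?_ (sq_nonneg _)
          linarith
  have h6 : ε / 2 * (σθ ^ 2 + σg ^ 2) + C * tailTerm P H g θ σg d ≤ ε * (σθ ^ 2 + σg ^ 2) := by
    nlinarith [mul_nonneg hε.le (sq_nonneg σθ)]
  exact ⟨hW, Δ, h1, h2.trans h6, h3.trans (by linarith)⟩

end Conclusions
end WLZF

/-! ### The theorem -/

theorem theorem1 (K N : ℕ) (hK : 0 < K) (hKN : K < N) :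
    -- exact moments, multiplexing gains, and the case without IQ imbalance
    (∀ (Ω : Type u) [MeasurableSpace Ω] (P : Measure Ω) [IsProbabilityMeasure P]
      (H : Ω → Matrix (Fin K) (Fin N) ℂ), WLZF.IsRayleigh P H →
      (Integrable (fun ω => WLZF.zfTrace (H ω)) P ∧
        ∫ ω, WLZF.zfTrace (H ω) ∂P = (K : ℂ) / ((N : ℂ) - K)) ∧
      (Integrable (fun ω => WLZF.mixedTrace (H ω)) P ∧
        ∫ ω, WLZF.mixedTrace (H ω) ∂P =
          ((K : ℂ) ^ 2 + K) / (((N : ℂ) - K) * ((N : ℂ) + 1))) ∧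
      (∀ (σg c : ℝ) (g θ : Fin N → Ω → ℝ), 0 < c →
        (∀ n, AEMeasurable (g n) P) → (∀ n, AEMeasurable (θ n) P) →
        (∀ᵐ ω ∂P, ∀ n, c ≤ |(|g n ω| - 1)| ∧ c ≤ |Real.cos (θ n ω)|) →
        WLZF.WellDefined P H (WLZF.diag₁ σg g θ) (WLZF.diag₂ σg g θ)) ∧
      ∀ σn : ℝ, 0 < σn → ∃ LZF : ℝ,
        (∀ᵐ ω ∂P, WLZF.HasMultiplexingGain (WLZF.zfRate P H σn ω) K ∧
          WLZF.HasPowerOffset (WLZF.zfRate P H σn ω) K LZF) ∧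
        (∀ a₁ a₂ : Ω → Fin N → ℂ,
          (∀ᵐ ω ∂P, Matrix.diagonal (a₁ ω) = 1 ∧ Matrix.diagonal (a₂ ω) = 0) →
          WLZF.WellDefined P H a₁ a₂ ∧
          ∀ᵐ ω ∂P, WLZF.HasMultiplexingGain (WLZF.wlRate P H a₁ a₂ σn ω) K ∧
            WLZF.HasPowerOffset (WLZF.wlRate P H a₁ a₂ σn ω) K LZF) ∧
        (∀ a₁ a₂ : Ω → Fin N → ℂ, WLZF.WellDefined P H a₁ a₂ →
          ∃ LWL : ℝ, ∀ᵐ ω ∂P, WLZF.HasMultiplexingGain (WLZF.wlRate P H a₁ a₂ σn ω) K ∧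
            WLZF.HasPowerOffset (WLZF.wlRate P H a₁ a₂ σn ω) K LWL)) ∧
    -- power offset loss, arbitrary mismatch distributions
    (∀ ε : ℝ, 0 < ε → ∃ δ C : ℝ, 0 < δ ∧ 0 < C ∧
      ∀ (Ω : Type u) [MeasurableSpace Ω] (P : Measure Ω) [IsProbabilityMeasure P]
        (H : Ω → Matrix (Fin K) (Fin N) ℂ) (g θ : Fin N → Ω → ℝ) (σg σθ σn : ℝ),
        0 < σn → WLZF.IsModel P H g θ σg σθ →
        WLZF.WellDefined P H (WLZF.diag₁ σg g θ) (WLZF.diag₂ σg g θ) →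
        ∃ Δ : ℝ, WLZF.IsOffsetLoss P H (WLZF.diag₁ σg g θ) (WLZF.diag₂ σg g θ) σn Δ ∧
          |Δ - WLZF.lossApprox K N σg σθ| ≤
            ε * (σθ ^ 2 + σg ^ 2) + C * WLZF.tailTerm P H g θ σg δ ∧
          |Δ - WLZF.lossLarge σg ((K : ℝ) / (N : ℝ))| ≤
            ε * (σθ ^ 2 + σg ^ 2) + C * WLZF.tailTerm P H g θ σg δ +
              WLZF.simplificationError K N σg σθ) ∧
    -- power offset loss, bounded mismatches
    (∀ ε : ℝ, 0 < ε → ∃ δ : ℝ, 0 < δ ∧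
      ∀ (Ω : Type u) [MeasurableSpace Ω] (P : Measure Ω) [IsProbabilityMeasure P]
        (H : Ω → Matrix (Fin K) (Fin N) ℂ) (g θ : Fin N → Ω → ℝ) (σg σθ σn : ℝ),
        0 < σn → WLZF.IsModel P H g θ σg σθ →
        (∀ᵐ ω ∂P, ∀ n, |g n ω| ≤ δ ∧ |θ n ω| ≤ δ) →
        WLZF.WellDefined P H (WLZF.diag₁ σg g θ) (WLZF.diag₂ σg g θ) ∧
        ∃ Δ : ℝ, WLZF.IsOffsetLoss P H (WLZF.diag₁ σg g θ) (WLZF.diag₂ σg g θ) σn Δ ∧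
          |Δ - WLZF.lossApprox K N σg σθ| ≤ ε * (σθ ^ 2 + σg ^ 2) ∧
          |Δ - WLZF.lossLarge σg ((K : ℝ) / (N : ℝ))| ≤
            ε * (σθ ^ 2 + σg ^ 2) + WLZF.simplificationError K N σg σθ) ∧
    -- power offset loss, Gaussian gain mismatches
    (∀ ε : ℝ, 0 < ε → ∃ δ : ℝ, 0 < δ ∧
      ∀ (Ω : Type u) [MeasurableSpace Ω] (P : Measure Ω) [IsProbabilityMeasure P]
        (H : Ω → Matrix (Fin K) (Fin N) ℂ) (g θ : Fin N → Ω → ℝ) (σg σθ σn : ℝ),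
        0 < σn → WLZF.IsModel P H g θ σg σθ → σg ≤ δ →
        (∀ n, HasLaw (g n) (gaussianReal 0 (Real.toNNReal (σg ^ 2))) P) →
        (∀ᵐ ω ∂P, ∀ n, |θ n ω| ≤ δ) →
        (K + 3 ≤ N → WLZF.WellDefined P H (WLZF.diag₁ σg g θ) (WLZF.diag₂ σg g θ)) ∧
        (WLZF.WellDefined P H (WLZF.diag₁ σg g θ) (WLZF.diag₂ σg g θ) →
        ∃ Δ : ℝ, WLZF.IsOffsetLoss P H (WLZF.diag₁ σg g θ) (WLZF.diag₂ σg g θ) σn Δ ∧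
          |Δ - WLZF.lossApprox K N σg σθ| ≤ ε * (σθ ^ 2 + σg ^ 2) ∧
          |Δ - WLZF.lossLarge σg ((K : ℝ) / (N : ℝ))| ≤
            ε * (σθ ^ 2 + σg ^ 2) + WLZF.simplificationError K N σg σθ)) := by
  refine ⟨?_, fun ε hε => ?_, fun ε hε => WLZF.exists_offsetLoss_of_bounded hK hKN hε,
    fun ε hε => ?_⟩
  · intro Ω _ P _ H hH
    refine ⟨⟨hH.integrable_comp (WLZF.integrable_zfTrace hK hKN), ?_⟩,
      ⟨hH.integrable_comp (WLZF.integrable_mixedTrace hK hKN), ?_⟩, ?_, ?_⟩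
    · rw [hH.integral_comp (F := WLZF.zfTrace) (WLZF.integrable_zfTrace hK hKN).aestronglyMeasurable]
      exact WLZF.integral_zfTrace hK hKN
    · rw [hH.integral_comp (F := WLZF.mixedTrace)
        (WLZF.integrable_mixedTrace hK hKN).aestronglyMeasurable]
      exact WLZF.integral_mixedTrace hK hKN
    · intro σg c g θ hc hg hθ h
      exact WLZF.wellDefined_of_bounded_away hH hK hKN σg hc hg hθ h
    · intro σn hσn
      refine ⟨_, hH.zfRate hK hKN hσn, fun a₁ a₂ ha => ?_, fun a₁ a₂ hW =>
        ⟨_, hW.wlRate hK hσn⟩⟩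
      have h := WLZF.wellDefined_one_zero hH hK hKN ha
      refine ⟨h.1, ?_⟩
      have hr := h.1.wlRate hK hσn
      rwa [h.2, show (2 : ℝ) / (2 * ((K : ℝ) / (N - K))) = 1 / ((K : ℝ) / (N - K)) by
        rw [← div_div, div_self two_ne_zero]] at hr
  · obtain ⟨δ₀, hδ₀, h⟩ := WLZF.exists_offsetLoss.{u} hK hKN hε
    obtain ⟨C, hC, hmain⟩ := h δ₀ hδ₀ le_rfl
    exact ⟨δ₀, C, hδ₀, hC, fun Ω _ P _ H g θ σg σθ σn hσn hM hW =>
      (hmain Ω P H g θ σg σθ σn hσn hM hW).2⟩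
  · obtain ⟨δ, hδ, h⟩ := WLZF.exists_offsetLoss_of_gaussian.{u} hK hKN hε
    refine ⟨δ, hδ, fun Ω _ P _ H g θ σg σθ σn hσn hM hσ hg hθ => ?_⟩
    have hmain := h Ω P H g θ σg σθ σn hσn hM hσ hg hθ
    exact ⟨fun _ => hmain.1, fun _ => hmain.2⟩
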